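/- Let $g\in C([0,\infty),\mathbb R)\cap C^2((0,\infty),\mathbb R)$ with $g(0)=0$ satisfy $$|sg'(s)|+|s^2g''(s)|\le C_0\bigl(s^{\alpha_1/2}+s^{\alpha_2/2}\bigr)\qquad(s>0)$$ for some $C_0>0$ and $1\le\alpha_1\le\alpha_2<\infty$, and put $f(z)=g(|z|^2)z$ for $z\in\mathbb C$. Let $\omega_*>0$, $0<a<1$, $D>0$ be such that for every $0<\omega<\omega_*$ the equation $-\varphi''+\omega\varphi=f(\varphi)$ on $\mathbb R$ has a nontrivial real-valued solution $\varphi=\varphi_\omega\in H^1(\mathbb R)$ with $$|\varphi_\omega(x)|+\omega^{-1/2}|\varphi_\omega'(x)|\le D\,\omega^{1/\alpha_1}e^{-a\omega^{1/2}|x|}\qquad(x\in\mathbb R).$$ Then for every $\rho\in(0,\infty)$ there is a constant $\lambda_0>0$, depending only on $f,C_0,\alpha_1,\alpha_2,\omega_*,a,D$ and $\rho$ (not on the choice of the family $(\varphi_\omega)$), such that for every $\lambda\in[\lambda_0,\infty)$ the following holds. There exist frequencies $\omega_j\in(0,\omega_*)$, pairwise distinct velocities $v_j\in\mathbb R$ and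 phases $\gamma_j\in\mathbb R$ $(j\in\mathbb N)$, and a function $\eta:[0,\infty)\times\mathbb R\to\mathbb C$, such that, with $$R_j(t,x)=e^{i(\omega_jt+\frac12v_jx-\frac14v_j^2t+\gamma_j)}\varphi_{\omega_j}(x-v_jt),\qquad T=\sum_{j\in\mathbb N}R_j,$$ the series $T(t,x)$ converges absolutely for every $t\ge0$ and almost every $x$, the function $u=T+\eta$ is a solution of $$i\partial_tu+\partial_x^2u+f(u)=0\qquad\text{for }t\ge0$$ (that is, $u\in C([0,\infty);L^2_{\rm loc}(\mathbb R))$, $u$ and $f(u)$ are locally integrable on $[0,\infty)\times\mathbb R$, and the equation holds in the sense of distributions on $(0,\infty)\times\mathbb R$), and $$\sup_{t\ge0}e^{\lambda t}\,\|\eta(t)\|_{L^2\cap L^\infty}\le\rho,\qquad \|w\|_{L^2\cap L^\infty}:=\|w\|_{L^2(\mathbb R)}+\|w\|_{L^\infty(\mathbb R)}.$$ -/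

import Mathlib

open MeasureTheory Set Filter Topology

noncomputable section

/-- The nonlinearity `f(z) = g(|z|²) z`. -/
def nlsF (g : ℝ → ℝ) (z : ℂ) : ℂ := (g (‖z‖ ^ 2) : ℂ) * z

/-- The assumption on the nonlinearity (in dimension one, where the only upper bound on
`α₂` is `α₂ < ∞`).  The values of `g` on the negative half-line play no role. -/
structure AssumptionF (g : ℝ → ℝ) (C₀ α₁ α₂ : ℝ) : Prop where
  continuousOn : ContinuousOn g (Ici 0)
  contDiffOn : ContDiffOn ℝ 2 g (Ioi 0)
  map_zero : g 0 = 0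
  C₀_pos : 0 < C₀
  α₁_pos : 0 < α₁
  α₁_le_α₂ : α₁ ≤ α₂
  bound : ∀ s : ℝ, 0 < s →
    |s * deriv g s| + |s ^ 2 * deriv (deriv g) s| ≤ C₀ * (s ^ (α₁ / 2) + s ^ (α₂ / 2))

/-- `ψ` is the weak derivative of `φ` on the real line. -/
def HasWeakDeriv (φ ψ : ℝ → ℝ) : Prop :=
  LocallyIntegrable φ volume ∧ LocallyIntegrable ψ volume ∧
    ∀ θ : ℝ → ℝ, ContDiff ℝ (⊤ : ℕ∞) θ → HasCompactSupport θ →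
      ∫ x, φ x * deriv θ x = -∫ x, ψ x * θ x

/-- `φ` is a nontrivial real-valued `H¹(ℝ)` function with weak derivative `φ'`, and solves
`-φ'' + ω φ = f(φ)` in the weak sense. -/
structure IsBoundState (g : ℝ → ℝ) (ω : ℝ) (φ φ' : ℝ → ℝ) : Prop where
  memLp : MemLp φ 2 volume
  memLp_deriv : MemLp φ' 2 volume
  weakDeriv : HasWeakDeriv φ φ'
  nontrivial : ¬ φ =ᵐ[volume] 0
  equation : ∀ θ : ℝ → ℝ, ContDiff ℝ (⊤ : ℕ∞) θ → HasCompactSupport θ →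
    (∫ x, φ' x * deriv θ x) + ω * ∫ x, φ x * θ x = ∫ x, g (φ x ^ 2) * φ x * θ x

/-- The assumption on the existence of small solitons in dimension one: `φ ω`, for
`0 < ω < ωs`, are bound states with the given size and exponential decay.  (A function in
`H¹(ℝ)` solving the equation has a `C²` representative, for which the almost everywhere
bound holds everywhere.) -/
structure AssumptionT (g : ℝ → ℝ) (α₁ ωs a D : ℝ) (φ : ℝ → ℝ → ℝ) : Prop where
  ωs_pos : 0 < ωs
  a_pos : 0 < a
  a_lt_one : a < 1
  D_pos : 0 < D
  exists_deriv : ∀ ω : ℝ, 0 < ω → ω < ωs → ∃ φ' : ℝ → ℝ,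
    IsBoundState g ω (φ ω) φ' ∧
    ∀ᵐ x : ℝ, |φ ω x| + ω ^ (-(1 / 2 : ℝ)) * |φ' x| ≤
      D * ω ^ (1 / α₁) * Real.exp (-a * ω ^ (1 / 2 : ℝ) * |x|)

/-- The soliton with profile `φ`, frequency `ω`, velocity `v`, initial position `x₀` and
phase `γ`: `exp(i(ωt + vx/2 - v²t/4 + γ)) φ(x - x₀ - vt)`. -/
def soliton (φ : ℝ → ℝ) (ω v x₀ γ : ℝ) (t x : ℝ) : ℂ :=
  Complex.exp (Complex.I * ((ω * t + v * x / 2 - v ^ 2 * t / 4 + γ : ℝ) : ℂ)) *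
    (φ (x - x₀ - v * t) : ℂ)

/-- `u(t,x)` is a solution of `i ∂ₜu + ∂ₓₓu + f(u) = 0` for `t ≥ 0`: `u` belongs to
`C([0,∞); L²_loc(ℝ))`, `u` and `f(u)` are locally integrable on `[0,∞) × ℝ`, and the equation
holds in the sense of distributions on `(0,∞) × ℝ`. -/
structure IsNLSSolution (g : ℝ → ℝ) (u : ℝ → ℝ → ℂ) : Prop where
  memLp_loc : ∀ t : ℝ, 0 ≤ t → ∀ r : ℝ, MemLp (u t) 2 (volume.restrict (Icc (-r) r))
  continuous_loc : ∀ t₀ : ℝ, 0 ≤ t₀ → ∀ r : ℝ,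
    Tendsto (fun t => eLpNorm (fun x => u t x - u t₀ x) 2 (volume.restrict (Icc (-r) r)))
      (𝓝[Ici 0] t₀) (𝓝 0)
  locallyIntegrable : LocallyIntegrableOn (fun p : ℝ × ℝ => u p.1 p.2) (Ici 0 ×ˢ univ) volume
  locallyIntegrable_nonlinearity :
    LocallyIntegrableOn (fun p : ℝ × ℝ => nlsF g (u p.1 p.2)) (Ici 0 ×ˢ univ) volume
  equation : ∀ χ : ℝ × ℝ → ℂ, ContDiff ℝ (⊤ : ℕ∞) χ → HasCompactSupport χ →
    tsupport χ ⊆ Ioi 0 ×ˢ univ →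
    ∫ p : ℝ × ℝ,
      (u p.1 p.2 * (-Complex.I * deriv (fun t => χ (t, p.2)) p.1 +
          iteratedDeriv 2 (fun x => χ (p.1, x)) p.2) +
        nlsF g (u p.1 p.2) * χ p) = 0

/-- The norm of `L²(ℝ) ∩ L^∞(ℝ)`, as an extended nonnegative real. -/
def normL2Linfty (w : ℝ → ℂ) : ENNReal := eLpNorm w 2 volume + eLpNorm w ⊤ volume

end

/-!
The solution is sought as a small perturbation of a soliton train with rapidly decreasing
frequencies `ω j` and rapidly increasing velocities `v j`.  Any two of the solitons then separate so
fast that the product of their sizes at time `t` is `O(exp (-2 * lam * t))`, and the smaller one is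
`O(exp (-lam * t))`, uniformly in `x`.  The remaining factor in the interaction term
`f (∑ R j) - ∑ f (R j)` is of the order of the power `α₁` of the total size of the train, which has
bounded integral because `ω j` decreases rapidly, so that the interaction is `O(exp (-lam * t))` in
`L¹ ∩ L²`.

The remainder is prescribed to vanish at `t = ∞` and solves the Duhamel equation backward from
there.  In the norm `sup exp (lam * t) * ‖η t‖` of curves in `L²` the Duhamel map is a contraction
once `lam` exceeds the Lipschitz constant of the nonlinearity on the relevant ball, and the fixed
point has size `O(1 / lam)`.  Its `L^∞` norm is controlled afterwards: the forcing decays in `L¹`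
as well, and the dispersive estimate `L¹ → L^∞` with constant `(4 * π * r) ^ (-1 / 2)` makes the
Duhamel integral `O(lam ^ (-1 / 2))`.  Both bounds are below any given size for large `lam`, and in
particular the nonlinearity may be truncated away from the values which are actually attained.
-/

open scoped FourierTransform SchwartzMap BoundedContinuousFunction

/-! ### The truncated nonlinearity -/

/-- The nonlinearity `f` with `g` frozen outside the ball of radius two: it agrees with `f` on that
ball, where all the functions of the construction take their values, and is globally Lipschitz. -/
noncomputable def truncF (g : ℝ → ℝ) (z : ℂ) : ℂ := (g ((min ‖z‖ 2) ^ 2) : ℂ) * z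

/-- `F` vanishes at zero and is Lipschitz, with a constant which is at most `L r ^ α` on the ball of
radius `r ≤ 2`. -/
structure PowerLipschitz (F : ℂ → ℂ) (L α : ℝ) : Prop where
  map_zero : F 0 = 0
  nonneg : 0 ≤ L
  one_le : 1 ≤ α
  bound : ∀ z w, ‖F z - F w‖ ≤ L * (max (min ‖z‖ 2) (min ‖w‖ 2)) ^ α * ‖z - w‖

/-- The first-order part of the assumption on the nonlinearity, near the origin only: small
solutions see nothing else of `g`.  The range `s ≤ 4` matches the truncation at `‖z‖ = 2`. -/
structure PowerDerivBound (g : ℝ → ℝ) (C α : ℝ) : Prop where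
  continuousOn : ContinuousOn g (Ici 0)
  differentiableOn : DifferentiableOn ℝ g (Ioi 0)
  map_zero : g 0 = 0
  bound : ∀ s : ℝ, 0 < s → s ≤ 4 → |s * deriv g s| ≤ C * s ^ (α / 2)

theorem truncF_eq_nlsF {g : ℝ → ℝ} {z : ℂ} (hz : ‖z‖ ≤ 2) : truncF g z = nlsF g z := by
  simp [truncF, nlsF, min_eq_left hz]

theorem AssumptionF.exists_powerDerivBound {g : ℝ → ℝ} {C₀ α₁ α₂ : ℝ}
    (hF : AssumptionF g C₀ α₁ α₂) : ∃ C : ℝ, PowerDerivBound g C α₁ := by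
  have hC₀ := hF.C₀_pos
  refine ⟨C₀ * (1 + 4 ^ ((α₂ - α₁) / 2)), hF.continuousOn,
    hF.contDiffOn.differentiableOn (by norm_num), hF.map_zero, fun s hs hs4 => ?_⟩
  have higher_power : s ^ (α₂ / 2) ≤ s ^ (α₁ / 2) * 4 ^ ((α₂ - α₁) / 2) := by
    rw [show α₂ / 2 = α₁ / 2 + (α₂ - α₁) / 2 by ring, Real.rpow_add hs]
    gcongr
    linarith [hF.α₁_le_α₂]
  calc |s * deriv g s| ≤ C₀ * (s ^ (α₁ / 2) + s ^ (α₂ / 2)) := by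
        linarith [hF.bound s hs, abs_nonneg (s ^ 2 * deriv (deriv g) s)]
    _ ≤ C₀ * (s ^ (α₁ / 2) + s ^ (α₁ / 2) * 4 ^ ((α₂ - α₁) / 2)) := by gcongr
    _ = _ := by ring

theorem le_div_mul_rpow_of_mul_deriv_le {g : ℝ → ℝ} {C β M : ℝ} (hβ : 0 < β)
    (hcont : ContinuousOn g (Icc 0 M)) (hdiff : ∀ s ∈ Ioo 0 M, DifferentiableAt ℝ g s)
    (hzero : g 0 = 0) (hbound : ∀ s ∈ Ioo 0 M, s * deriv g s ≤ C * s ^ β) {s : ℝ}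
    (hs : s ∈ Icc 0 M) : g s ≤ C / β * s ^ β := by
  have hasDeriv : ∀ x ∈ Ioo (0 : ℝ) M, HasDerivAt (fun s => C / β * s ^ β - g s)
      (C / β * (β * x ^ (β - 1)) - deriv g x) x := fun x hx =>
    ((Real.hasDerivAt_rpow_const (Or.inl hx.1.ne')).const_mul _).sub (hdiff x hx).hasDerivAt
  have mono : MonotoneOn (fun s => C / β * s ^ β - g s) (Icc 0 M) := by
    apply monotoneOn_of_deriv_nonneg (convex_Icc 0 M)
    · exact ((Real.continuous_rpow_const hβ.le).const_mul _).continuousOn.sub hcont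
    · rw [interior_Icc]
      exact fun x hx => (hasDeriv x hx).differentiableAt.differentiableWithinAt
    · rw [interior_Icc]
      intro x hx
      rw [(hasDeriv x hx).deriv, ← mul_assoc, div_mul_cancel₀ _ hβ.ne', sub_nonneg]
      refine le_of_mul_le_mul_left ((hbound x hx).trans (le_of_eq ?_)) hx.1
      rw [Real.rpow_sub_one hx.1.ne']
      field_simp [hx.1.ne']
  have := mono (left_mem_Icc.2 (hs.1.trans hs.2)) hs hs.1
  simpa [hzero, Real.zero_rpow hβ.ne'] using this

theorem abs_le_div_mul_rpow_of_abs_mul_deriv_le {g : ℝ → ℝ} {C β M : ℝ} (hβ : 0 < β)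
    (hcont : ContinuousOn g (Icc 0 M)) (hdiff : ∀ s ∈ Ioo 0 M, DifferentiableAt ℝ g s)
    (hzero : g 0 = 0) (hbound : ∀ s ∈ Ioo 0 M, |s * deriv g s| ≤ C * s ^ β) {s : ℝ}
    (hs : s ∈ Icc 0 M) : |g s| ≤ C / β * s ^ β := by
  refine abs_le'.2 ⟨le_div_mul_rpow_of_mul_deriv_le hβ hcont hdiff hzero
    (fun x hx => (le_abs_self _).trans (hbound x hx)) hs, ?_⟩
  refine le_div_mul_rpow_of_mul_deriv_le (g := fun s => -g s) hβ hcont.neg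
    (fun x hx => (hdiff x hx).neg) (by simp [hzero]) (fun x hx => ?_) hs
  rw [deriv.fun_neg, mul_neg]
  exact (neg_le_abs _).trans (hbound x hx)

theorem sq_rpow_half {r : ℝ} (hr : 0 ≤ r) (α : ℝ) : (r ^ 2) ^ (α / 2) = r ^ α := by
  rw [← Real.rpow_natCast_mul hr]
  congr 1
  push_cast
  ring

namespace PowerDerivBound

variable {g : ℝ → ℝ} {C α : ℝ}

theorem nonneg (hg : PowerDerivBound g C α) : 0 ≤ C := by
  simpa using (abs_nonneg _).trans (hg.bound 1 one_pos (by norm_num))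

theorem differentiableAt (hg : PowerDerivBound g C α) {s : ℝ} (hs : 0 < s) :
    DifferentiableAt ℝ g s :=
  hg.differentiableOn.differentiableAt (Ioi_mem_nhds hs)

theorem abs_sq_le (hg : PowerDerivBound g C α) (hα : 0 < α) {r : ℝ} (hr : 0 ≤ r) (hr2 : r ≤ 2) :
    |g (r ^ 2)| ≤ C / (α / 2) * r ^ α := by
  rw [← sq_rpow_half hr]
  exact abs_le_div_mul_rpow_of_abs_mul_deriv_le (half_pos hα)
    (hg.continuousOn.mono Icc_subset_Ici_self) (fun s hs => hg.differentiableAt hs.1) hg.map_zero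
    (fun s hs => hg.bound s hs.1 hs.2.le) (M := 4) ⟨sq_nonneg r, by nlinarith⟩

theorem abs_sub_sq_mul_le (hg : PowerDerivBound g C α) (hα : 0 < α) {r₁ r₂ : ℝ} (h0 : 0 ≤ r₂)
    (hlt : r₂ < r₁) (h2 : r₁ ≤ 2) :
    |g (r₁ ^ 2) - g (r₂ ^ 2)| * r₂ ≤ 2 * C * r₁ ^ α * (r₁ - r₂) := by
  have hC := hg.nonneg
  have hsub : 0 < r₁ - r₂ := sub_pos.2 hlt
  have hasDeriv : ∀ r ∈ Ioo r₂ r₁,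
      HasDerivAt (fun r => g (r ^ 2)) (deriv g (r ^ 2) * (2 * r)) r := fun r hr =>
    HasDerivAt.comp (h := fun r : ℝ => r ^ 2) r
      (hg.differentiableAt (pow_pos (h0.trans_lt hr.1) 2)).hasDerivAt
      (by simpa using hasDerivAt_pow 2 r)
  obtain ⟨ξ, hξ, slope⟩ := exists_hasDerivAt_eq_slope (fun r => g (r ^ 2)) _ hlt
    (hg.continuousOn.comp (continuous_pow 2).continuousOn fun x _ => sq_nonneg x) hasDeriv
  have hξ0 : 0 < ξ := h0.trans_lt hξ.1
  have deriv_le : ξ ^ 2 * |deriv g (ξ ^ 2)| ≤ C * r₁ ^ α := by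
    have := hg.bound (ξ ^ 2) (by positivity) (by nlinarith [hξ.2])
    rw [sq_rpow_half hξ0.le, abs_mul, abs_of_pos (by positivity : 0 < ξ ^ 2)] at this
    exact this.trans (by gcongr; exact hξ.2.le)
  rw [eq_div_iff hsub.ne'] at slope
  calc |g (r₁ ^ 2) - g (r₂ ^ 2)| * r₂
      = 2 * (|deriv g (ξ ^ 2)| * ξ * r₂) * (r₁ - r₂) := by
        rw [← slope, abs_mul, abs_mul, abs_of_pos (by positivity : 0 < 2 * ξ), abs_of_pos hsub]
        ring
    _ ≤ 2 * (|deriv g (ξ ^ 2)| * ξ * ξ) * (r₁ - r₂) := by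
        gcongr
        exact hξ.1.le
    _ = 2 * (ξ ^ 2 * |deriv g (ξ ^ 2)|) * (r₁ - r₂) := by ring
    _ ≤ 2 * (C * r₁ ^ α) * (r₁ - r₂) := by gcongr
    _ = _ := by ring

theorem abs_sub_min_sq_mul_norm_le (hg : PowerDerivBound g C α) (hα : 0 < α) {z w : ℂ}
    (hwz : ‖w‖ ≤ ‖z‖) :
    |g ((min ‖z‖ 2) ^ 2) - g ((min ‖w‖ 2) ^ 2)| * ‖w‖ ≤ 2 * C * (min ‖z‖ 2) ^ α * ‖z - w‖ := by
  have hC := hg.nonneg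
  rcases (min_le_min_right 2 hwz).eq_or_lt with heq | hlt
  · rw [heq, sub_self, abs_zero, zero_mul]
    positivity
  · have hw : ‖w‖ < 2 := by
      by_contra! h
      exact absurd hlt (by simp [min_eq_right h])
    rw [min_eq_left hw.le] at hlt ⊢
    refine (hg.abs_sub_sq_mul_le hα (norm_nonneg _) hlt (min_le_right _ _)).trans ?_
    gcongr
    exact (sub_le_sub_right (min_le_left _ _) _).trans (norm_sub_norm_le z w)

theorem norm_truncF_sub_le (hg : PowerDerivBound g C α) (hα : 0 < α) {z w : ℂ} (hwz : ‖w‖ ≤ ‖z‖) :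
    ‖truncF g z - truncF g w‖ ≤ (C / (α / 2) + 2 * C) * (min ‖z‖ 2) ^ α * ‖z - w‖ := by
  have split : truncF g z - truncF g w = (g ((min ‖z‖ 2) ^ 2) : ℂ) * (z - w) +
      ((g ((min ‖z‖ 2) ^ 2) - g ((min ‖w‖ 2) ^ 2) : ℝ) : ℂ) * w := by
    simp only [truncF]
    push_cast
    ring
  have coefficient : ‖(g ((min ‖z‖ 2) ^ 2) : ℂ) * (z - w)‖ ≤
      C / (α / 2) * (min ‖z‖ 2) ^ α * ‖z - w‖ := by
    rw [norm_mul, Complex.norm_real, Real.norm_eq_abs]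
    gcongr
    exact hg.abs_sq_le hα (le_min (norm_nonneg _) zero_le_two) (min_le_right _ _)
  have difference : ‖((g ((min ‖z‖ 2) ^ 2) - g ((min ‖w‖ 2) ^ 2) : ℝ) : ℂ) * w‖ ≤
      2 * C * (min ‖z‖ 2) ^ α * ‖z - w‖ := by
    rw [norm_mul, Complex.norm_real, Real.norm_eq_abs]
    exact hg.abs_sub_min_sq_mul_norm_le hα hwz
  rw [split]
  linarith [norm_add_le_of_le coefficient difference]

theorem powerLipschitz_truncF (hg : PowerDerivBound g C α) (hα : 1 ≤ α) :
    PowerLipschitz (truncF g) (C / (α / 2) + 2 * C) α := by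
  have hC := hg.nonneg
  have hα0 : 0 < α := one_pos.trans_le hα
  refine ⟨by simp [truncF], by positivity, hα, fun z w => ?_⟩
  rcases le_total ‖w‖ ‖z‖ with h | h
  · rw [max_eq_left (min_le_min_right _ h)]
    exact hg.norm_truncF_sub_le hα0 h
  · rw [max_eq_right (min_le_min_right _ h), norm_sub_rev, norm_sub_rev z w]
    exact hg.norm_truncF_sub_le hα0 h

end PowerDerivBound

/-! ### Curves in `L²` -/

section DominatedLp

variable {α E : Type*} [MeasurableSpace α] [NormedAddCommGroup E] {μ : Measure α} {p : ENNReal}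

theorem tendsto_eLpNorm_sub_of_dominated {ι : Type*} {l : Filter ι} [l.IsCountablyGenerated]
    {f : ι → α → E} {f₀ : α → E} {b : α → ℝ} (hp0 : p ≠ 0) (hp : p ≠ ⊤)
    (hf : ∀ n, AEStronglyMeasurable (f n) μ) (hf₀ : AEStronglyMeasurable f₀ μ)
    (hb : MemLp b p μ) (hbound : ∀ᶠ n in l, ∀ᵐ x ∂μ, ‖f n x - f₀ x‖ ≤ b x)
    (hlim : ∀ᵐ x ∂μ, Tendsto (fun n => f n x) l (𝓝 (f₀ x))) :
    Tendsto (fun n => eLpNorm (f n - f₀) p μ) l (𝓝 0) := by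
  have hp' : 0 < p.toReal := ENNReal.toReal_pos hp0 hp
  have power : Tendsto (fun n => ∫⁻ x, ‖(f n - f₀) x‖ₑ ^ p.toReal ∂μ) l (𝓝 (∫⁻ _, 0 ∂μ)) := by
    refine tendsto_lintegral_filter_of_dominated_convergence' (fun x => ‖b x‖ₑ ^ p.toReal)
      (Eventually.of_forall fun n => ((hf n).sub hf₀).enorm.pow_const _) ?_
      ((eLpNorm_lt_top_iff_lintegral_rpow_enorm_lt_top hp0 hp).1 hb.eLpNorm_lt_top).ne ?_
    · filter_upwards [hbound] with n hn
      filter_upwards [hn] with x hx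
      gcongr
      rw [enorm_le_iff_norm_le, Pi.sub_apply]
      exact hx.trans (le_abs_self _)
    · filter_upwards [hlim] with x hx
      have enorm_tendsto : Tendsto (fun n => ‖(f n - f₀) x‖ₑ) l (𝓝 0) := by
        rw [← tendsto_zero_iff_enorm_tendsto_zero]
        simpa using hx.sub_const (f₀ x)
      simpa [ENNReal.zero_rpow_of_pos hp'] using enorm_tendsto.ennrpow_const p.toReal
  have root := power.ennrpow_const (1 / p.toReal)
  rw [lintegral_zero, ENNReal.zero_rpow_of_pos (one_div_pos.2 hp')] at root
  exact root.congr fun n => (eLpNorm_eq_lintegral_rpow_enorm_toReal hp0 hp).symm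

theorem continuous_toLp_of_dominated {X : Type*} [TopologicalSpace X] [FirstCountableTopology X]
    [Fact (1 ≤ p)] (hp : p ≠ ⊤) {f : X → α → E} (hf : ∀ x, MemLp (f x) p μ)
    (hbound : ∀ x₀, ∃ b : α → ℝ, MemLp b p μ ∧ ∀ᶠ x in 𝓝 x₀, ∀ᵐ y ∂μ, ‖f x y‖ ≤ b y)
    (hcont : ∀ x₀, ∀ᵐ y ∂μ, ContinuousAt (fun x => f x y) x₀) :
    Continuous fun x => (hf x).toLp (f x) := by
  rw [continuous_iff_continuousAt]
  intro x₀
  rw [ContinuousAt, Lp.tendsto_Lp_iff_tendsto_eLpNorm'']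
  obtain ⟨b, hb, hbx₀⟩ := hbound x₀
  refine tendsto_eLpNorm_sub_of_dominated (b := fun y => b y + ‖f x₀ y‖)
    (one_pos.trans_le Fact.out).ne' hp (fun x => (hf x).aestronglyMeasurable)
    (hf x₀).aestronglyMeasurable (hb.add (hf x₀).norm) ?_ (hcont x₀)
  filter_upwards [hbx₀] with x hx
  filter_upwards [hx] with y hy
  exact (norm_sub_le _ _).trans (by gcongr)

end DominatedLp

/-- Complex-valued square-integrable functions on the real line. -/
abbrev L2Line : Type := Lp ℂ 2 (volume : Measure ℝ)

theorem L2Line.locallyIntegrable (w : L2Line) : LocallyIntegrable w volume :=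
  (Lp.memLp w).locallyIntegrable (by norm_num)

theorem inner_toLp_eq_integral {h : ℝ → ℂ} (hh : MemLp h 2 volume) (w : L2Line) :
    inner ℂ (hh.toLp h) w = ∫ x, (starRingEnd ℂ) (h x) * w x := by
  rw [L2.inner_def]
  refine integral_congr_ae ?_
  filter_upwards [hh.coeFn_toLp] with x hx
  rw [hx, RCLike.inner_apply, mul_comm]

/-- A sequence of bump functions on the line shrinking to zero. -/
noncomputable def bumpSeq (n : ℕ) : ContDiffBump (0 : ℝ) where
  rIn := ((n : ℝ) + 1)⁻¹
  rOut := 2 * ((n : ℝ) + 1)⁻¹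
  rIn_pos := by positivity
  rIn_lt_rOut := lt_mul_of_one_lt_left (by positivity) one_lt_two

/-- The approximate identity made of the normalized bump functions. -/
noncomputable def mollifier (n : ℕ) (x : ℝ) : ℝ := (bumpSeq n).normed volume x

theorem mollifier_nonneg (n : ℕ) (x : ℝ) : 0 ≤ mollifier n x := (bumpSeq n).nonneg_normed x

theorem contDiff_mollifier (n : ℕ) : ContDiff ℝ (⊤ : ℕ∞) (mollifier n) :=
  (bumpSeq n).contDiff_normed

theorem hasCompactSupport_mollifier (n : ℕ) : HasCompactSupport (mollifier n) :=
  (bumpSeq n).hasCompactSupport_normed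

theorem integral_mollifier_sub (n : ℕ) (x : ℝ) : ∫ y, mollifier n (x - y) = 1 := by
  rw [integral_sub_left_eq_self (fun y => mollifier n y) volume x]
  exact (bumpSeq n).integral_normed

theorem hasCompactSupport_mollifier_sub (n : ℕ) (x : ℝ) :
    HasCompactSupport fun y => mollifier n (x - y) :=
  (hasCompactSupport_mollifier n).comp_homeomorph (Homeomorph.subLeft x)

theorem contDiff_mollifier_sub (n : ℕ) (x : ℝ) :
    ContDiff ℝ (⊤ : ℕ∞) fun y => mollifier n (x - y) :=
  (contDiff_mollifier n).comp (contDiff_const.sub contDiff_id)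

theorem ae_tendsto_mollifier {E : Type*} [NormedAddCommGroup E] [NormedSpace ℝ E] [CompleteSpace E]
    {w : ℝ → E} (hw : LocallyIntegrable w volume) :
    ∀ᵐ x, Tendsto (fun n => ∫ y, mollifier n (x - y) • w y) atTop (𝓝 (w x)) := by
  have rOut_tendsto : Tendsto (fun n => (bumpSeq n).rOut) atTop (𝓝 0) := by
    have h := (tendsto_one_div_add_atTop_nhds_zero_nat (𝕜 := ℝ)).const_mul 2
    simp only [mul_zero, one_div] at h
    exact h
  filter_upwards [ContDiffBump.ae_convolution_tendsto_right_of_locallyIntegrable (φ := bumpSeq)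
    (K := 2) rOut_tendsto (Eventually.of_forall fun n => le_rfl) hw] with x hx
  refine hx.congr fun n => ?_
  rw [convolution_eq_swap]
  rfl

theorem ae_norm_le_of_norm_integral_le {E : Type*} [NormedAddCommGroup E] [NormedSpace ℝ E]
    [CompleteSpace E] {w : ℝ → E} (hw : LocallyIntegrable w volume) {C : ℝ}
    (h : ∀ θ : ℝ → ℝ, ContDiff ℝ (⊤ : ℕ∞) θ → HasCompactSupport θ → (∀ x, 0 ≤ θ x) →
      ‖∫ x, θ x • w x‖ ≤ C * ∫ x, θ x) :
    ∀ᵐ x, ‖w x‖ ≤ C := by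
  filter_upwards [ae_tendsto_mollifier hw] with x hx
  refine le_of_tendsto hx.norm (Eventually.of_forall fun n => ?_)
  simpa only [integral_mollifier_sub, mul_one] using h (fun y => mollifier n (x - y))
    (contDiff_mollifier_sub n x) (hasCompactSupport_mollifier_sub n x)
    (fun y => mollifier_nonneg n _)

theorem memLp_comp_sub_left {E : Type*} [NormedAddCommGroup E] {h : ℝ → E} (hc : Continuous h)
    (hs : HasCompactSupport h) (p : ENNReal) (x : ℝ) : MemLp (fun y => h (x - y)) p volume :=
  (hc.comp (continuous_const.sub continuous_id)).memLp_of_hasCompactSupport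
    (hs.comp_homeomorph (Homeomorph.subLeft x))

theorem continuous_toLp_comp_sub_left {E : Type*} [NormedAddCommGroup E] {h : ℝ → E}
    (hc : Continuous h) (hs : HasCompactSupport h) {p : ENNReal} [Fact (1 ≤ p)] (hp : p ≠ ⊤) :
    Continuous fun x => (memLp_comp_sub_left hc hs p x).toLp (fun y => h (x - y)) := by
  obtain ⟨M, hM⟩ := hs.exists_bound_of_continuous hc
  obtain ⟨R, hR⟩ := hs.isCompact.isBounded.subset_closedBall 0
  refine continuous_toLp_of_dominated hp _ (fun x₀ => ?_)
    fun x₀ => Eventually.of_forall fun y => (hc.comp (by fun_prop)).continuousAt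
  refine ⟨(Metric.closedBall x₀ (R + 1)).indicator fun _ => M,
    memLp_indicator_const p measurableSet_closedBall M
      (Or.inr (isCompact_closedBall x₀ (R + 1)).measure_lt_top.ne), ?_⟩
  filter_upwards [Metric.ball_mem_nhds x₀ one_pos] with x hx
  refine Eventually.of_forall fun y => ?_
  by_cases hy : y ∈ Metric.closedBall x₀ (R + 1)
  · rw [indicator_of_mem hy]
    exact hM _
  · rw [indicator_of_notMem hy, norm_le_zero_iff]
    by_contra hne
    refine hy (Metric.mem_closedBall.2 ?_)
    calc dist y x₀ ≤ dist y x + dist x x₀ := dist_triangle y x x₀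
      _ = dist (x - y) 0 + dist x x₀ := by rw [dist_comm y x, dist_zero_right, dist_eq_norm x y]
      _ ≤ R + 1 := add_le_add (hR (subset_tsupport _ hne)) (Metric.mem_ball.1 hx).le

theorem exists_measurable_representative {ζ : ℝ → L2Line} (hζ : Continuous ζ) :
    ∃ W : ℝ → ℝ → ℂ, StronglyMeasurable (fun p : ℝ × ℝ => W p.1 p.2) ∧
      ∀ t, W t =ᵐ[volume] ζ t := by
  have hc : ∀ n, Continuous fun y => (mollifier n y : ℂ) := fun n =>
    Complex.continuous_ofReal.comp (contDiff_mollifier n).continuous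
  have hs : ∀ n, HasCompactSupport fun y => (mollifier n y : ℂ) := fun n =>
    (hasCompactSupport_mollifier n).comp_left (g := fun r : ℝ => (r : ℂ)) rfl
  have mollified_measurable : ∀ n : ℕ, StronglyMeasurable fun p : ℝ × ℝ =>
      inner ℂ ((memLp_comp_sub_left (hc n) (hs n) 2 p.2).toLp _) (ζ p.1) := fun n =>
    (((continuous_toLp_comp_sub_left (hc n) (hs n) (by norm_num)).comp continuous_snd).inner
      (hζ.comp continuous_fst)).stronglyMeasurable
  refine ⟨fun t x => limUnder atTop fun n =>
      inner ℂ ((memLp_comp_sub_left (hc n) (hs n) 2 x).toLp _) (ζ t),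
    StronglyMeasurable.limUnder mollified_measurable, fun t => ?_⟩
  filter_upwards [ae_tendsto_mollifier (ζ t).locallyIntegrable] with x hx
  refine Tendsto.limUnder_eq (hx.congr fun n => ?_)
  rw [inner_toLp_eq_integral]
  simp [Complex.real_smul]

/-! ### The Schrödinger group and its dispersive estimate -/

/-- The Fourier multiplier of `exp(-i r ∂ₓ²)`. -/
noncomputable def schrodingerSymbol (r ξ : ℝ) : ℂ :=
  Complex.exp (((4 * Real.pi ^ 2 * r * ξ ^ 2 : ℝ) : ℂ) * Complex.I)

@[simp] theorem norm_schrodingerSymbol (r ξ : ℝ) : ‖schrodingerSymbol r ξ‖ = 1 :=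
  Complex.norm_exp_ofReal_mul_I _

theorem conj_schrodingerSymbol (r ξ : ℝ) :
    (starRingEnd ℂ) (schrodingerSymbol r ξ) = schrodingerSymbol (-r) ξ := by
  rw [schrodingerSymbol, schrodingerSymbol, ← Complex.exp_conj, map_mul, Complex.conj_ofReal,
    Complex.conj_I]
  congr 1
  push_cast
  ring

theorem continuous_schrodingerSymbol :
    Continuous fun p : ℝ × ℝ => schrodingerSymbol p.1 p.2 := by
  unfold schrodingerSymbol
  fun_prop

theorem iteratedDeriv_cexp_ofReal_mul_I (n : ℕ) :
    iteratedDeriv n (fun x : ℝ => Complex.exp ((x : ℂ) * Complex.I)) =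
      fun x : ℝ => Complex.I ^ n * Complex.exp ((x : ℂ) * Complex.I) := by
  induction n with
  | zero => simp
  | succ n ih =>
    rw [iteratedDeriv_succ, ih]
    ext x
    have hasDeriv : HasDerivAt (fun x : ℝ => (x : ℂ) * Complex.I) (1 * Complex.I) x :=
      (Complex.ofRealCLM.hasDerivAt (x := x)).mul_const Complex.I
    rw [(hasDeriv.cexp.const_mul (Complex.I ^ n)).deriv]
    ring

theorem hasTemperateGrowth_cexp_ofReal_mul_I :
    (fun x : ℝ => Complex.exp ((x : ℂ) * Complex.I)).HasTemperateGrowth := by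
  refine ⟨(Complex.ofRealCLM.contDiff.mul contDiff_const).cexp, fun n => ⟨0, 1, fun x => ?_⟩⟩
  rw [norm_iteratedFDeriv_eq_norm_iteratedDeriv, iteratedDeriv_cexp_ofReal_mul_I]
  simp [Complex.norm_exp_ofReal_mul_I]

theorem hasTemperateGrowth_schrodingerSymbol (r : ℝ) :
    (schrodingerSymbol r).HasTemperateGrowth := by
  have quadratic : (fun ξ : ℝ => 4 * Real.pi ^ 2 * r * ξ ^ 2).HasTemperateGrowth :=
    (Function.HasTemperateGrowth.const (4 * Real.pi ^ 2 * r)).mul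
      (Function.HasTemperateGrowth.id'.pow 2)
  exact hasTemperateGrowth_cexp_ofReal_mul_I.comp quadratic

theorem memLp_schrodingerSymbol_mul (r : ℝ) (w : L2Line) :
    MemLp (fun ξ => schrodingerSymbol r ξ * w ξ) 2 volume := by
  refine (Lp.memLp w).of_le ?_ (Eventually.of_forall fun ξ => by simp)
  exact (continuous_schrodingerSymbol.comp (Continuous.prodMk_right r)).aestronglyMeasurable.mul
    (Lp.aestronglyMeasurable w)

/-- Multiplication by the symbol of `exp(-i r ∂ₓ²)`. -/
noncomputable def schrodingerMul (r : ℝ) : L2Line →ₗᵢ[ℂ] L2Line where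
  toFun w := (memLp_schrodingerSymbol_mul r w).toLp _
  map_add' v w := by
    rw [← MemLp.toLp_add]
    apply MemLp.toLp_congr
    filter_upwards [Lp.coeFn_add v w] with ξ hξ
    rw [hξ, Pi.add_apply, Pi.add_apply, mul_add]
  map_smul' c w := by
    rw [RingHom.id_apply, ← MemLp.toLp_const_smul]
    apply MemLp.toLp_congr
    filter_upwards [Lp.coeFn_smul c w] with ξ hξ
    simp only [hξ, Pi.smul_apply, smul_eq_mul]
    ring
  norm_map' w := by
    change ‖(memLp_schrodingerSymbol_mul r w).toLp _‖ = ‖w‖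
    rw [Lp.norm_toLp, Lp.norm_def]
    congr 1
    exact eLpNorm_congr_norm_ae (Eventually.of_forall fun ξ => by simp)

theorem schrodingerMul_apply (r : ℝ) (w : L2Line) :
    schrodingerMul r w = (memLp_schrodingerSymbol_mul r w).toLp _ := rfl

theorem continuous_schrodingerMul (w : L2Line) : Continuous fun r => schrodingerMul r w := by
  refine continuous_toLp_of_dominated (by norm_num) (fun r => memLp_schrodingerSymbol_mul r w)
    (fun r₀ => ?_) fun r₀ => ?_
  · exact ⟨fun ξ => ‖w ξ‖, (Lp.memLp w).norm,
      Eventually.of_forall fun r => Eventually.of_forall fun ξ => by simp⟩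
  · exact Eventually.of_forall fun ξ => Continuous.continuousAt
      ((continuous_schrodingerSymbol.comp (Continuous.prodMk_left ξ)).mul continuous_const)

theorem inner_schrodingerMul (r : ℝ) (v w : L2Line) :
    inner ℂ v (schrodingerMul r w) =
      ∫ ξ, (starRingEnd ℂ) (v ξ) * (schrodingerSymbol r ξ * w ξ) := by
  rw [L2.inner_def]
  refine integral_congr_ae ?_
  filter_upwards [(memLp_schrodingerSymbol_mul r w).coeFn_toLp] with ξ hξ
  rw [schrodingerMul_apply, hξ, RCLike.inner_apply, mul_comm]

/-- The operator `exp(-i r ∂ₓ²)` on `L²(ℝ)`, that is, the Schrödinger evolution backward in time: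
solutions are prescribed at `t = ∞`. -/
noncomputable def schrodinger (r : ℝ) : L2Line →ₗᵢ[ℂ] L2Line :=
  (Lp.fourierTransformₗᵢ ℝ ℂ).symm.toLinearIsometry.comp
    ((schrodingerMul r).comp (Lp.fourierTransformₗᵢ ℝ ℂ).toLinearIsometry)

theorem schrodinger_apply (r : ℝ) (w : L2Line) :
    schrodinger r w = 𝓕⁻ (schrodingerMul r (𝓕 w)) := rfl

theorem continuous_schrodinger : Continuous fun p : ℝ × L2Line => schrodinger p.1 p.2 := by
  refine continuous_prod_of_continuous_lipschitzWith' _ 1 (fun r => (schrodinger r).lipschitz)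
    fun w => ?_
  exact (Lp.fourierTransformₗᵢ ℝ ℂ).symm.continuous.comp (continuous_schrodingerMul (𝓕 w))

theorem continuous_schrodinger_apply {X : Type*} [TopologicalSpace X] {f : X → ℝ} {w : X → L2Line}
    (hf : Continuous f) (hw : Continuous w) : Continuous fun x => schrodinger (f x) (w x) :=
  Continuous.comp (g := fun p : ℝ × L2Line => schrodinger p.1 p.2) (f := fun x => (f x, w x))
    continuous_schrodinger (hf.prodMk hw)

theorem inner_schrodinger (r : ℝ) (v w : L2Line) :
    inner ℂ v (schrodinger r w) = inner ℂ (𝓕 v) (schrodingerMul r (𝓕 w)) := by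
  rw [schrodinger_apply, ← Lp.inner_fourier_eq]
  congr 1
  exact (Lp.fourierTransformₗᵢ ℝ ℂ).apply_symm_apply _

/-- The operator `exp(-i r ∂ₓ²)` on Schwartz functions. -/
noncomputable def schwartzSchrodinger (r : ℝ) (h : 𝓢(ℝ, ℂ)) : 𝓢(ℝ, ℂ) :=
  SchwartzMap.fourierMultiplierCLM ℂ (schrodingerSymbol r) h

theorem fourier_schwartzSchrodinger (r : ℝ) (h : 𝓢(ℝ, ℂ)) (ξ : ℝ) :
    𝓕 (schwartzSchrodinger r h) ξ = schrodingerSymbol r ξ * 𝓕 h ξ := by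
  rw [schwartzSchrodinger, SchwartzMap.fourierMultiplierCLM_apply,
    FourierTransform.fourier_fourierInv_eq,
    SchwartzMap.smulLeftCLM_apply_apply (hasTemperateGrowth_schrodingerSymbol r), smul_eq_mul]

theorem inner_toLp_schrodinger (r : ℝ) (h : 𝓢(ℝ, ℂ)) (w : L2Line) :
    inner ℂ (h.toLp 2) (schrodinger r w) = inner ℂ ((schwartzSchrodinger (-r) h).toLp 2) w := by
  rw [inner_schrodinger, ← Lp.inner_fourier_eq ((schwartzSchrodinger (-r) h).toLp 2 volume) w,
    SchwartzMap.toLp_fourier_eq, SchwartzMap.toLp_fourier_eq, inner_schrodingerMul, L2.inner_def]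
  refine integral_congr_ae ?_
  filter_upwards [(𝓕 h).coeFn_toLp 2, (𝓕 (schwartzSchrodinger (-r) h)).coeFn_toLp 2] with ξ h1 h2
  rw [h1, h2, RCLike.inner_apply, fourier_schwartzSchrodinger, map_mul, conj_schrodingerSymbol,
    neg_neg]
  ring

/-- The integral kernel `exp(-π b ξ² + 2 π i x ξ)`.  At `b = -4 π r i` it represents
`exp(-i r ∂ₓ²)`, and for `re b > 0` it is an integrable Gaussian. -/
noncomputable def gaussianKernel (b : ℂ) (x ξ : ℝ) : ℂ :=
  Complex.exp (-Real.pi * b * ξ ^ 2 + 2 * Real.pi * (Complex.I * x) * ξ)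

theorem norm_gaussianKernel_le_one {b : ℂ} (hb : 0 ≤ b.re) (x ξ : ℝ) :
    ‖gaussianKernel b x ξ‖ ≤ 1 := by
  rw [gaussianKernel, Complex.norm_exp, Real.exp_le_one_iff,
    show (-Real.pi * b * ξ ^ 2 + 2 * Real.pi * (Complex.I * x) * ξ : ℂ) =
      ((-(Real.pi * ξ ^ 2) : ℝ) : ℂ) * b + ((2 * Real.pi * x * ξ : ℝ) : ℂ) * Complex.I by
        push_cast; ring,
    Complex.add_re, Complex.re_ofReal_mul, Complex.re_ofReal_mul, Complex.I_re, mul_zero, add_zero,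
    neg_mul, neg_nonpos]
  exact mul_nonneg (by positivity) hb

theorem integrable_gaussianKernel {b : ℂ} (hb : 0 < b.re) (x : ℝ) :
    Integrable (gaussianKernel b x) := by
  refine (integrable_cexp_quadratic (b := Real.pi * b) (by simpa using mul_pos Real.pi_pos hb)
    (2 * Real.pi * (Complex.I * x)) 0).congr (Eventually.of_forall fun ξ => ?_)
  simp only [gaussianKernel]
  congr 1
  ring

theorem norm_fourier_gaussianKernel_le {b : ℂ} (hb : 0 < b.re) (x y : ℝ) :
    ‖𝓕 (gaussianKernel b x) y‖ ≤ ‖b‖ ^ (-(1 / 2) : ℝ) := by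
  have exponent : -(Real.pi : ℂ) / b * (y + Complex.I * (Complex.I * x)) ^ 2 =
      ((-(Real.pi * (y - x) ^ 2) : ℝ) : ℂ) * b⁻¹ := by
    rw [← mul_assoc, Complex.I_mul_I]
    push_cast
    ring
  have exp_le_one :
      ‖Complex.exp (-(Real.pi : ℂ) / b * (y + Complex.I * (Complex.I * x)) ^ 2)‖ ≤ 1 := by
    rw [exponent, Complex.norm_exp, Real.exp_le_one_iff, Complex.re_ofReal_mul, Complex.inv_re,
      neg_mul, neg_nonpos]
    exact mul_nonneg (by positivity) (div_nonneg hb.le (Complex.normSq_nonneg _))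
  have norm_sqrt : ‖b ^ (1 / 2 : ℂ)‖ = ‖b‖ ^ (1 / 2 : ℝ) := by
    simpa using Complex.norm_cpow_real b (1 / 2)
  unfold gaussianKernel
  rw [fourier_gaussian_pi' hb]
  dsimp only
  rw [norm_mul, norm_div, norm_one, norm_sqrt, Real.rpow_neg (norm_nonneg _), one_div]
  exact mul_le_of_le_one_right (by positivity) exp_le_one

theorem norm_integral_gaussianKernel_mul_fourier_le_of_pos {b : ℂ} (hb : 0 < b.re) (x : ℝ)
    (h : 𝓢(ℝ, ℂ)) :
    ‖∫ ξ : ℝ, gaussianKernel b x ξ * 𝓕 h ξ‖ ≤ ‖b‖ ^ (-(1 / 2) : ℝ) * ∫ y, ‖h y‖ := by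
  have flip : ∫ ξ : ℝ, gaussianKernel b x ξ * 𝓕 h ξ =
      ∫ y : ℝ, 𝓕 (gaussianKernel b x) y * h y := by
    have := VectorFourier.integral_fourierIntegral_smul_eq_flip (L := innerₗ ℝ)
      (μ := volume) (ν := volume) Real.continuous_fourierChar continuous_inner
      (integrable_gaussianKernel hb x) h.integrable
    rw [flip_innerₗ] at this
    exact this.symm
  rw [flip, ← integral_const_mul]
  refine norm_integral_le_of_norm_le (h.integrable.norm.const_mul _)
    (Eventually.of_forall fun y => ?_)
  rw [norm_mul]
  gcongr
  exact norm_fourier_gaussianKernel_le hb x y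

theorem norm_integral_gaussianKernel_mul_fourier_le {b : ℂ} (hb : 0 ≤ b.re) (hb0 : b ≠ 0) (x : ℝ)
    (h : 𝓢(ℝ, ℂ)) :
    ‖∫ ξ : ℝ, gaussianKernel b x ξ * 𝓕 h ξ‖ ≤ ‖b‖ ^ (-(1 / 2) : ℝ) * ∫ y, ‖h y‖ := by
  have re_pos : ∀ᶠ ε : ℝ in 𝓝[>] 0, 0 < (b + ε).re := by
    filter_upwards [self_mem_nhdsWithin] with ε hε
    rw [Complex.add_re, Complex.ofReal_re]
    exact add_pos_of_nonneg_of_pos hb hε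
  have tendsto_b : Tendsto (fun ε : ℝ => b + ε) (𝓝[>] 0) (𝓝 b) := by
    have : Continuous fun ε : ℝ => b + ε := by fun_prop
    simpa using this.continuousWithinAt (s := Ioi (0 : ℝ)) (x := 0) |>.tendsto
  have continuous_kernel : ∀ ξ : ℝ, Continuous fun β => gaussianKernel β x ξ * 𝓕 h ξ := by
    intro ξ
    unfold gaussianKernel
    fun_prop
  have tendsto_lhs : Tendsto (fun ε : ℝ => ∫ ξ : ℝ, gaussianKernel (b + ε) x ξ * 𝓕 h ξ) (𝓝[>] 0)
      (𝓝 (∫ ξ : ℝ, gaussianKernel b x ξ * 𝓕 h ξ)) := by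
    refine tendsto_integral_filter_of_dominated_convergence (fun ξ => ‖𝓕 h ξ‖)
      (Eventually.of_forall fun ε => ?_) ?_ (𝓕 h).integrable.norm
      (Eventually.of_forall fun ξ => ((continuous_kernel ξ).tendsto b).comp tendsto_b)
    · refine (Continuous.mul ?_ (𝓕 h).continuous).aestronglyMeasurable
      unfold gaussianKernel
      fun_prop
    · filter_upwards [re_pos] with ε hε
      refine Eventually.of_forall fun ξ => ?_
      rw [norm_mul]
      exact mul_le_of_le_one_left (norm_nonneg _) (norm_gaussianKernel_le_one hε.le x ξ)
  have tendsto_rhs := ((tendsto_b.norm.rpow_const (p := (-(1 / 2) : ℝ))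
    (Or.inl (norm_ne_zero_iff.2 hb0))).mul_const (∫ y, ‖h y‖))
  refine le_of_tendsto_of_tendsto tendsto_lhs.norm tendsto_rhs ?_
  filter_upwards [re_pos] with ε hε
  exact norm_integral_gaussianKernel_mul_fourier_le_of_pos hε x h

theorem schwartzSchrodinger_eq_integral (r : ℝ) (h : 𝓢(ℝ, ℂ)) (x : ℝ) :
    schwartzSchrodinger r h x =
      ∫ ξ : ℝ, gaussianKernel (-((4 * Real.pi * r : ℝ) * Complex.I)) x ξ * 𝓕 h ξ := by
  rw [schwartzSchrodinger, SchwartzMap.fourierMultiplierCLM_apply, SchwartzMap.fourierInv_coe,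
    Real.fourierInv_eq']
  refine integral_congr_ae (Eventually.of_forall fun ξ => ?_)
  simp only [SchwartzMap.smulLeftCLM_apply_apply (hasTemperateGrowth_schrodingerSymbol r),
    smul_eq_mul, schrodingerSymbol, gaussianKernel, RCLike.inner_apply, conj_trivial]
  rw [← mul_assoc, ← Complex.exp_add]
  congr 2
  push_cast
  ring

theorem norm_schwartzSchrodinger_apply_le {r : ℝ} (hr : r ≠ 0) (h : 𝓢(ℝ, ℂ)) (x : ℝ) :
    ‖schwartzSchrodinger r h x‖ ≤ |r| ^ (-(1 / 2) : ℝ) * ∫ y, ‖h y‖ := by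
  have norm_b : ‖(-((4 * Real.pi * r : ℝ) * Complex.I) : ℂ)‖ = 4 * Real.pi * |r| := by
    rw [norm_neg, norm_mul, Complex.norm_I, mul_one, Complex.norm_real, Real.norm_eq_abs, abs_mul,
      abs_of_pos (by positivity)]
  rw [schwartzSchrodinger_eq_integral]
  refine (norm_integral_gaussianKernel_mul_fourier_le (by simp) ?_ x h).trans ?_
  · rw [← norm_pos_iff, norm_b]
    positivity
  · rw [norm_b]
    refine mul_le_mul_of_nonneg_right ?_ (integral_nonneg fun y => norm_nonneg _)
    refine Real.rpow_le_rpow_of_nonpos (abs_pos.2 hr) ?_ (by norm_num)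
    exact le_mul_of_one_le_left (abs_nonneg _) (by linarith [Real.pi_gt_three])

theorem norm_inner_toLp_schrodinger_le {r : ℝ} (hr : r ≠ 0) (h : 𝓢(ℝ, ℂ)) {w : L2Line}
    (hw : Integrable w volume) :
    ‖inner ℂ (h.toLp 2) (schrodinger r w)‖ ≤
      |r| ^ (-(1 / 2) : ℝ) * (∫ y, ‖h y‖) * ∫ y, ‖w y‖ := by
  rw [inner_toLp_schrodinger, SchwartzMap.toLp, inner_toLp_eq_integral, ← integral_const_mul]
  refine norm_integral_le_of_norm_le (hw.norm.const_mul _) (Eventually.of_forall fun y => ?_)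
  rw [norm_mul, RCLike.norm_conj, ← abs_neg r]
  gcongr
  exact norm_schwartzSchrodinger_apply_le (neg_ne_zero.2 hr) h y

/-! ### The Duhamel equation with data at infinity -/

theorem integral_exp_neg_mul_Ioi_zero {lam : ℝ} (hlam : 0 < lam) :
    ∫ r in Ioi (0 : ℝ), Real.exp (-lam * r) = 1 / lam := by
  rw [integral_exp_mul_Ioi (neg_lt_zero.2 hlam)]
  simp

theorem integrableOn_exp_neg_mul_Ioi_zero {lam : ℝ} (hlam : 0 < lam) :
    IntegrableOn (fun r => Real.exp (-lam * r)) (Ioi (0 : ℝ)) :=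
  integrableOn_exp_mul_Ioi (neg_lt_zero.2 hlam) 0

section Duhamel

variable {E : Type*} [NormedAddCommGroup E]

theorem integrableOn_Ioi_of_exp_decay {φ : ℝ → E} {M lam : ℝ} (hlam : 0 < lam)
    (hc : Continuous φ) (hφ : ∀ r, 0 < r → ‖φ r‖ ≤ M * Real.exp (-lam * r)) :
    IntegrableOn φ (Ioi (0 : ℝ)) :=
  Integrable.mono' ((integrableOn_exp_neg_mul_Ioi_zero hlam).const_mul M)
    hc.aestronglyMeasurable (ae_restrict_of_forall_mem measurableSet_Ioi hφ)

theorem norm_integral_Ioi_le_of_exp_decay [NormedSpace ℝ E] {φ : ℝ → E} {M lam : ℝ}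
    (hlam : 0 < lam) (hφ : ∀ r, 0 < r → ‖φ r‖ ≤ M * Real.exp (-lam * r)) :
    ‖∫ r in Ioi (0 : ℝ), φ r‖ ≤ M / lam := by
  refine (norm_integral_le_of_norm_le ((integrableOn_exp_neg_mul_Ioi_zero hlam).const_mul M)
    (ae_restrict_of_forall_mem measurableSet_Ioi hφ)).trans_eq ?_
  rw [integral_const_mul, integral_exp_neg_mul_Ioi_zero hlam, mul_one_div]

/-- A time-dependent nonlinearity that is Lipschitz in the state and decays exponentially in time at
the zero state. -/
structure IsDecayingForcing (N : ℝ → E → E) (Lip K lam : ℝ) : Prop where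
  continuous : Continuous fun p : ℝ × E => N p.1 p.2
  lip_nonneg : 0 ≤ Lip
  norm_sub_le : ∀ t v w, ‖N t v - N t w‖ ≤ Lip * ‖v - w‖
  norm_zero_le : ∀ t, 0 ≤ t → ‖N t 0‖ ≤ K * Real.exp (-lam * t)

namespace IsDecayingForcing

variable {N : ℝ → E → E} {Lip K lam : ℝ}

theorem norm_le (hN : IsDecayingForcing N Lip K lam) {t : ℝ} (ht : 0 ≤ t) {v : E} {M : ℝ}
    (hv : ‖v‖ ≤ M * Real.exp (-lam * t)) :
    ‖N t v‖ ≤ (K + Lip * M) * Real.exp (-lam * t) := by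
  have lipschitz : ‖N t v - N t 0‖ ≤ Lip * (M * Real.exp (-lam * t)) :=
    (hN.norm_sub_le t v 0).trans
      (mul_le_mul_of_nonneg_left (by rwa [sub_zero]) hN.lip_nonneg)
  linarith [norm_le_norm_add_norm_sub' (N t v) (N t 0), hN.norm_zero_le t ht]

theorem K_nonneg (hN : IsDecayingForcing N Lip K lam) : 0 ≤ K :=
  nonneg_of_mul_nonneg_left ((norm_nonneg _).trans (hN.norm_zero_le 0 le_rfl)) (Real.exp_pos _)

end IsDecayingForcing

variable [NormedSpace ℂ E]

theorem norm_exp_smul (x : ℝ) (v : E) : ‖(Real.exp x : ℂ) • v‖ = Real.exp x * ‖v‖ := by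
  rw [norm_smul, Complex.norm_real, Real.norm_eq_abs, Real.abs_exp]

/-- The integrand of the Duhamel formula with zero data at `t = ∞`, in terms of the weighted
unknown `ζ t = exp(lam t) η t`.  Negative times are identified with `0`, so that `ζ` can be a
bounded continuous function on the whole line. -/
noncomputable def weightedDuhamelIntegrand (V : ℝ → E →ₗᵢ[ℂ] E) (N : ℝ → E → E) (lam : ℝ)
    (ζ : ℝ → E) (t r : ℝ) : E :=
  V r ((Real.exp (lam * max t 0) : ℂ) •
    N (max t 0 + r) ((Real.exp (-lam * (max t 0 + r)) : ℂ) • ζ (max t 0 + r)))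

/-- The right-hand side of the weighted Duhamel formula with zero data at `t = ∞`. -/
noncomputable def weightedDuhamel (V : ℝ → E →ₗᵢ[ℂ] E) (N : ℝ → E → E) (lam : ℝ) (ζ : ℝ → E)
    (t : ℝ) : E :=
  (-Complex.I) • ∫ r in Ioi (0 : ℝ), weightedDuhamelIntegrand V N lam ζ t r

namespace IsDecayingForcing

variable {V : ℝ → E →ₗᵢ[ℂ] E} {N : ℝ → E → E} {Lip K lam : ℝ}

theorem continuous_weightedDuhamelIntegrand (hN : IsDecayingForcing N Lip K lam)
    (hV : Continuous fun p : ℝ × E => V p.1 p.2) {ζ : ℝ → E} (hζ : Continuous ζ) :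
    Continuous fun p : ℝ × ℝ => weightedDuhamelIntegrand V N lam ζ p.1 p.2 := by
  unfold weightedDuhamelIntegrand
  have time : Continuous fun p : ℝ × ℝ => max p.1 0 + p.2 := by fun_prop
  refine hV.comp (continuous_snd.prodMk (Continuous.smul (by fun_prop) ?_))
  refine hN.continuous.comp (time.prodMk (Continuous.smul ?_ (hζ.comp time)))
  fun_prop

theorem norm_weightedDuhamelIntegrand_le (hN : IsDecayingForcing N Lip K lam) (ζ : ℝ →ᵇ E)
    (t : ℝ) {r : ℝ} (hr : 0 < r) :
    ‖weightedDuhamelIntegrand V N lam ζ t r‖ ≤ (K + Lip * ‖ζ‖) * Real.exp (-lam * r) := by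
  set s := max t 0 with hs
  have state_le : ‖(Real.exp (-lam * (s + r)) : ℂ) • ζ (s + r)‖ ≤
      ‖ζ‖ * Real.exp (-lam * (s + r)) := by
    rw [norm_exp_smul, mul_comm]
    gcongr
    exact ζ.norm_coe_le_norm _
  rw [weightedDuhamelIntegrand, LinearIsometry.norm_map, norm_exp_smul, ← hs]
  calc _ ≤ Real.exp (lam * s) * ((K + Lip * ‖ζ‖) * Real.exp (-lam * (s + r))) := by
        gcongr
        exact hN.norm_le (add_nonneg (le_max_right _ _) hr.le) state_le
    _ = (K + Lip * ‖ζ‖) * (Real.exp (lam * s) * Real.exp (-lam * (s + r))) := by ring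
    _ = _ := by rw [← Real.exp_add]; ring_nf

theorem norm_weightedDuhamelIntegrand_sub_le (hN : IsDecayingForcing N Lip K lam)
    (ζ ζ' : ℝ →ᵇ E) (t r : ℝ) :
    ‖weightedDuhamelIntegrand V N lam ζ t r - weightedDuhamelIntegrand V N lam ζ' t r‖ ≤
      Lip * ‖ζ - ζ'‖ * Real.exp (-lam * r) := by
  set s := max t 0 with hs
  have hLip := hN.lip_nonneg
  rw [weightedDuhamelIntegrand, weightedDuhamelIntegrand, ← map_sub, LinearIsometry.norm_map,
    ← smul_sub, norm_exp_smul, ← hs]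
  calc _ ≤ Real.exp (lam * s) * (Lip * (Real.exp (-lam * (s + r)) * ‖ζ (s + r) - ζ' (s + r)‖)) := by
        gcongr
        refine (hN.norm_sub_le _ _ _).trans_eq ?_
        rw [← smul_sub, norm_exp_smul]
    _ ≤ Real.exp (lam * s) * (Lip * (Real.exp (-lam * (s + r)) * ‖ζ - ζ'‖)) := by
        gcongr
        exact (ζ - ζ').norm_coe_le_norm _
    _ = Lip * ‖ζ - ζ'‖ * (Real.exp (lam * s) * Real.exp (-lam * (s + r))) := by ring
    _ = _ := by rw [← Real.exp_add]; ring_nf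

theorem integrableOn_weightedDuhamelIntegrand (hN : IsDecayingForcing N Lip K lam) (hlam : 0 < lam)
    (hV : Continuous fun p : ℝ × E => V p.1 p.2) (ζ : ℝ →ᵇ E) (t : ℝ) :
    IntegrableOn (weightedDuhamelIntegrand V N lam ζ t) (Ioi (0 : ℝ)) :=
  integrableOn_Ioi_of_exp_decay hlam
    ((hN.continuous_weightedDuhamelIntegrand hV ζ.continuous).comp (Continuous.prodMk_right t))
    fun _ hr => hN.norm_weightedDuhamelIntegrand_le ζ t hr

theorem norm_weightedDuhamel_le (hN : IsDecayingForcing N Lip K lam) (hlam : 0 < lam)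
    (ζ : ℝ →ᵇ E) (t : ℝ) :
    ‖weightedDuhamel V N lam ζ t‖ ≤ (K + Lip * ‖ζ‖) / lam := by
  rw [weightedDuhamel, norm_smul, norm_neg, Complex.norm_I, one_mul]
  exact norm_integral_Ioi_le_of_exp_decay hlam
    fun r hr => hN.norm_weightedDuhamelIntegrand_le ζ t hr

theorem norm_weightedDuhamel_sub_le (hN : IsDecayingForcing N Lip K lam) (hlam : 0 < lam)
    (hV : Continuous fun p : ℝ × E => V p.1 p.2) (ζ ζ' : ℝ →ᵇ E) (t : ℝ) :
    ‖weightedDuhamel V N lam ζ t - weightedDuhamel V N lam ζ' t‖ ≤ Lip * ‖ζ - ζ'‖ / lam := by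
  rw [weightedDuhamel, weightedDuhamel, ← smul_sub, norm_smul, norm_neg, Complex.norm_I, one_mul,
    ← integral_sub (hN.integrableOn_weightedDuhamelIntegrand hlam hV ζ t)
      (hN.integrableOn_weightedDuhamelIntegrand hlam hV ζ' t)]
  exact norm_integral_Ioi_le_of_exp_decay hlam
    fun r _ => hN.norm_weightedDuhamelIntegrand_sub_le ζ ζ' t r

theorem continuous_weightedDuhamel (hN : IsDecayingForcing N Lip K lam) (hlam : 0 < lam)
    (hV : Continuous fun p : ℝ × E => V p.1 p.2) (ζ : ℝ →ᵇ E) :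
    Continuous (weightedDuhamel V N lam ζ) := by
  refine Continuous.const_smul ?_ (-Complex.I)
  refine continuous_of_dominated
    (fun t => (hN.integrableOn_weightedDuhamelIntegrand hlam hV ζ t).1)
    (fun t => ae_restrict_of_forall_mem measurableSet_Ioi fun r hr =>
      hN.norm_weightedDuhamelIntegrand_le ζ t hr)
    ((integrableOn_exp_neg_mul_Ioi_zero hlam).const_mul (K + Lip * ‖ζ‖))
    (Eventually.of_forall fun r => ?_)
  exact (hN.continuous_weightedDuhamelIntegrand hV ζ.continuous).comp (Continuous.prodMk_left r)

theorem exists_weightedDuhamel_eq [CompleteSpace E] (hN : IsDecayingForcing N Lip K lam)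
    (hlam : 0 < lam) (hlamLip : 2 * Lip ≤ lam) (hV : Continuous fun p : ℝ × E => V p.1 p.2) :
    ∃ ζ : ℝ →ᵇ E, ∀ t, ζ t = weightedDuhamel V N lam ζ t := by
  let Φ : (ℝ →ᵇ E) → (ℝ →ᵇ E) := fun ζ => BoundedContinuousFunction.ofNormedAddCommGroup
    (weightedDuhamel V N lam ζ) (hN.continuous_weightedDuhamel hlam hV ζ) _
    (hN.norm_weightedDuhamel_le hlam ζ)
  have contracting : ContractingWith (1 / 2) Φ := by
    refine ⟨by norm_num, LipschitzWith.of_dist_le_mul fun ζ ζ' => ?_⟩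
    rw [BoundedContinuousFunction.dist_le (by positivity)]
    intro t
    rw [dist_eq_norm, dist_eq_norm]
    refine (hN.norm_weightedDuhamel_sub_le hlam hV ζ ζ' t).trans ?_
    rw [div_le_iff₀ hlam]
    push_cast
    nlinarith [norm_nonneg (ζ - ζ')]
  obtain ⟨ζ, hζ⟩ : ∃ ζ, Φ ζ = ζ := ⟨_, contracting.fixedPoint_isFixedPt⟩
  exact ⟨ζ, fun t => (DFunLike.congr_fun hζ t).symm⟩

theorem norm_le_of_weightedDuhamel_eq (hN : IsDecayingForcing N Lip K lam) (hlam : 0 < lam)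
    (hlamLip : 2 * Lip ≤ lam) {ζ : ℝ →ᵇ E} (hζ : ∀ t, ζ t = weightedDuhamel V N lam ζ t) :
    ‖ζ‖ ≤ 2 * K / lam := by
  have hK := hN.K_nonneg
  have hLip := hN.lip_nonneg
  have norm_le : ‖ζ‖ ≤ (K + Lip * ‖ζ‖) / lam :=
    (BoundedContinuousFunction.norm_le (by positivity)).2 fun t =>
      hζ t ▸ hN.norm_weightedDuhamel_le hlam ζ t
  rw [le_div_iff₀ hlam] at norm_le ⊢
  nlinarith [norm_nonneg ζ]

theorem exists_decaying_duhamel_solution [CompleteSpace E] (hN : IsDecayingForcing N Lip K lam)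
    (hlam : 0 < lam) (hlamLip : 2 * Lip ≤ lam) (hV : Continuous fun p : ℝ × E => V p.1 p.2) :
    ∃ η : ℝ → E, Continuous η ∧
      (∀ t, 0 ≤ t → η t = (-Complex.I) • ∫ r in Ioi (0 : ℝ), V r (N (t + r) (η (t + r)))) ∧
      ∀ t, 0 ≤ t → ‖η t‖ ≤ 2 * K / lam * Real.exp (-lam * t) := by
  obtain ⟨ζ, hζ⟩ := hN.exists_weightedDuhamel_eq hlam hlamLip hV
  refine ⟨fun t => (Real.exp (-lam * max t 0) : ℂ) • ζ t,
    Continuous.smul (by fun_prop) ζ.continuous, fun t ht => ?_, fun t ht => ?_⟩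
  · simp only [max_eq_left ht]
    rw [hζ t, weightedDuhamel, smul_comm, ← integral_smul]
    congr 1
    refine setIntegral_congr_fun measurableSet_Ioi fun r hr => ?_
    have hs : 0 ≤ t + r := add_nonneg ht (le_of_lt hr)
    simp only [weightedDuhamelIntegrand, max_eq_left ht, max_eq_left hs]
    rw [← map_smul, smul_smul, ← Complex.ofReal_mul, ← Real.exp_add]
    simp
  · simp only [max_eq_left ht]
    rw [norm_exp_smul, mul_comm]
    gcongr
    exact (ζ.norm_coe_le_norm t).trans (hN.norm_le_of_weightedDuhamel_eq hlam hlamLip hζ)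

end IsDecayingForcing

end Duhamel

theorem integral_rpow_neg_half_mul_exp {lam : ℝ} (hlam : 0 < lam) :
    ∫ r in Ioi (0 : ℝ), r ^ (-(1 / 2) : ℝ) * Real.exp (-lam * r) = √(Real.pi / lam) := by
  have gamma := Real.integral_rpow_mul_exp_neg_mul_Ioi (a := 1 / 2) (by norm_num) hlam
  rw [show (1 / 2 - 1 : ℝ) = -(1 / 2) by norm_num, Real.Gamma_one_half_eq, ← Real.sqrt_eq_rpow,
    ← Real.sqrt_mul' _ Real.pi_pos.le] at gamma
  simp only [neg_mul, gamma]
  congr 1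
  ring

theorem integrableOn_rpow_neg_half_mul_exp {lam : ℝ} (hlam : 0 < lam) :
    IntegrableOn (fun r : ℝ => r ^ (-(1 / 2) : ℝ) * Real.exp (-lam * r)) (Ioi 0) := by
  by_contra not_integrable
  have := integral_undef not_integrable
  rw [integral_rpow_neg_half_mul_exp hlam] at this
  exact (Real.sqrt_pos.2 (by positivity)).ne' this

theorem norm_schrodinger_comp_add_le {G : ℝ → L2Line} {K lam : ℝ} (hlam : 0 ≤ lam)
    (hGK : ∀ s, 0 ≤ s → ‖G s‖ ≤ K * Real.exp (-lam * s)) {t r : ℝ} (ht : 0 ≤ t) (hr : 0 < r) :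
    ‖schrodinger r (G (t + r))‖ ≤ K * Real.exp (-lam * r) := by
  have hK : 0 ≤ K :=
    nonneg_of_mul_nonneg_left ((norm_nonneg _).trans (hGK 0 le_rfl)) (Real.exp_pos _)
  rw [LinearIsometry.norm_map]
  refine (hGK _ (add_nonneg ht hr.le)).trans ?_
  gcongr K * Real.exp ?_
  nlinarith

theorem integrableOn_schrodinger_comp_add {G : ℝ → L2Line} (hG : Continuous G) {K lam : ℝ}
    (hlam : 0 < lam) (hGK : ∀ s, 0 ≤ s → ‖G s‖ ≤ K * Real.exp (-lam * s)) {t : ℝ} (ht : 0 ≤ t) :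
    IntegrableOn (fun r => schrodinger r (G (t + r))) (Ioi 0) :=
  integrableOn_Ioi_of_exp_decay hlam
    (continuous_schrodinger_apply continuous_id (hG.comp (continuous_const.add continuous_id)))
    fun _ hr => norm_schrodinger_comp_add_le hlam.le hGK ht hr

theorem norm_integral_inner_schrodinger_le {G : ℝ → L2Line} {K₁ lam : ℝ} (hlam : 0 < lam)
    (hGi : ∀ s, 0 ≤ s → Integrable (G s))
    (hG1 : ∀ s, 0 ≤ s → ∫ x, ‖G s x‖ ≤ K₁ * Real.exp (-lam * s)) {t : ℝ} (ht : 0 ≤ t)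
    (h : 𝓢(ℝ, ℂ)) :
    ‖∫ r in Ioi (0 : ℝ), inner ℂ (h.toLp 2) (schrodinger r (G (t + r)))‖ ≤
      (∫ x, ‖h x‖) * K₁ * Real.exp (-lam * t) * √(Real.pi / lam) := by
  rw [← integral_rpow_neg_half_mul_exp hlam, ← integral_const_mul]
  refine norm_integral_le_of_norm_le ((integrableOn_rpow_neg_half_mul_exp hlam).const_mul _)
    (ae_restrict_of_forall_mem measurableSet_Ioi fun r (hr : 0 < r) => ?_)
  refine (norm_inner_toLp_schrodinger_le hr.ne' h (hGi _ (by positivity))).trans ?_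
  rw [abs_of_pos hr]
  calc _ ≤ r ^ (-(1 / 2) : ℝ) * (∫ x, ‖h x‖) * (K₁ * Real.exp (-lam * (t + r))) := by
        gcongr
        exact hG1 (t + r) (by positivity)
    _ = _ := by rw [mul_add, Real.exp_add]; ring

theorem ae_norm_le_of_duhamel {G : ℝ → L2Line} (hG : Continuous G) {K K₁ lam : ℝ} (hlam : 0 < lam)
    (hGK : ∀ s, 0 ≤ s → ‖G s‖ ≤ K * Real.exp (-lam * s))
    (hGi : ∀ s, 0 ≤ s → Integrable (G s))
    (hG1 : ∀ s, 0 ≤ s → ∫ x, ‖G s x‖ ≤ K₁ * Real.exp (-lam * s)) {t : ℝ} (ht : 0 ≤ t) {w : L2Line}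
    (hw : w = (-Complex.I) • ∫ r in Ioi (0 : ℝ), schrodinger r (G (t + r))) :
    ∀ᵐ x, ‖w x‖ ≤ K₁ * √(Real.pi / lam) * Real.exp (-lam * t) := by
  refine ae_norm_le_of_norm_integral_le w.locallyIntegrable fun θ hθ hθc hθ0 => ?_
  let h : 𝓢(ℝ, ℂ) := HasCompactSupport.toSchwartzMap (f := fun x => (θ x : ℂ))
    (hθc.comp_left (g := fun r : ℝ => (r : ℂ)) rfl) (Complex.ofRealCLM.contDiff.comp hθ)
  have h_apply : ∀ x, h x = θ x := fun x => rfl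
  have norm_h : ∫ x, ‖h x‖ = ∫ x, θ x := by
    simp only [h_apply, Complex.norm_real, Real.norm_eq_abs, abs_of_nonneg (hθ0 _)]
  have integral_eq : ∫ x, θ x • w x =
      -Complex.I * ∫ r in Ioi (0 : ℝ), inner ℂ (h.toLp 2) (schrodinger r (G (t + r))) := by
    rw [integral_inner (integrableOn_schrodinger_comp_add hG hlam hGK ht), ← inner_smul_right,
      ← hw, SchwartzMap.toLp, inner_toLp_eq_integral]
    simp [h_apply]
  rw [integral_eq, norm_mul, norm_neg, Complex.norm_I, one_mul]
  refine (norm_integral_inner_schrodinger_le hlam hGi hG1 ht h).trans_eq ?_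
  rw [norm_h]
  ring

/-! ### The distributional equation for Duhamel integrals -/

/-- Smooth compactly supported functions of time and space. -/
structure IsTest (χ : ℝ × ℝ → ℂ) : Prop where
  smooth : ContDiff ℝ (⊤ : ℕ∞) χ
  compact : HasCompactSupport χ

/-- The time derivative `∂ₜχ`. -/
noncomputable def timeDeriv (χ : ℝ × ℝ → ℂ) (p : ℝ × ℝ) : ℂ := fderiv ℝ χ p (1, 0)

/-- The space derivative `∂ₓχ`. -/
noncomputable def spaceDeriv (χ : ℝ × ℝ → ℂ) (p : ℝ × ℝ) : ℂ := fderiv ℝ χ p (0, 1)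

/-- The transpose `-i∂ₜ + ∂ₓ²` of the linear Schrödinger operator. -/
noncomputable def adjointSchrodinger (χ : ℝ × ℝ → ℂ) (p : ℝ × ℝ) : ℂ :=
  -Complex.I * timeDeriv χ p + spaceDeriv (spaceDeriv χ) p

/-- The partial inverse Fourier transform in space. -/
noncomputable def partialFourier (χ : ℝ × ℝ → ℂ) (t ξ : ℝ) : ℂ :=
  ∫ x, Complex.exp (((2 * Real.pi * x * ξ : ℝ) : ℂ) * Complex.I) * χ (t, x)

theorem integrable_indicator_Icc_const (a b M : ℝ) :
    Integrable ((Icc a b).indicator fun _ => M) volume :=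
  (integrable_indicator_iff measurableSet_Icc).2
    (integrableOn_const isCompact_Icc.measure_lt_top.ne)

theorem hasDerivAt_cexp_ofReal_mul (κ : ℂ) (x : ℝ) :
    HasDerivAt (fun x : ℝ => Complex.exp ((x : ℂ) * κ)) (Complex.exp ((x : ℂ) * κ) * κ) x := by
  simpa using ((Complex.ofRealCLM.hasDerivAt (x := x)).mul_const κ).cexp

theorem hasDerivAt_schrodingerSymbol (r ξ : ℝ) : HasDerivAt (fun r => schrodingerSymbol r ξ)
    (schrodingerSymbol r ξ * (((4 * Real.pi ^ 2 * ξ ^ 2 : ℝ) : ℂ) * Complex.I)) r := by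
  have symbol_eq : ∀ r, schrodingerSymbol r ξ =
      Complex.exp ((r : ℂ) * (((4 * Real.pi ^ 2 * ξ ^ 2 : ℝ) : ℂ) * Complex.I)) := fun r => by
    rw [schrodingerSymbol]
    congr 1
    push_cast
    ring
  simp only [symbol_eq]
  exact hasDerivAt_cexp_ofReal_mul _ r

theorem hasDerivAt_planeWave (ξ x : ℝ) :
    HasDerivAt (fun x : ℝ => Complex.exp (((2 * Real.pi * x * ξ : ℝ) : ℂ) * Complex.I))
      (((2 * Real.pi * ξ : ℝ) : ℂ) * Complex.I *
        Complex.exp (((2 * Real.pi * x * ξ : ℝ) : ℂ) * Complex.I)) x := by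
  have exponent_eq : ∀ x : ℝ, ((2 * Real.pi * x * ξ : ℝ) : ℂ) * Complex.I =
      x * (((2 * Real.pi * ξ : ℝ) : ℂ) * Complex.I) := fun x => by push_cast; ring
  simp only [exponent_eq]
  exact (hasDerivAt_cexp_ofReal_mul _ x).congr_deriv (mul_comm _ _)

namespace IsTest

variable {χ : ℝ × ℝ → ℂ}

theorem continuous (h : IsTest χ) : Continuous χ := h.smooth.continuous

theorem integrable (h : IsTest χ) : Integrable χ volume :=
  h.continuous.integrable_of_hasCompactSupport h.compact

protected theorem timeDeriv (h : IsTest χ) : IsTest (timeDeriv χ) where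
  smooth := (h.smooth.fderiv_right (by norm_num)).clm_apply contDiff_const
  compact := h.compact.fderiv_apply ℝ _

protected theorem spaceDeriv (h : IsTest χ) : IsTest (spaceDeriv χ) where
  smooth := (h.smooth.fderiv_right (by norm_num)).clm_apply contDiff_const
  compact := h.compact.fderiv_apply ℝ _

protected theorem adjointSchrodinger (h : IsTest χ) : IsTest (adjointSchrodinger χ) where
  smooth := (contDiff_const.mul h.timeDeriv.smooth).add h.spaceDeriv.spaceDeriv.smooth
  compact := (h.timeDeriv.compact.mul_left (f := fun _ => -Complex.I)).add
    h.spaceDeriv.spaceDeriv.compact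

theorem hasDerivAt_fst (h : IsTest χ) (t x : ℝ) :
    HasDerivAt (fun t => χ (t, x)) (timeDeriv χ (t, x)) t :=
  ((h.smooth.differentiable (by norm_num)) (t, x)).hasFDerivAt.comp_hasDerivAt t
    ((hasDerivAt_id t).prodMk (hasDerivAt_const t x))

theorem hasDerivAt_snd (h : IsTest χ) (t x : ℝ) :
    HasDerivAt (fun x => χ (t, x)) (spaceDeriv χ (t, x)) x :=
  ((h.smooth.differentiable (by norm_num)) (t, x)).hasFDerivAt.comp_hasDerivAt x
    ((hasDerivAt_const x t).prodMk (hasDerivAt_id x))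

theorem deriv_slice (h : IsTest χ) (t : ℝ) :
    deriv (fun x => χ (t, x)) = fun x => spaceDeriv χ (t, x) :=
  funext fun x => (h.hasDerivAt_snd t x).deriv

theorem deriv_add_iteratedDeriv_eq (h : IsTest χ) (p : ℝ × ℝ) :
    -Complex.I * deriv (fun t => χ (t, p.2)) p.1 + iteratedDeriv 2 (fun x => χ (p.1, x)) p.2 =
      adjointSchrodinger χ p := by
  rw [iteratedDeriv_succ, iteratedDeriv_one, h.deriv_slice, (h.hasDerivAt_fst p.1 p.2).deriv,
    (h.spaceDeriv.hasDerivAt_snd p.1 p.2).deriv, adjointSchrodinger]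

theorem exists_support_bound (h : IsTest χ) :
    ∃ R : ℝ, ∀ p, χ p ≠ 0 → p.1 ∈ Icc (-R) R ∧ p.2 ∈ Icc (-R) R := by
  obtain ⟨R, hR⟩ := h.compact.isCompact.isBounded.subset_closedBall 0
  refine ⟨R, fun p hp => ?_⟩
  have norm_le := hR (subset_tsupport _ hp)
  rw [mem_closedBall_zero_iff, Prod.norm_def] at norm_le
  exact ⟨abs_le.1 ((le_max_left _ _).trans norm_le), abs_le.1 ((le_max_right _ _).trans norm_le)⟩

theorem exists_indicator_bound (h : IsTest χ) : ∃ M R : ℝ,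
    (∀ t x, ‖χ (t, x)‖ ≤ (Icc (-R) R).indicator (fun _ => M) x) ∧
    ∀ t, t ∉ Icc (-R) R → ∀ x, χ (t, x) = 0 := by
  obtain ⟨M, hM⟩ := h.compact.exists_bound_of_continuous h.continuous
  obtain ⟨R, hR⟩ := h.exists_support_bound
  refine ⟨M, R, fun t x => ?_, fun t ht x => ?_⟩
  · by_cases hx : x ∈ Icc (-R) R
    · rw [indicator_of_mem hx]
      exact hM _
    · rw [indicator_of_notMem hx, norm_le_zero_iff]
      exact by_contra fun hne => hx (hR _ hne).2
  · exact by_contra fun hne => ht (hR _ hne).1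

theorem contDiff_slice (h : IsTest χ) (t : ℝ) : ContDiff ℝ (⊤ : ℕ∞) fun x => χ (t, x) :=
  h.smooth.comp (contDiff_const.prodMk contDiff_id)

theorem hasCompactSupport_slice (h : IsTest χ) (t : ℝ) : HasCompactSupport fun x => χ (t, x) := by
  obtain ⟨R, hR⟩ := h.exists_support_bound
  exact HasCompactSupport.intro isCompact_Icc fun x hx => by_contra fun hne => hx (hR _ hne).2

theorem integrable_slice (h : IsTest χ) (t : ℝ) : Integrable fun x => χ (t, x) :=
  (h.contDiff_slice t).continuous.integrable_of_hasCompactSupport (h.hasCompactSupport_slice t)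

/-- The conjugate of a time slice, as a Schwartz function. -/
noncomputable def conjSlice (h : IsTest χ) (t : ℝ) : 𝓢(ℝ, ℂ) :=
  HasCompactSupport.toSchwartzMap (f := fun x => (starRingEnd ℂ) (χ (t, x)))
    ((h.hasCompactSupport_slice t).comp_left (g := starRingEnd ℂ) (map_zero _))
    (Complex.conjCLE.contDiff.comp (h.contDiff_slice t))

@[simp] theorem conjSlice_apply (h : IsTest χ) (t x : ℝ) :
    h.conjSlice t x = (starRingEnd ℂ) (χ (t, x)) := rfl

/-- The conjugate of a time slice, as a square-integrable function.  The inner product is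
conjugate-linear in its first variable, so that pairing with `h.slice t` is integration
against `χ (t, ·)`. -/
noncomputable def slice (h : IsTest χ) (t : ℝ) : L2Line := (h.conjSlice t).toLp 2 volume

theorem inner_slice (h : IsTest χ) (t : ℝ) (w : L2Line) :
    inner ℂ (h.slice t) w = ∫ x, χ (t, x) * w x := by
  rw [slice, SchwartzMap.toLp, inner_toLp_eq_integral]
  simp

theorem continuous_slice (h : IsTest χ) : Continuous h.slice := by
  obtain ⟨M, R, norm_le, -⟩ := h.exists_indicator_bound
  refine continuous_toLp_of_dominated (by norm_num) (fun t => (h.conjSlice t).memLp 2 volume)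
    (fun t₀ => ⟨(Icc (-R) R).indicator fun _ => M, memLp_indicator_const 2 measurableSet_Icc M
      (Or.inr isCompact_Icc.measure_lt_top.ne), Eventually.of_forall fun t =>
        Eventually.of_forall fun x => ?_⟩) fun t₀ => Eventually.of_forall fun x => ?_
  · rw [conjSlice_apply, RCLike.norm_conj]
    exact norm_le t x
  · simp only [conjSlice_apply]
    exact (Complex.continuous_conj.comp
      (h.continuous.comp (Continuous.prodMk_left x))).continuousAt

theorem slice_eq_zero (h : IsTest χ) {t : ℝ} (ht : ∀ x, χ (t, x) = 0) : h.slice t = 0 := by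
  have : h.conjSlice t = 0 := by
    ext x
    simp [ht x]
  rw [slice, this]
  exact (SchwartzMap.toLpCLM ℂ ℂ 2 volume).map_zero

theorem hasCompactSupport_slice_toLp (h : IsTest χ) : HasCompactSupport h.slice := by
  obtain ⟨M, R, -, eq_zero⟩ := h.exists_indicator_bound
  exact HasCompactSupport.intro isCompact_Icc fun t ht => h.slice_eq_zero (eq_zero t ht)

theorem integrable_norm_slice (h : IsTest χ) : Integrable fun t => ‖h.slice t‖ :=
  (h.continuous_slice.integrable_of_hasCompactSupport h.hasCompactSupport_slice_toLp).norm

theorem adjointSchrodinger_eq_zero (h : IsTest χ) (hpos : ∀ t ≤ 0, ∀ x, χ (t, x) = 0) {t : ℝ}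
    (ht : t ≤ 0) (x : ℝ) : adjointSchrodinger χ (t, x) = 0 := by
  have tsupport_subset : tsupport (adjointSchrodinger χ) ⊆ tsupport χ :=
    (tsupport_add _ _).trans (union_subset
      ((tsupport_mul_subset_right (f := fun _ => -Complex.I)).trans
        (tsupport_fderiv_apply_subset ℝ _))
      ((tsupport_fderiv_apply_subset ℝ _).trans (tsupport_fderiv_apply_subset ℝ _)))
  have tsupport_subset_Ici : tsupport χ ⊆ Ici 0 ×ˢ univ :=
    closure_minimal (fun p hp => ⟨le_of_not_ge fun hneg => hp (hpos p.1 hneg p.2), mem_univ _⟩)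
      (isClosed_Ici.prod isClosed_univ)
  have eq_zero_of_neg : Iio (0 : ℝ) ⊆ {t | adjointSchrodinger χ (t, x) = 0} := fun t ht =>
    image_eq_zero_of_notMem_tsupport fun hmem =>
      not_le.2 (mem_Iio.1 ht) (mem_Ici.1 (tsupport_subset_Ici (tsupport_subset hmem)).1)
  have eq_zero_closure := closure_minimal eq_zero_of_neg (isClosed_eq
    (h.adjointSchrodinger.continuous.comp (Continuous.prodMk_left x)) continuous_const)
  rw [closure_Iio] at eq_zero_closure
  exact eq_zero_closure ht

theorem norm_planeWave_mul (h : ℝ × ℝ → ℂ) (t ξ x : ℝ) :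
    ‖Complex.exp (((2 * Real.pi * x * ξ : ℝ) : ℂ) * Complex.I) * h (t, x)‖ = ‖h (t, x)‖ := by
  rw [norm_mul, Complex.norm_exp_ofReal_mul_I, one_mul]

theorem integrable_planeWave_mul_slice (h : IsTest χ) (t ξ : ℝ) :
    Integrable fun x => Complex.exp (((2 * Real.pi * x * ξ : ℝ) : ℂ) * Complex.I) * χ (t, x) :=
  (h.integrable_slice t).mono
    (Continuous.mul (by fun_prop) (h.contDiff_slice t).continuous).aestronglyMeasurable
    (Eventually.of_forall fun x => (norm_planeWave_mul χ t ξ x).le)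

theorem continuous_partialFourier (h : IsTest χ) :
    Continuous fun p : ℝ × ℝ => partialFourier χ p.1 p.2 := by
  obtain ⟨M, R, norm_le, -⟩ := h.exists_indicator_bound
  refine continuous_of_dominated (fun p => (h.integrable_planeWave_mul_slice p.1 p.2).1)
    (fun p => Eventually.of_forall fun x => (norm_planeWave_mul χ _ _ x).trans_le (norm_le p.1 x))
    (integrable_indicator_Icc_const _ _ M) (Eventually.of_forall fun x => ?_)
  exact Continuous.mul (by fun_prop) (h.continuous.comp (continuous_fst.prodMk continuous_const))

theorem exists_norm_partialFourier_le (h : IsTest χ) : ∃ M R : ℝ,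
    ∀ t ξ, ‖partialFourier χ t ξ‖ ≤ (Icc (-R) R).indicator (fun _ => M) t := by
  obtain ⟨M, R, norm_le, eq_zero⟩ := h.exists_indicator_bound
  refine ⟨∫ x, (Icc (-R) R).indicator (fun _ => M) x, R, fun t ξ => ?_⟩
  by_cases ht : t ∈ Icc (-R) R
  · rw [indicator_of_mem ht]
    exact norm_integral_le_of_norm_le (integrable_indicator_Icc_const _ _ M)
      (Eventually.of_forall fun x => (norm_planeWave_mul χ t ξ x).trans_le (norm_le t x))
  · rw [indicator_of_notMem ht]
    simp [partialFourier, eq_zero t ht]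

theorem hasCompactSupport_partialFourier (h : IsTest χ) (ξ : ℝ) :
    HasCompactSupport fun t => partialFourier χ t ξ := by
  obtain ⟨M, R, norm_le⟩ := h.exists_norm_partialFourier_le
  refine HasCompactSupport.intro (isCompact_Icc (a := -R) (b := R)) fun t ht => ?_
  simpa only [indicator_of_notMem ht, norm_le_zero_iff] using norm_le t ξ

theorem conj_fourier_conjSlice (h : IsTest χ) (t ξ : ℝ) :
    (starRingEnd ℂ) (𝓕 (h.conjSlice t) ξ) = partialFourier χ t ξ := by
  rw [SchwartzMap.fourier_coe, Real.fourier_real_eq_integral_exp_smul, ← integral_conj]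
  refine integral_congr_ae (Eventually.of_forall fun x => ?_)
  simp only [smul_eq_mul, map_mul, conjSlice_apply, Complex.conj_conj, ← Complex.exp_conj,
    Complex.conj_ofReal, Complex.conj_I]
  congr 2
  push_cast
  ring

theorem hasDerivAt_partialFourier (h : IsTest χ) (t ξ : ℝ) :
    HasDerivAt (fun t => partialFourier χ t ξ) (partialFourier (timeDeriv χ) t ξ) t := by
  obtain ⟨M, R, norm_le, -⟩ := h.timeDeriv.exists_indicator_bound
  exact (hasDerivAt_integral_of_dominated_loc_of_deriv_le univ_mem
    (Eventually.of_forall fun s => (h.integrable_planeWave_mul_slice s ξ).1)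
    (h.integrable_planeWave_mul_slice t ξ) (h.timeDeriv.integrable_planeWave_mul_slice t ξ).1
    (Eventually.of_forall fun x s _ =>
      (norm_planeWave_mul (timeDeriv χ) s ξ x).trans_le (norm_le s x))
    (integrable_indicator_Icc_const _ _ M)
    (Eventually.of_forall fun x s _ => (h.hasDerivAt_fst s x).const_mul _)).2

theorem partialFourier_spaceDeriv (h : IsTest χ) (t ξ : ℝ) :
    partialFourier (spaceDeriv χ) t ξ =
      -(((2 * Real.pi * ξ : ℝ) : ℂ) * Complex.I) * partialFourier χ t ξ := by
  have integrable_deriv_mul := (h.integrable_planeWave_mul_slice t ξ).const_mul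
    (((2 * Real.pi * ξ : ℝ) : ℂ) * Complex.I)
  simp only [← mul_assoc] at integrable_deriv_mul
  unfold partialFourier
  rw [integral_mul_deriv_eq_deriv_mul_of_integrable (fun x _ => hasDerivAt_planeWave ξ x)
    (fun x _ => h.hasDerivAt_snd t x)
    (h.spaceDeriv.integrable_planeWave_mul_slice t ξ) integrable_deriv_mul
    (h.integrable_planeWave_mul_slice t ξ), neg_mul, ← integral_const_mul]
  simp only [mul_assoc]

theorem partialFourier_adjointSchrodinger (h : IsTest χ) (t ξ : ℝ) :
    partialFourier (adjointSchrodinger χ) t ξ = -Complex.I * partialFourier (timeDeriv χ) t ξ -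
      ((4 * Real.pi ^ 2 * ξ ^ 2 : ℝ) : ℂ) * partialFourier χ t ξ := by
  have linear : partialFourier (adjointSchrodinger χ) t ξ =
      -Complex.I * partialFourier (timeDeriv χ) t ξ +
        partialFourier (spaceDeriv (spaceDeriv χ)) t ξ := by
    unfold partialFourier
    rw [← integral_const_mul, ← integral_add
      ((h.timeDeriv.integrable_planeWave_mul_slice t ξ).const_mul _)
      (h.spaceDeriv.spaceDeriv.integrable_planeWave_mul_slice t ξ)]
    refine integral_congr_ae (Eventually.of_forall fun x => ?_)
    simp only [adjointSchrodinger]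
    ring
  rw [linear, h.spaceDeriv.partialFourier_spaceDeriv, h.partialFourier_spaceDeriv]
  push_cast
  linear_combination (2 * (Real.pi : ℂ) * ξ) ^ 2 * partialFourier χ t ξ * Complex.I_mul_I

theorem hasDerivAt_partialFourier_mul_schrodingerSymbol (h : IsTest χ) (s ξ r : ℝ) :
    HasDerivAt (fun r => Complex.I * (partialFourier χ (s - r) ξ * schrodingerSymbol r ξ))
      (partialFourier (adjointSchrodinger χ) (s - r) ξ * schrodingerSymbol r ξ) r := by
  have deriv_fourier : HasDerivAt (fun r => partialFourier χ (s - r) ξ)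
      ((-1 : ℝ) • partialFourier (timeDeriv χ) (s - r) ξ) r :=
    (h.hasDerivAt_partialFourier (s - r) ξ).scomp r ((hasDerivAt_id r).const_sub s)
  refine ((deriv_fourier.mul (hasDerivAt_schrodingerSymbol r ξ)).const_mul
    Complex.I).congr_deriv ?_
  rw [h.partialFourier_adjointSchrodinger]
  simp only [Complex.real_smul]
  push_cast
  linear_combination ((4 * (Real.pi : ℂ) ^ 2 * ξ ^ 2) * partialFourier χ (s - r) ξ *
    schrodingerSymbol r ξ) * Complex.I_mul_I

theorem integral_partialFourier_adjointSchrodinger (h : IsTest χ) (s ξ : ℝ) :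
    ∫ r in Ioi (0 : ℝ), partialFourier (adjointSchrodinger χ) (s - r) ξ * schrodingerSymbol r ξ =
      -Complex.I * partialFourier χ s ξ := by
  have hasCompactSupport : ∀ {ψ : ℝ × ℝ → ℂ}, IsTest ψ →
      HasCompactSupport fun r => partialFourier ψ (s - r) ξ * schrodingerSymbol r ξ := fun hψ =>
    ((hψ.hasCompactSupport_partialFourier ξ).comp_homeomorph (Homeomorph.subLeft s)).mul_right
  have continuous : Continuous fun r =>
      partialFourier (adjointSchrodinger χ) (s - r) ξ * schrodingerSymbol r ξ :=
    (h.adjointSchrodinger.continuous_partialFourier.comp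
      (by fun_prop : Continuous fun r : ℝ => (s - r, ξ))).mul
        (continuous_schrodingerSymbol.comp (Continuous.prodMk_left ξ))
  have tendsto_zero : Tendsto
      (fun r => Complex.I * (partialFourier χ (s - r) ξ * schrodingerSymbol r ξ)) atTop (𝓝 0) :=
    ((hasCompactSupport h).mul_left (f := fun _ => Complex.I)).is_zero_at_infty.mono_left
      atTop_le_cocompact
  rw [integral_Ioi_of_hasDerivAt_of_tendsto'
    (fun r _ => h.hasDerivAt_partialFourier_mul_schrodingerSymbol s ξ r)
    (continuous.integrable_of_hasCompactSupport
      (hasCompactSupport h.adjointSchrodinger)).integrableOn tendsto_zero]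
  simp [schrodingerSymbol]

theorem inner_slice_schrodinger_toLp (h : IsTest χ) (t r : ℝ) (W : 𝓢(ℝ, ℂ)) :
    inner ℂ (h.slice t) (schrodinger r (W.toLp 2 volume)) =
      ∫ ξ, partialFourier χ t ξ * (schrodingerSymbol r ξ * 𝓕 W ξ) := by
  rw [inner_schrodinger, slice, SchwartzMap.toLp_fourier_eq, SchwartzMap.toLp_fourier_eq,
    inner_schrodingerMul]
  refine integral_congr_ae ?_
  filter_upwards [(𝓕 (h.conjSlice t)).coeFn_toLp 2 volume, (𝓕 W).coeFn_toLp 2 volume]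
    with ξ hχ hW
  rw [hχ, hW, conj_fourier_conjSlice]

theorem inner_slice_toLp (h : IsTest χ) (t : ℝ) (W : 𝓢(ℝ, ℂ)) :
    inner ℂ (h.slice t) (W.toLp 2 volume) = ∫ ξ, partialFourier χ t ξ * 𝓕 W ξ := by
  rw [slice, ← Lp.inner_fourier_eq, SchwartzMap.toLp_fourier_eq, SchwartzMap.toLp_fourier_eq,
    L2.inner_def]
  refine integral_congr_ae ?_
  filter_upwards [(𝓕 (h.conjSlice t)).coeFn_toLp 2 volume, (𝓕 W).coeFn_toLp 2 volume]
    with ξ hχ hW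
  rw [hχ, hW, RCLike.inner_apply, conj_fourier_conjSlice, mul_comm]

theorem integrable_partialFourier_mul (h : IsTest χ) (s : ℝ) (W : 𝓢(ℝ, ℂ)) :
    Integrable (Function.uncurry fun r ξ =>
      partialFourier χ (s - r) ξ * (schrodingerSymbol r ξ * 𝓕 W ξ))
      ((volume.restrict (Ioi 0)).prod volume) := by
  obtain ⟨M, R, norm_le⟩ := h.exists_norm_partialFourier_le
  have continuous : Continuous fun p : ℝ × ℝ =>
      partialFourier χ (s - p.1) p.2 * (schrodingerSymbol p.1 p.2 * 𝓕 W p.2) := by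
    refine Continuous.mul ?_
      (continuous_schrodingerSymbol.mul ((𝓕 W).continuous.comp continuous_snd))
    exact h.continuous_partialFourier.comp
      (by fun_prop : Continuous fun p : ℝ × ℝ => (s - p.1, p.2))
  refine ((((integrable_indicator_Icc_const (-R) R M).comp_sub_left s).restrict).mul_prod
    (𝓕 W).integrable.norm).mono' continuous.aestronglyMeasurable
    (Eventually.of_forall fun p => ?_)
  simp only [Function.uncurry, norm_mul, norm_schrodingerSymbol, one_mul]
  gcongr
  exact norm_le _ _

theorem integral_inner_slice_schrodinger_toLp (h : IsTest χ) (s : ℝ) (W : 𝓢(ℝ, ℂ)) :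
    ∫ r in Ioi (0 : ℝ), inner ℂ (h.adjointSchrodinger.slice (s - r))
        (schrodinger r (W.toLp 2 volume)) =
      -Complex.I * inner ℂ (h.slice s) (W.toLp 2 volume) := by
  simp_rw [inner_slice_schrodinger_toLp, inner_slice_toLp]
  rw [integral_integral_swap (h.adjointSchrodinger.integrable_partialFourier_mul s W),
    ← integral_const_mul]
  simp_rw [← mul_assoc, integral_mul_const, h.integral_partialFourier_adjointSchrodinger]

theorem integral_inner_slice_schrodinger (h : IsTest χ) (s : ℝ) (w : L2Line) :
    ∫ r in Ioi (0 : ℝ), inner ℂ (h.adjointSchrodinger.slice (s - r)) (schrodinger r w) =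
      -Complex.I * inner ℂ (h.slice s) w := by
  refine DenseRange.induction_on (p := fun w : L2Line =>
    ∫ r in Ioi (0 : ℝ), inner ℂ (h.adjointSchrodinger.slice (s - r)) (schrodinger r w) =
      -Complex.I * inner ℂ (h.slice s) w)
    (SchwartzMap.denseRange_toLpCLM (F := ℂ) (p := 2) (μ := (volume : Measure ℝ))
      ENNReal.ofNat_ne_top) w ?_ fun W => h.integral_inner_slice_schrodinger_toLp s W
  refine isClosed_eq ?_ (continuous_const.mul (continuous_const.inner continuous_id))
  have continuous_slice : Continuous fun r => h.adjointSchrodinger.slice (s - r) :=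
    h.adjointSchrodinger.continuous_slice.comp (by fun_prop)
  rw [continuous_iff_continuousAt]
  intro w₀
  refine continuousAt_of_dominated
    (bound := fun r => ‖h.adjointSchrodinger.slice (s - r)‖ * (‖w₀‖ + 1))
    (Eventually.of_forall fun w => ?_) ?_ ?_ (Eventually.of_forall fun r => ?_)
  · exact (continuous_slice.inner
      (continuous_schrodinger_apply continuous_id continuous_const)).aestronglyMeasurable
  · filter_upwards [Metric.ball_mem_nhds w₀ one_pos] with w hw
    refine Eventually.of_forall fun r => (norm_inner_le_norm _ _).trans ?_
    rw [LinearIsometry.norm_map]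
    gcongr
    rw [Metric.mem_ball, dist_eq_norm] at hw
    linarith [norm_le_norm_add_norm_sub' w w₀]
  · exact ((h.adjointSchrodinger.integrable_norm_slice.comp_sub_left s).mul_const _).restrict
  · exact (continuous_const.inner (schrodinger r).continuous).continuousAt

theorem integrable_inner_slice_schrodinger_comp_add (h : IsTest χ)
    (hpos : ∀ t ≤ 0, ∀ x, χ (t, x) = 0) {G : ℝ → L2Line} (hG : Continuous G) {K lam : ℝ}
    (hlam : 0 < lam) (hGK : ∀ s, 0 ≤ s → ‖G s‖ ≤ K * Real.exp (-lam * s)) :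
    Integrable (Function.uncurry fun r t => inner ℂ (h.slice t) (schrodinger r (G (t + r))))
      ((volume.restrict (Ioi (0 : ℝ))).prod volume) := by
  have majorant : Integrable (fun p : ℝ × ℝ => K * Real.exp (-lam * p.1) * ‖h.slice p.2‖)
      ((volume.restrict (Ioi (0 : ℝ))).prod volume) :=
    Integrable.mul_prod (f := fun r => K * Real.exp (-lam * r))
      ((integrableOn_exp_neg_mul_Ioi_zero hlam).const_mul K) h.integrable_norm_slice
  have continuous : Continuous fun p : ℝ × ℝ =>
      inner ℂ (h.slice p.2) (schrodinger p.1 (G (p.2 + p.1))) :=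
    (h.continuous_slice.comp continuous_snd).inner (continuous_schrodinger_apply continuous_fst
      (hG.comp (continuous_snd.add continuous_fst)))
  have fst_pos : ∀ᵐ p ∂((volume.restrict (Ioi (0 : ℝ))).prod (volume : Measure ℝ)), 0 < p.1 :=
    Measure.quasiMeasurePreserving_fst.ae (self_mem_ae_restrict measurableSet_Ioi)
  refine majorant.mono' continuous.aestronglyMeasurable ?_
  filter_upwards [fst_pos] with p hp
  rcases le_or_gt p.2 0 with ht | ht
  · simp [Function.uncurry, h.slice_eq_zero (hpos _ ht)]
  · refine (norm_inner_le_norm _ _).trans ?_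
    rw [mul_comm]
    gcongr
    exact norm_schrodinger_comp_add_le hlam.le hGK ht.le hp

theorem integral_inner_slice_duhamel (h : IsTest χ) (hpos : ∀ t ≤ 0, ∀ x, χ (t, x) = 0)
    {G η : ℝ → L2Line} (hG : Continuous G) {K lam : ℝ} (hlam : 0 < lam)
    (hGK : ∀ s, 0 ≤ s → ‖G s‖ ≤ K * Real.exp (-lam * s))
    (hη : ∀ t, 0 ≤ t → η t = (-Complex.I) • ∫ r in Ioi (0 : ℝ), schrodinger r (G (t + r))) :
    ∫ t, inner ℂ (h.adjointSchrodinger.slice t) (η t) = -∫ t, inner ℂ (h.slice t) (G t) := by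
  set μ : Measure ℝ := volume.restrict (Ioi 0)
  set f : ℝ → ℝ → ℂ :=
    fun r t => inner ℂ (h.adjointSchrodinger.slice t) (schrodinger r (G (t + r))) with f_def
  have hpos_adjoint : ∀ t ≤ 0, ∀ x, adjointSchrodinger χ (t, x) = 0 := fun t ht =>
    h.adjointSchrodinger_eq_zero hpos ht
  have integrable_f : Integrable (Function.uncurry f) (μ.prod volume) :=
    h.adjointSchrodinger.integrable_inner_slice_schrodinger_comp_add hpos_adjoint hG hlam hGK
  have integrable_shift : Integrable (Function.uncurry fun r s => f r (-r + s)) (μ.prod volume) :=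
    (measurePreserving_prod_neg_add μ (volume : Measure ℝ)).integrable_comp_of_integrable
      integrable_f
  have inner_η : ∀ t, inner ℂ (h.adjointSchrodinger.slice t) (η t) =
      -Complex.I * ∫ r, f r t ∂μ := fun t => by
    rcases le_or_gt t 0 with ht | ht
    · simp [f_def, h.adjointSchrodinger.slice_eq_zero (hpos_adjoint t ht)]
    · rw [hη t ht.le, inner_smul_right,
        integral_inner (integrableOn_schrodinger_comp_add hG hlam hGK ht.le)]
  have integral_f_shift : ∀ s, ∫ r, f r (-r + s) ∂μ = -Complex.I * inner ℂ (h.slice s) (G s) :=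
    fun s => by
      simp only [f_def, ← h.integral_inner_slice_schrodinger s (G s), neg_add_eq_sub,
        sub_add_cancel, μ]
  calc ∫ t, inner ℂ (h.adjointSchrodinger.slice t) (η t)
      = -Complex.I * ∫ t, ∫ r, f r t ∂μ := by simp only [inner_η, integral_const_mul]
    _ = -Complex.I * ∫ r, (∫ t, f r t) ∂μ := by rw [integral_integral_swap integrable_f]
    _ = -Complex.I * ∫ r, (∫ s, f r (-r + s)) ∂μ := by
        simp only [integral_add_left_eq_self]
    _ = -Complex.I * ∫ s, ∫ r, f r (-r + s) ∂μ := by rw [integral_integral_swap integrable_shift]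
    _ = -∫ t, inner ℂ (h.slice t) (G t) := by
        simp only [integral_f_shift, integral_const_mul]
        rw [← mul_assoc, neg_mul_neg, Complex.I_mul_I, neg_one_mul]

end IsTest

/-! ### Solitons as distributional solutions -/

namespace HasWeakDeriv

variable {φ ψ : ℝ → ℝ}

theorem hasDerivAt_mollify (h : HasWeakDeriv φ ψ) (n : ℕ) (x : ℝ) :
    HasDerivAt (fun x => ∫ y, mollifier n (x - y) • φ y) (∫ y, ψ y * mollifier n (x - y)) x := by
  have convolution_deriv := (hasCompactSupport_mollifier n).hasDerivAt_convolution_left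
    (ContinuousLinearMap.lsmul ℝ ℝ) ((contDiff_mollifier n).of_le (by norm_num)) h.1 x
  have deriv_reflect : deriv (fun y => mollifier n (x - y)) =
      fun y => -deriv (mollifier n) (x - y) := funext (deriv_comp_const_sub (mollifier n) x)
  have weak_deriv := h.2.2 (fun y => mollifier n (x - y)) (contDiff_mollifier_sub n x)
    (hasCompactSupport_mollifier_sub n x)
  simp only [deriv_reflect, mul_neg, integral_neg, neg_inj] at weak_deriv
  rw [convolution_eq_swap] at convolution_deriv
  refine (convolution_deriv.congr_of_eventuallyEq
    (Eventually.of_forall fun x => ?_)).congr_deriv (weak_deriv ▸ ?_)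
  · rw [convolution_eq_swap]
    rfl
  · exact integral_congr_ae (Eventually.of_forall fun y => mul_comm _ _)

theorem lipschitzWith_mollify (h : HasWeakDeriv φ ψ) {M : NNReal} (hM : ∀ᵐ x, |ψ x| ≤ M)
    (n : ℕ) : LipschitzWith M fun x => ∫ y, mollifier n (x - y) • φ y := by
  refine lipschitzWith_of_nnnorm_deriv_le
    (fun x => (h.hasDerivAt_mollify n x).differentiableAt) fun x => ?_
  rw [← NNReal.coe_le_coe, coe_nnnorm, (h.hasDerivAt_mollify n x).deriv]
  have integrable_mollifier : Integrable fun y => mollifier n (x - y) :=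
    (contDiff_mollifier_sub n x).continuous.integrable_of_hasCompactSupport
      (hasCompactSupport_mollifier_sub n x)
  refine (norm_integral_le_of_norm_le (integrable_mollifier.const_mul (M : ℝ)) ?_).trans_eq ?_
  · filter_upwards [hM] with y hy
    rw [norm_mul, Real.norm_of_nonneg (mollifier_nonneg n _)]
    exact mul_le_mul_of_nonneg_right hy (mollifier_nonneg n _)
  · rw [integral_const_mul, integral_mollifier_sub, mul_one]

theorem exists_lipschitzWith_ae_eq (h : HasWeakDeriv φ ψ) {M : NNReal}
    (hM : ∀ᵐ x, |ψ x| ≤ M) : ∃ φ₁ : ℝ → ℝ, LipschitzWith M φ₁ ∧ φ =ᵐ[volume] φ₁ := by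
  have lipschitzOn : LipschitzOnWith M φ
      {x | Tendsto (fun n => ∫ y, mollifier n (x - y) • φ y) atTop (𝓝 (φ x))} :=
    LipschitzOnWith.of_dist_le_mul fun x hx y hy => le_of_tendsto (hx.dist hy)
      (Eventually.of_forall fun n => (h.lipschitzWith_mollify hM n).dist_le_mul x y)
  obtain ⟨φ₁, lipschitz, eqOn⟩ := lipschitzOn.extend_real
  exact ⟨φ₁, lipschitz, (ae_tendsto_mollifier h.1).mono fun x hx => eqOn hx⟩

end HasWeakDeriv

theorem le_of_ae_le_of_continuous {a b : ℝ → ℝ} (ha : Continuous a) (hb : Continuous b)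
    (h : ∀ᵐ x, a x ≤ b x) (x : ℝ) : a x ≤ b x :=
  closure_minimal subset_rfl (isClosed_le ha hb) (Measure.dense_of_ae h x)

/-- Continuous bound state profiles, with the equation tested against smooth functions. -/
structure IsProfile (g : ℝ → ℝ) (ω : ℝ) (φ : ℝ → ℝ) : Prop where
  continuous : Continuous φ
  equation : ∀ θ : ℝ → ℝ, ContDiff ℝ (⊤ : ℕ∞) θ → HasCompactSupport θ →
    (∫ x, φ x * deriv (deriv θ) x) = (ω * ∫ x, φ x * θ x) - ∫ x, g (φ x ^ 2) * φ x * θ x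

theorem IsBoundState.isProfile_of_ae_eq {g : ℝ → ℝ} {ω : ℝ} {φ φ' φ₁ : ℝ → ℝ}
    (hb : IsBoundState g ω φ φ') (hφ₁ : Continuous φ₁) (hae : φ =ᵐ[volume] φ₁) :
    IsProfile g ω φ₁ where
  continuous := hφ₁
  equation θ hθ hθc := by
    have integral_eq : ∀ P : ℝ → ℝ → ℝ, ∫ x, P (φ₁ x) x = ∫ x, P (φ x) x := fun P =>
      integral_congr_ae (hae.mono fun x hx => by simp only [hx])
    rw [integral_eq fun y x => y * deriv (deriv θ) x, integral_eq fun y x => y * θ x,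
      integral_eq fun y x => g (y ^ 2) * y * θ x]
    linarith [hb.weakDeriv.2.2 (deriv θ) (contDiff_infty_iff_deriv.1 hθ).2 hθc.deriv,
      hb.equation θ hθ hθc]

theorem AssumptionT.exists_profile {g : ℝ → ℝ} {α₁ ωs a D : ℝ} {φ : ℝ → ℝ → ℝ}
    (hT : AssumptionT g α₁ ωs a D φ) {ω : ℝ} (hω : 0 < ω) (hωs : ω < ωs) :
    ∃ φ₁ : ℝ → ℝ, IsProfile g ω φ₁ ∧ φ ω =ᵐ[volume] φ₁ ∧
      ∀ x, |φ₁ x| ≤ D * ω ^ (1 / α₁) * Real.exp (-a * ω ^ (1 / 2 : ℝ) * |x|) := by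
  obtain ⟨φ', hb, hbound⟩ := hT.exists_deriv ω hω hωs
  have hD := hT.D_pos
  have ha := hT.a_pos
  have rpow_pos : 0 < ω ^ (-(1 / 2 : ℝ)) := Real.rpow_pos_of_pos hω _
  have deriv_bound : ∀ᵐ x, |φ' x| ≤ ((D * ω ^ (1 / α₁) / ω ^ (-(1 / 2 : ℝ))).toNNReal : ℝ) := by
    filter_upwards [hbound] with x hx
    rw [Real.coe_toNNReal _ (by positivity), le_div_iff₀ rpow_pos, mul_comm]
    have decay_le_one : Real.exp (-a * ω ^ (1 / 2 : ℝ) * |x|) ≤ 1 := by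
      rw [Real.exp_le_one_iff, neg_mul, neg_mul, neg_nonpos]
      positivity
    exact (le_add_of_nonneg_left (abs_nonneg _)).trans
      (hx.trans (mul_le_of_le_one_right (by positivity) decay_le_one))
  obtain ⟨φ₁, lipschitz, hae⟩ := hb.weakDeriv.exists_lipschitzWith_ae_eq deriv_bound
  refine ⟨φ₁, hb.isProfile_of_ae_eq lipschitz.continuous hae, hae,
    le_of_ae_le_of_continuous lipschitz.continuous.abs (by fun_prop) ?_⟩
  filter_upwards [hbound, hae] with x hx hφ
  rw [← hφ]
  exact (le_add_of_nonneg_right (by positivity)).trans hx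

theorem norm_soliton (φ : ℝ → ℝ) (ω v x₀ γ t x : ℝ) :
    ‖soliton φ ω v x₀ γ t x‖ = |φ (x - x₀ - v * t)| := by
  rw [soliton, norm_mul, mul_comm Complex.I, Complex.norm_exp_ofReal_mul_I, one_mul,
    Complex.norm_real, Real.norm_eq_abs]

theorem continuous_soliton {φ : ℝ → ℝ} (hφ : Continuous φ) (ω v x₀ γ : ℝ) :
    Continuous fun p : ℝ × ℝ => soliton φ ω v x₀ γ p.1 p.2 := by
  unfold soliton
  fun_prop

namespace IsProfile

variable {g : ℝ → ℝ} {ω : ℝ} {φ : ℝ → ℝ} {θ : ℝ → ℂ}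

theorem continuous_comp_sq (hφ : IsProfile g ω φ) (hg : ContinuousOn g (Ici 0)) :
    Continuous fun y => g (φ y ^ 2) :=
  hg.comp_continuous (hφ.continuous.pow 2) fun y => mem_Ici.2 (sq_nonneg (φ y))

theorem integrable_equation (hφ : IsProfile g ω φ) (hg : ContinuousOn g (Ici 0))
    (hθ : ContDiff ℝ (⊤ : ℕ∞) θ) (hθc : HasCompactSupport θ) :
    Integrable fun y => (φ y : ℂ) * deriv (deriv θ) y - (ω : ℂ) * ((φ y : ℂ) * θ y) +
      ((g (φ y ^ 2) * φ y : ℝ) : ℂ) * θ y := by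
  have continuous_profile : Continuous fun y => (φ y : ℂ) :=
    Complex.continuous_ofReal.comp hφ.continuous
  have continuous_nonlinearity : Continuous fun y => ((g (φ y ^ 2) * φ y : ℝ) : ℂ) :=
    Complex.continuous_ofReal.comp ((hφ.continuous_comp_sq hg).mul hφ.continuous)
  have continuous_deriv₂ : Continuous (deriv (deriv θ)) :=
    (contDiff_infty_iff_deriv.1 (contDiff_infty_iff_deriv.1 hθ).2).2.continuous
  exact (((continuous_profile.mul continuous_deriv₂).integrable_of_hasCompactSupport
    hθc.deriv.deriv.mul_left).sub (((continuous_profile.mul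
      hθ.continuous).integrable_of_hasCompactSupport hθc.mul_left).const_mul _)).add
    ((continuous_nonlinearity.mul hθ.continuous).integrable_of_hasCompactSupport hθc.mul_left)

theorem equation_clm (hφ : IsProfile g ω φ) (hg : ContinuousOn g (Ici 0))
    (hθ : ContDiff ℝ (⊤ : ℕ∞) θ) (hθc : HasCompactSupport θ) (ℓ : ℂ →L[ℝ] ℝ) :
    ℓ (∫ y, ((φ y : ℂ) * deriv (deriv θ) y - (ω : ℂ) * ((φ y : ℂ) * θ y) +
      ((g (φ y ^ 2) * φ y : ℝ) : ℂ) * θ y)) = 0 := by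
  have integrable_mul : ∀ {a b : ℝ → ℝ}, Continuous a → Continuous b → HasCompactSupport b →
      Integrable fun y => a y * b y := fun ha hb hbc =>
    (ha.mul hb).integrable_of_hasCompactSupport hbc.mul_left
  have deriv_clm_comp : ∀ {ψ : ℝ → ℂ}, ContDiff ℝ (⊤ : ℕ∞) ψ →
      deriv (fun y => ℓ (ψ y)) = fun y => ℓ (deriv ψ y) := fun hψ => funext fun y =>
    (ℓ.hasFDerivAt.comp_hasDerivAt y ((hψ.differentiable (by norm_num)) y).hasDerivAt).deriv
  have hθ' := (contDiff_infty_iff_deriv.1 hθ).2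
  have hℓθ : ContDiff ℝ (⊤ : ℕ∞) fun y => ℓ (θ y) := ℓ.contDiff.comp hθ
  have hℓθc : HasCompactSupport fun y => ℓ (θ y) := hθc.comp_left (g := ℓ) (map_zero ℓ)
  have integrable_deriv₂ : Integrable fun y => φ y * ℓ (deriv (deriv θ) y) :=
    integrable_mul hφ.continuous
      (ℓ.continuous.comp (contDiff_infty_iff_deriv.1 hθ').2.continuous)
      (hθc.deriv.deriv.comp_left (g := ℓ) (map_zero ℓ))
  have integrable_linear := (integrable_mul hφ.continuous hℓθ.continuous hℓθc).const_mul ω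
  have integrable_nonlinear : Integrable fun y => g (φ y ^ 2) * φ y * ℓ (θ y) :=
    integrable_mul ((hφ.continuous_comp_sq hg).mul hφ.continuous) hℓθ.continuous hℓθc
  have integrable_sub : Integrable fun y => φ y * ℓ (deriv (deriv θ) y) - ω * (φ y * ℓ (θ y)) :=
    integrable_deriv₂.sub integrable_linear
  have real_equation := hφ.equation (fun y => ℓ (θ y)) hℓθ hℓθc
  rw [deriv_clm_comp hθ, deriv_clm_comp hθ'] at real_equation
  rw [← ℓ.integral_comp_comm (hφ.integrable_equation hg hθ hθc)]
  simp only [← Complex.real_smul, map_add, map_sub, map_smul, smul_eq_mul]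
  rw [integral_add integrable_sub integrable_nonlinear,
    integral_sub integrable_deriv₂ integrable_linear, integral_const_mul, real_equation]
  ring

theorem equation_complex (hφ : IsProfile g ω φ) (hg : ContinuousOn g (Ici 0))
    (hθ : ContDiff ℝ (⊤ : ℕ∞) θ) (hθc : HasCompactSupport θ) :
    ∫ y, ((φ y : ℂ) * deriv (deriv θ) y - (ω : ℂ) * ((φ y : ℂ) * θ y) +
      ((g (φ y ^ 2) * φ y : ℝ) : ℂ) * θ y) = 0 :=
  Complex.ext (hφ.equation_clm hg hθ hθc Complex.reCLM) (hφ.equation_clm hg hθ hθc Complex.imCLM)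

end IsProfile

section Galilean

variable {χ : ℝ × ℝ → ℂ}

/-- The phase of a soliton of frequency `ω`, velocity `v`, initial position `x₀` and initial phase
`γ`, in the coordinate `y = x - x₀ - v t` of its moving frame. -/
noncomputable def galileanPhase (ω v x₀ γ t y : ℝ) : ℂ :=
  Complex.exp (Complex.I * ((ω * t + v * (y + x₀) / 2 + v ^ 2 * t / 4 + γ : ℝ) : ℂ))

/-- A test function seen in the moving frame of a soliton. -/
noncomputable def galileanPullback (ω v x₀ γ : ℝ) (χ : ℝ × ℝ → ℂ) (p : ℝ × ℝ) : ℂ :=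
  galileanPhase ω v x₀ γ p.1 p.2 * χ (p.1, p.2 + (x₀ + v * p.1))

theorem norm_galileanPhase (ω v x₀ γ t y : ℝ) : ‖galileanPhase ω v x₀ γ t y‖ = 1 := by
  rw [galileanPhase, mul_comm, Complex.norm_exp_ofReal_mul_I]

theorem soliton_eq_galileanPhase_mul (φ : ℝ → ℝ) (ω v x₀ γ t y : ℝ) :
    soliton φ ω v x₀ γ t (y + (x₀ + v * t)) = galileanPhase ω v x₀ γ t y * φ y := by
  rw [soliton, galileanPhase]
  congr 4 <;> ring

theorem hasDerivAt_galileanPhase_fst (ω v x₀ γ t y : ℝ) :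
    HasDerivAt (fun t => galileanPhase ω v x₀ γ t y)
      (galileanPhase ω v x₀ γ t y * (Complex.I * ((ω + v ^ 2 / 4 : ℝ) : ℂ))) t := by
  have deriv_phase : HasDerivAt (fun t => ω * t + v * (y + x₀) / 2 + v ^ 2 * t / 4 + γ)
      (ω + v ^ 2 / 4) t := by
    simpa using ((((hasDerivAt_id t).const_mul ω).add_const (v * (y + x₀) / 2)).fun_add
      (((hasDerivAt_id t).const_mul (v ^ 2)).div_const 4)).add_const γ
  exact (deriv_phase.ofReal_comp.const_mul Complex.I).cexp

theorem hasDerivAt_galileanPhase_snd (ω v x₀ γ t y : ℝ) :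
    HasDerivAt (fun y => galileanPhase ω v x₀ γ t y)
      (galileanPhase ω v x₀ γ t y * (Complex.I * ((v / 2 : ℝ) : ℂ))) y := by
  have deriv_phase : HasDerivAt (fun y => ω * t + v * (y + x₀) / 2 + v ^ 2 * t / 4 + γ)
      (v / 2) y := by
    simpa using ((((((hasDerivAt_id y).add_const x₀).const_mul v).div_const 2).const_add
      (ω * t)).add_const (v ^ 2 * t / 4)).add_const γ
  exact (deriv_phase.ofReal_comp.const_mul Complex.I).cexp

namespace IsTest

protected theorem galileanPullback (h : IsTest χ) (ω v x₀ γ : ℝ) :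
    IsTest (galileanPullback ω v x₀ γ χ) where
  smooth := by
    have contDiff_phase : ContDiff ℝ (⊤ : ℕ∞) fun p : ℝ × ℝ =>
        ω * p.1 + v * (p.2 + x₀) / 2 + v ^ 2 * p.1 / 4 + γ := by fun_prop
    exact (contDiff_const.mul (Complex.ofRealCLM.contDiff.comp contDiff_phase)).cexp.mul
      (h.smooth.comp (by fun_prop))
  compact := by
    obtain ⟨R, hR⟩ := h.exists_support_bound
    refine HasCompactSupport.intro (K := Icc (-R) R ×ˢ Icc (-(R + (|x₀| + |v| * R)))
      (R + (|x₀| + |v| * R))) (isCompact_Icc.prod isCompact_Icc) fun p hp => ?_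
    suffices χ (p.1, p.2 + (x₀ + v * p.1)) = 0 by rw [galileanPullback, this, mul_zero]
    by_contra hne
    obtain ⟨time_mem, space_mem⟩ := hR _ hne
    refine hp ⟨time_mem, abs_le.1 ?_⟩
    calc |p.2| = |p.2 + (x₀ + v * p.1) - (x₀ + v * p.1)| := by ring_nf
      _ ≤ |p.2 + (x₀ + v * p.1)| + (|x₀| + |v| * |p.1|) := by
        rw [← abs_mul]
        exact (abs_sub _ _).trans (by gcongr; exact abs_add_le _ _)
      _ ≤ R + (|x₀| + |v| * R) := by
        gcongr
        exacts [abs_le.2 space_mem, abs_le.2 time_mem]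

theorem spaceDeriv_galileanPullback (h : IsTest χ) (ω v x₀ γ : ℝ) :
    spaceDeriv (galileanPullback ω v x₀ γ χ) = fun p =>
      Complex.I * ((v / 2 : ℝ) : ℂ) * galileanPullback ω v x₀ γ χ p +
        galileanPullback ω v x₀ γ (spaceDeriv χ) p := by
  ext ⟨t, y⟩
  refine (((h.galileanPullback ω v x₀ γ).hasDerivAt_snd t y).unique
    ((hasDerivAt_galileanPhase_snd ω v x₀ γ t y).mul
      ((h.hasDerivAt_snd t (y + (x₀ + v * t))).comp_add_const y (x₀ + v * t)))).trans ?_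
  simp only [galileanPullback]
  ring

theorem hasDerivAt_comp_add_mul (h : IsTest χ) (v t x : ℝ) :
    HasDerivAt (fun t => χ (t, x + v * t))
      (timeDeriv χ (t, x + v * t) + v * spaceDeriv χ (t, x + v * t)) t := by
  have deriv_line : HasDerivAt (fun t : ℝ => (t, x + v * t)) ((1, v) : ℝ × ℝ) t := by
    refine (hasDerivAt_id t).prodMk ?_
    simpa using ((hasDerivAt_id t).const_mul v).const_add x
  refine (((h.smooth.differentiable (by norm_num)) (t, x + v * t)).hasFDerivAt.comp_hasDerivAt t
    deriv_line).congr_deriv ?_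
  rw [timeDeriv, spaceDeriv,
    show ((1, v) : ℝ × ℝ) = (1, 0) + v • (0, 1) by simp, map_add, map_smul, Complex.real_smul]

theorem timeDeriv_galileanPullback (h : IsTest χ) (ω v x₀ γ : ℝ) :
    timeDeriv (galileanPullback ω v x₀ γ χ) = fun p =>
      Complex.I * ((ω + v ^ 2 / 4 : ℝ) : ℂ) * galileanPullback ω v x₀ γ χ p +
        galileanPullback ω v x₀ γ (timeDeriv χ) p +
          v * galileanPullback ω v x₀ γ (spaceDeriv χ) p := by
  ext ⟨t, y⟩
  have deriv_pullback := (hasDerivAt_galileanPhase_fst ω v x₀ γ t y).mul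
    (h.hasDerivAt_comp_add_mul v t (y + x₀))
  simp only [add_assoc] at deriv_pullback
  refine (((h.galileanPullback ω v x₀ γ).hasDerivAt_fst t y).unique deriv_pullback).trans ?_
  simp only [galileanPullback]
  ring

theorem galileanPullback_adjointSchrodinger (h : IsTest χ) (ω v x₀ γ : ℝ) (p : ℝ × ℝ) :
    galileanPullback ω v x₀ γ (adjointSchrodinger χ) p =
      adjointSchrodinger (galileanPullback ω v x₀ γ χ) p -
        (ω : ℂ) * galileanPullback ω v x₀ γ χ p := by
  have spaceDeriv₂ : spaceDeriv (spaceDeriv (galileanPullback ω v x₀ γ χ)) p =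
      Complex.I * ((v / 2 : ℝ) : ℂ) *
        (Complex.I * ((v / 2 : ℝ) : ℂ) * galileanPullback ω v x₀ γ χ p +
          galileanPullback ω v x₀ γ (spaceDeriv χ) p) +
      (Complex.I * ((v / 2 : ℝ) : ℂ) * galileanPullback ω v x₀ γ (spaceDeriv χ) p +
        galileanPullback ω v x₀ γ (spaceDeriv (spaceDeriv χ)) p) := by
    have deriv_formula :=
      (((h.galileanPullback ω v x₀ γ).hasDerivAt_snd p.1 p.2).const_mul
        (Complex.I * ((v / 2 : ℝ) : ℂ))).add
        ((h.spaceDeriv.galileanPullback ω v x₀ γ).hasDerivAt_snd p.1 p.2)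
    have deriv_def := (h.galileanPullback ω v x₀ γ).spaceDeriv.hasDerivAt_snd p.1 p.2
    nth_rewrite 1 [h.spaceDeriv_galileanPullback] at deriv_def
    rw [deriv_def.unique deriv_formula, h.spaceDeriv_galileanPullback,
      h.spaceDeriv.spaceDeriv_galileanPullback]
  have pullback_linear : galileanPullback ω v x₀ γ (adjointSchrodinger χ) p =
      -Complex.I * galileanPullback ω v x₀ γ (timeDeriv χ) p +
        galileanPullback ω v x₀ γ (spaceDeriv (spaceDeriv χ)) p := by
    simp only [galileanPullback, adjointSchrodinger]
    ring
  rw [pullback_linear, adjointSchrodinger, spaceDeriv₂, h.timeDeriv_galileanPullback]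
  push_cast
  linear_combination (ω : ℂ) * galileanPullback ω v x₀ γ χ p * Complex.I_mul_I

end IsTest

theorem nlsF_mul_ofReal (g : ℝ → ℝ) {e : ℂ} (he : ‖e‖ = 1) (r : ℝ) :
    nlsF g (e * r) = e * ((g (r ^ 2) * r : ℝ) : ℂ) := by
  rw [nlsF, norm_mul, he, one_mul, Complex.norm_real, Real.norm_eq_abs, sq_abs]
  push_cast
  ring

theorem IsTest.integral_timeDeriv (h : IsTest χ) (x : ℝ) : ∫ t, timeDeriv χ (t, x) = 0 := by
  have integrable_time : ∀ {ψ : ℝ × ℝ → ℂ}, IsTest ψ → Integrable fun t => ψ (t, x) := by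
    intro ψ hψ
    obtain ⟨R, hR⟩ := hψ.exists_support_bound
    exact (hψ.continuous.comp (Continuous.prodMk_left x)).integrable_of_hasCompactSupport
      (HasCompactSupport.intro isCompact_Icc fun t ht => by_contra fun hne => ht (hR _ hne).1)
  exact integral_eq_zero_of_hasDerivAt_of_integrable (fun t => h.hasDerivAt_fst t x)
    (integrable_time h.timeDeriv) (integrable_time h)

namespace IsProfile

variable {g : ℝ → ℝ} {ω : ℝ} {φ : ℝ → ℝ}

theorem integral_soliton_slice (hφ : IsProfile g ω φ) (hg : ContinuousOn g (Ici 0))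
    (v x₀ γ : ℝ) (h : IsTest χ) (t : ℝ) :
    ∫ x, (soliton φ ω v x₀ γ t x * adjointSchrodinger χ (t, x) +
        nlsF g (soliton φ ω v x₀ γ t x) * χ (t, x)) =
      ∫ y, -Complex.I * ((φ y : ℂ) * timeDeriv (galileanPullback ω v x₀ γ χ) (t, y)) := by
  have hψ := h.galileanPullback ω v x₀ γ
  have integrable_time : Integrable fun y =>
      -Complex.I * ((φ y : ℂ) * timeDeriv (galileanPullback ω v x₀ γ χ) (t, y)) :=
    (((Complex.continuous_ofReal.comp hφ.continuous).mul
      (hψ.timeDeriv.contDiff_slice t).continuous).integrable_of_hasCompactSupport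
        (hψ.timeDeriv.hasCompactSupport_slice t).mul_left).const_mul _
  have integrable_profile :=
    hφ.integrable_equation hg (hψ.contDiff_slice t) (hψ.hasCompactSupport_slice t)
  have profile_equation :=
    hφ.equation_complex hg (hψ.contDiff_slice t) (hψ.hasCompactSupport_slice t)
  rw [hψ.deriv_slice, hψ.spaceDeriv.deriv_slice] at integrable_profile profile_equation
  rw [← integral_add_right_eq_self _ (x₀ + v * t), ← add_zero (∫ y, _ * _), ← profile_equation,
    ← integral_add integrable_time integrable_profile]
  refine integral_congr_ae (Eventually.of_forall fun y => ?_)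
  have adjoint_pullback := h.galileanPullback_adjointSchrodinger ω v x₀ γ (t, y)
  rw [adjointSchrodinger] at adjoint_pullback
  simp only [galileanPullback] at adjoint_pullback ⊢
  rw [soliton_eq_galileanPhase_mul, nlsF_mul_ofReal g (norm_galileanPhase ω v x₀ γ t y)]
  linear_combination (φ y : ℂ) * adjoint_pullback

theorem soliton_equation (hφ : IsProfile g ω φ) (hg : ContinuousOn g (Ici 0)) (v x₀ γ : ℝ)
    (h : IsTest χ) :
    ∫ p : ℝ × ℝ, (soliton φ ω v x₀ γ p.1 p.2 * adjointSchrodinger χ p +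
      nlsF g (soliton φ ω v x₀ γ p.1 p.2) * χ p) = 0 := by
  have hψ := h.galileanPullback ω v x₀ γ
  have continuous_soliton := continuous_soliton hφ.continuous ω v x₀ γ
  have continuous_nonlinearity :
      Continuous fun p : ℝ × ℝ => nlsF g (soliton φ ω v x₀ γ p.1 p.2) := by
    refine (Complex.continuous_ofReal.comp ?_).mul continuous_soliton
    exact hg.comp_continuous (continuous_soliton.norm.pow 2) fun p => mem_Ici.2 (sq_nonneg _)
  have integrable_equation : Integrable fun p : ℝ × ℝ =>
      soliton φ ω v x₀ γ p.1 p.2 * adjointSchrodinger χ p +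
        nlsF g (soliton φ ω v x₀ γ p.1 p.2) * χ p :=
    ((continuous_soliton.mul h.adjointSchrodinger.continuous).integrable_of_hasCompactSupport
      h.adjointSchrodinger.compact.mul_left).add
    ((continuous_nonlinearity.mul h.continuous).integrable_of_hasCompactSupport
      h.compact.mul_left)
  have integrable_pullback : Integrable fun p : ℝ × ℝ =>
      -Complex.I * ((φ p.2 : ℂ) * timeDeriv (galileanPullback ω v x₀ γ χ) p) :=
    (((Complex.continuous_ofReal.comp (hφ.continuous.comp continuous_snd)).mul
      hψ.timeDeriv.continuous).integrable_of_hasCompactSupport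
        hψ.timeDeriv.compact.mul_left).const_mul _
  rw [Measure.volume_eq_prod] at integrable_equation integrable_pullback ⊢
  calc ∫ p : ℝ × ℝ, (soliton φ ω v x₀ γ p.1 p.2 * adjointSchrodinger χ p +
        nlsF g (soliton φ ω v x₀ γ p.1 p.2) * χ p) ∂(volume.prod volume)
      = ∫ t, ∫ x, (soliton φ ω v x₀ γ t x * adjointSchrodinger χ (t, x) +
          nlsF g (soliton φ ω v x₀ γ t x) * χ (t, x)) := integral_prod _ integrable_equation
    _ = ∫ t, ∫ y, -Complex.I * ((φ y : ℂ) * timeDeriv (galileanPullback ω v x₀ γ χ) (t, y)) :=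
        integral_congr_ae (Eventually.of_forall (hφ.integral_soliton_slice hg v x₀ γ h))
    _ = ∫ y, ∫ t, -Complex.I * ((φ y : ℂ) * timeDeriv (galileanPullback ω v x₀ γ χ) (t, y)) :=
        integral_integral_swap integrable_pullback
    _ = 0 := by simp only [integral_const_mul, hψ.integral_timeDeriv, mul_zero, integral_zero]

end IsProfile

end Galilean

/-! ### Soliton trains -/

theorem hasSum_half_pow_succ : HasSum (fun j : ℕ => (1 / 2 : ℝ) ^ (j + 1)) 1 := by
  simpa [pow_succ] using (hasSum_geometric_two.mul_right (1 / 2 : ℝ))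

theorem sum_half_pow_succ_le (N : ℕ) : ∑ j ∈ Finset.range N, (1 / 2 : ℝ) ^ (j + 1) ≤ 1 :=
  sum_le_hasSum _ (fun _ _ => by positivity) hasSum_half_pow_succ

theorem min_sum_le {ι : Type*} (s : Finset ι) {f : ι → ℝ} (hf : ∀ i, 0 ≤ f i) {y : ℝ}
    (hy : 0 ≤ y) : min (∑ i ∈ s, f i) y ≤ ∑ i ∈ s, min (f i) y := by
  have min_add_le : ∀ a b : ℝ, 0 ≤ a → 0 ≤ b → min (a + b) y ≤ min a y + min b y := by grind
  exact Finset.le_sum_of_subadditive_on_pred (fun a => min a y) (fun a => 0 ≤ a)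
    (min_eq_left hy).le min_add_le (fun _ _ => add_nonneg) f fun i _ => hf i

theorem rpow_tsum_le_tsum_rpow {f : ℕ → ℝ} {α : ℝ} (hα : 0 < α) (hf : ∀ j, 0 ≤ f j)
    (hsum : Summable fun j : ℕ => (2 ^ (j + 1) * f j) ^ α) :
    (∑' j, f j) ^ α ≤ ∑' j : ℕ, (2 ^ (j + 1) * f j) ^ α := by
  have scaled_nonneg : ∀ j, 0 ≤ 2 ^ (j + 1) * f j := fun j => mul_nonneg (by positivity) (hf j)
  set Z := ∑' j : ℕ, (2 ^ (j + 1) * f j) ^ α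
  have Z_nonneg : 0 ≤ Z := tsum_nonneg fun j => Real.rpow_nonneg (scaled_nonneg j) α
  have term_le : ∀ j, f j ≤ (1 / 2 : ℝ) ^ (j + 1) * Z ^ α⁻¹ := fun j => by
    have scaled_le : 2 ^ (j + 1) * f j ≤ Z ^ α⁻¹ :=
      (Real.le_rpow_inv_iff_of_pos (scaled_nonneg j) Z_nonneg hα).2
        (hsum.le_tsum j fun i _ => Real.rpow_nonneg (scaled_nonneg i) α)
    calc f j = (1 / 2 : ℝ) ^ (j + 1) * (2 ^ (j + 1) * f j) := by
          rw [← mul_assoc, ← mul_pow]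
          norm_num
      _ ≤ _ := by gcongr
  have hasSum_bound := hasSum_half_pow_succ.mul_right (Z ^ α⁻¹)
  rw [one_mul] at hasSum_bound
  have tsum_le : ∑' j, f j ≤ Z ^ α⁻¹ :=
    ((hasSum_bound.summable.of_nonneg_of_le hf term_le).tsum_le_tsum term_le
      hasSum_bound.summable).trans_eq hasSum_bound.tsum_eq
  exact (Real.le_rpow_inv_iff_of_pos (tsum_nonneg hf) Z_nonneg hα).1 tsum_le

theorem integral_exp_neg_mul_abs {β : ℝ} (hβ : 0 < β) :
    ∫ x : ℝ, Real.exp (-(β * |x|)) = 2 / β := by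
  rw [integral_comp_abs (f := fun x => Real.exp (-(β * x)))]
  simp only [← neg_mul, integral_exp_neg_mul_Ioi_zero hβ]
  ring

theorem integrable_exp_neg_mul_abs_sub {β : ℝ} (hβ : 0 < β) (m : ℝ) :
    Integrable fun x : ℝ => Real.exp (-(β * |x - m|)) := by
  have integrable_centred : Integrable fun x : ℝ => Real.exp (-(β * |x|)) :=
    not_imp_comm.1 integral_undef (by rw [integral_exp_neg_mul_abs hβ]; positivity)
  exact integrable_centred.comp_sub_right m

/-- Amplitudes `B`, decay rates `β` and velocities `v` of a soliton train.  At time `t` any two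
of the waves `B j * exp (-β j * |x - v j * t|)` have a product of size `exp (-2 * lam * t)`. -/
structure TrainSeq (α lam : ℝ) (B β v : ℕ → ℝ) : Prop where
  one_le : 1 ≤ α
  lam_pos : 0 < lam
  B_nonneg : ∀ j, 0 ≤ B j
  B_le : ∀ j, B j ≤ (1 / 4 : ℝ) ^ (j + 1)
  β_pos : ∀ j, 0 < β j
  β_le : ∀ j, β j ≤ 2
  weight_le : ∀ j, (2 ^ (j + 1) * B j) ^ α * Real.exp j * (2 / β j) ≤ (1 / 2 : ℝ) ^ (j + 1)
  separated : ∀ j n, j < n → ∀ t, 0 ≤ t → ∀ x,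
    2 * lam * t ≤ β j * |x - v j * t| + β n * |x - v n * t|
  speed_le : ∀ j, β j * |v j| ≤ 2 * lam * j

/-- The pointwise bound for the `j`-th soliton of a train. -/
noncomputable def envelope (B β v : ℕ → ℝ) (j : ℕ) (t x : ℝ) : ℝ :=
  B j * Real.exp (-(β j * |x - v j * t|))

/-- A majorant for the power `α` of the sum of the envelopes, with integral at most one. -/
noncomputable def trainWeight (α : ℝ) (B β v : ℕ → ℝ) (t x : ℝ) : ℝ :=
  ∑' j, (2 ^ (j + 1) * B j) ^ α * Real.exp (-(β j * |x - v j * t|))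

/-- A majorant for `trainWeight` on a short time interval around `t`: the factor `exp j` absorbs
the motion of the `j`-th wave. -/
noncomputable def localWeight (α : ℝ) (B β v : ℕ → ℝ) (t x : ℝ) : ℝ :=
  ∑' j, (2 ^ (j + 1) * B j) ^ α * Real.exp j * Real.exp (-(β j * |x - v j * t|))

namespace TrainSeq

variable {α lam : ℝ} {B β v : ℕ → ℝ}

theorem exp_neg_dist_le_one (h : TrainSeq α lam B β v) (j : ℕ) (t x : ℝ) :
    Real.exp (-(β j * |x - v j * t|)) ≤ 1 := by
  rw [Real.exp_le_one_iff, neg_nonpos]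
  exact mul_nonneg (h.β_pos j).le (abs_nonneg _)

theorem envelope_nonneg (h : TrainSeq α lam B β v) (j : ℕ) (t x : ℝ) : 0 ≤ envelope B β v j t x :=
  mul_nonneg (h.B_nonneg j) (Real.exp_pos _).le

theorem B_le_half (h : TrainSeq α lam B β v) (j : ℕ) : B j ≤ (1 / 2 : ℝ) ^ (j + 1) :=
  (h.B_le j).trans (pow_le_pow_left₀ (by norm_num) (by norm_num) _)

theorem envelope_le (h : TrainSeq α lam B β v) (j : ℕ) (t x : ℝ) : envelope B β v j t x ≤ B j :=
  mul_le_of_le_one_right (h.B_nonneg j) (h.exp_neg_dist_le_one j t x)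

theorem summable_B (h : TrainSeq α lam B β v) : Summable B :=
  Summable.of_nonneg_of_le h.B_nonneg h.B_le_half hasSum_half_pow_succ.summable

theorem summable_envelope (h : TrainSeq α lam B β v) (t x : ℝ) :
    Summable fun j => envelope B β v j t x :=
  Summable.of_nonneg_of_le (fun j => h.envelope_nonneg j t x) (fun j => h.envelope_le j t x)
    h.summable_B

theorem tsum_envelope_le_one (h : TrainSeq α lam B β v) (t x : ℝ) :
    ∑' j, envelope B β v j t x ≤ 1 :=
  (h.summable_envelope t x).tsum_le_of_sum_le fun s =>
    (Finset.sum_le_sum fun j _ => (h.envelope_le j t x).trans (h.B_le_half j)).trans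
      (sum_le_hasSum s (fun _ _ => by positivity) hasSum_half_pow_succ)

theorem coeff_nonneg (h : TrainSeq α lam B β v) (j : ℕ) : 0 ≤ (2 ^ (j + 1) * B j) ^ α :=
  Real.rpow_nonneg (mul_nonneg (by positivity) (h.B_nonneg j)) _

theorem coeff_le (h : TrainSeq α lam B β v) (j : ℕ) :
    (2 ^ (j + 1) * B j) ^ α ≤ (1 / 2 : ℝ) ^ (j + 1) := by
  have base_le : 2 ^ (j + 1) * B j ≤ (1 / 2 : ℝ) ^ (j + 1) :=
    calc 2 ^ (j + 1) * B j ≤ 2 ^ (j + 1) * (1 / 4 : ℝ) ^ (j + 1) := by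
          gcongr
          exact h.B_le j
      _ = _ := by
          rw [← mul_pow]
          norm_num
  exact (Real.rpow_le_self_of_le_one (mul_nonneg (by positivity) (h.B_nonneg j))
    (base_le.trans (pow_le_one₀ (by norm_num) (by norm_num))) h.one_le).trans base_le

theorem term_nonneg (h : TrainSeq α lam B β v) (j : ℕ) (t x : ℝ) :
    0 ≤ (2 ^ (j + 1) * B j) ^ α * Real.exp (-(β j * |x - v j * t|)) :=
  mul_nonneg (h.coeff_nonneg j) (Real.exp_pos _).le

theorem term_le (h : TrainSeq α lam B β v) (j : ℕ) (t x : ℝ) :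
    (2 ^ (j + 1) * B j) ^ α * Real.exp (-(β j * |x - v j * t|)) ≤ (1 / 2 : ℝ) ^ (j + 1) :=
  (mul_le_of_le_one_right (h.coeff_nonneg j) (h.exp_neg_dist_le_one j t x)).trans (h.coeff_le j)

theorem summable_term (h : TrainSeq α lam B β v) (t x : ℝ) :
    Summable fun j : ℕ => (2 ^ (j + 1) * B j) ^ α * Real.exp (-(β j * |x - v j * t|)) :=
  Summable.of_nonneg_of_le (fun j => h.term_nonneg j t x) (fun j => h.term_le j t x)
    hasSum_half_pow_succ.summable

theorem trainWeight_nonneg (h : TrainSeq α lam B β v) (t x : ℝ) : 0 ≤ trainWeight α B β v t x :=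
  tsum_nonneg fun j => h.term_nonneg j t x

theorem trainWeight_le_one (h : TrainSeq α lam B β v) (t x : ℝ) : trainWeight α B β v t x ≤ 1 :=
  ((h.summable_term t x).tsum_le_tsum (fun j => h.term_le j t x)
    hasSum_half_pow_succ.summable).trans hasSum_half_pow_succ.tsum_eq.le

theorem rpow_envelope_le (h : TrainSeq α lam B β v) (t x : ℝ) (j : ℕ) :
    (2 ^ (j + 1) * envelope B β v j t x) ^ α ≤
      (2 ^ (j + 1) * B j) ^ α * Real.exp (-(β j * |x - v j * t|)) := by
  rw [envelope, ← mul_assoc,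
    Real.mul_rpow (mul_nonneg (by positivity) (h.B_nonneg j)) (Real.exp_pos _).le]
  exact mul_le_mul_of_nonneg_left (Real.rpow_le_self_of_le_one (Real.exp_pos _).le
    (h.exp_neg_dist_le_one j t x) h.one_le) (h.coeff_nonneg j)

theorem rpow_tsum_envelope_le (h : TrainSeq α lam B β v) (t x : ℝ) :
    (∑' j, envelope B β v j t x) ^ α ≤ trainWeight α B β v t x := by
  have summable_rpow : Summable fun j : ℕ => (2 ^ (j + 1) * envelope B β v j t x) ^ α :=
    (h.summable_term t x).of_nonneg_of_le (fun j => Real.rpow_nonneg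
      (mul_nonneg (by positivity) (h.envelope_nonneg j t x)) _) (h.rpow_envelope_le t x)
  exact (rpow_tsum_le_tsum_rpow (one_pos.trans_le h.one_le)
    (fun j => h.envelope_nonneg j t x) summable_rpow).trans
      (summable_rpow.tsum_le_tsum (h.rpow_envelope_le t x) (h.summable_term t x))

theorem localTerm_nonneg (h : TrainSeq α lam B β v) (t x : ℝ) (j : ℕ) :
    0 ≤ (2 ^ (j + 1) * B j) ^ α * Real.exp j * Real.exp (-(β j * |x - v j * t|)) := by
  have := h.coeff_nonneg j
  positivity

theorem localTerm_le (h : TrainSeq α lam B β v) (t x : ℝ) (j : ℕ) :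
    (2 ^ (j + 1) * B j) ^ α * Real.exp j * Real.exp (-(β j * |x - v j * t|)) ≤
      (1 / 2 : ℝ) ^ (j + 1) := by
  have coeff_exp_nonneg : 0 ≤ (2 ^ (j + 1) * B j) ^ α * Real.exp j :=
    mul_nonneg (h.coeff_nonneg j) (Real.exp_pos _).le
  exact (mul_le_of_le_one_right coeff_exp_nonneg (h.exp_neg_dist_le_one j t x)).trans
    ((le_mul_of_one_le_right coeff_exp_nonneg
      ((one_le_div (h.β_pos j)).2 (h.β_le j))).trans (h.weight_le j))

theorem summable_localTerm (h : TrainSeq α lam B β v) (t x : ℝ) : Summable fun j : ℕ =>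
    (2 ^ (j + 1) * B j) ^ α * Real.exp j * Real.exp (-(β j * |x - v j * t|)) :=
  Summable.of_nonneg_of_le (h.localTerm_nonneg t x) (h.localTerm_le t x)
    hasSum_half_pow_succ.summable

theorem localWeight_nonneg (h : TrainSeq α lam B β v) (t x : ℝ) : 0 ≤ localWeight α B β v t x :=
  tsum_nonneg (h.localTerm_nonneg t x)

theorem continuous_localWeight (h : TrainSeq α lam B β v) :
    Continuous fun p : ℝ × ℝ => localWeight α B β v p.1 p.2 := by
  refine continuous_tsum (fun j => by fun_prop) hasSum_half_pow_succ.summable fun j p => ?_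
  rw [Real.norm_of_nonneg (h.localTerm_nonneg _ _ j)]
  exact h.localTerm_le p.1 p.2 j

theorem continuous_trainWeight (h : TrainSeq α lam B β v) :
    Continuous fun p : ℝ × ℝ => trainWeight α B β v p.1 p.2 := by
  refine continuous_tsum (fun j => by fun_prop) hasSum_half_pow_succ.summable fun j p => ?_
  rw [Real.norm_of_nonneg (h.term_nonneg j _ _)]
  exact h.term_le j p.1 p.2

theorem lintegral_localTerm_le (h : TrainSeq α lam B β v) (t : ℝ) (j : ℕ) :
    ∫⁻ x, ENNReal.ofReal
      ((2 ^ (j + 1) * B j) ^ α * Real.exp j * Real.exp (-(β j * |x - v j * t|))) ≤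
      ENNReal.ofReal ((1 / 2 : ℝ) ^ (j + 1)) := by
  rw [← ofReal_integral_eq_lintegral_ofReal
    ((integrable_exp_neg_mul_abs_sub (h.β_pos j) (v j * t)).const_mul _)
    (Eventually.of_forall fun x => h.localTerm_nonneg t x j)]
  refine ENNReal.ofReal_le_ofReal ?_
  rw [integral_const_mul, integral_sub_right_eq_self (fun x => Real.exp (-(β j * |x|))) (v j * t),
    integral_exp_neg_mul_abs (h.β_pos j)]
  exact h.weight_le j

theorem lintegral_localWeight_le (h : TrainSeq α lam B β v) (t : ℝ) :
    ∫⁻ x, ENNReal.ofReal (localWeight α B β v t x) ≤ 1 := by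
  simp only [localWeight, ENNReal.ofReal_tsum_of_nonneg (h.localTerm_nonneg t _)
    (h.summable_localTerm t _)]
  rw [lintegral_tsum fun j => by fun_prop]
  refine (ENNReal.tsum_le_tsum (h.lintegral_localTerm_le t)).trans ?_
  rw [← ENNReal.ofReal_tsum_of_nonneg (fun j => by positivity) hasSum_half_pow_succ.summable,
    hasSum_half_pow_succ.tsum_eq, ENNReal.ofReal_one]

theorem integrable_localWeight (h : TrainSeq α lam B β v) (t : ℝ) :
    Integrable (localWeight α B β v t) := by
  refine ⟨(h.continuous_localWeight.comp (Continuous.prodMk_right t)).aestronglyMeasurable, ?_⟩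
  rw [hasFiniteIntegral_iff_ofReal (Eventually.of_forall fun x => h.localWeight_nonneg t x)]
  exact (h.lintegral_localWeight_le t).trans_lt ENNReal.one_lt_top

theorem integral_localWeight_le (h : TrainSeq α lam B β v) (t : ℝ) :
    ∫ x, localWeight α B β v t x ≤ 1 := by
  rw [integral_eq_lintegral_of_nonneg_ae (Eventually.of_forall fun x => h.localWeight_nonneg t x)
    (h.integrable_localWeight t).1]
  exact ENNReal.toReal_le_of_le_ofReal zero_le_one
    ((h.lintegral_localWeight_le t).trans (by rw [ENNReal.ofReal_one]))

theorem trainWeight_le_localWeight (h : TrainSeq α lam B β v) {t t₀ : ℝ}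
    (ht : 2 * lam * |t - t₀| ≤ 1) (x : ℝ) :
    trainWeight α B β v t x ≤ localWeight α B β v t₀ x := by
  refine (h.summable_term t x).tsum_le_tsum (fun j => ?_) (h.summable_localTerm t₀ x)
  rw [mul_assoc, ← Real.exp_add]
  refine mul_le_mul_of_nonneg_left (Real.exp_le_exp.2 ?_) (h.coeff_nonneg j)
  have dist_le : |x - v j * t₀| ≤ |x - v j * t| + |v j| * |t - t₀| :=
    calc |x - v j * t₀| = |(x - v j * t) + v j * (t - t₀)| := by ring_nf
      _ ≤ _ := (abs_add_le _ _).trans_eq (by rw [abs_mul])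
  have drift_le : β j * (|v j| * |t - t₀|) ≤ j :=
    calc β j * (|v j| * |t - t₀|) = β j * |v j| * |t - t₀| := (mul_assoc _ _ _).symm
      _ ≤ 2 * lam * j * |t - t₀| := by
          gcongr ?_ * _
          exact h.speed_le j
      _ = j * (2 * lam * |t - t₀|) := by ring
      _ ≤ j := mul_le_of_le_one_right (Nat.cast_nonneg j) ht
  linarith [mul_le_mul_of_nonneg_left dist_le (h.β_pos j).le]

theorem integrable_trainWeight (h : TrainSeq α lam B β v) (t : ℝ) :
    Integrable (trainWeight α B β v t) := by
  refine (h.integrable_localWeight t).mono'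
    (h.continuous_trainWeight.comp (Continuous.prodMk_right t)).aestronglyMeasurable
    (Eventually.of_forall fun x => ?_)
  rw [Real.norm_of_nonneg (h.trainWeight_nonneg t x)]
  exact h.trainWeight_le_localWeight (by simp) x

theorem integral_trainWeight_le (h : TrainSeq α lam B β v) (t : ℝ) :
    ∫ x, trainWeight α B β v t x ≤ 1 :=
  (integral_mono (h.integrable_trainWeight t) (h.integrable_localWeight t)
    fun x => h.trainWeight_le_localWeight (by simp) x).trans (h.integral_localWeight_le t)

theorem trainWeight_le_sqrt (h : TrainSeq α lam B β v) {t t₀ : ℝ}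
    (ht : 2 * lam * |t - t₀| ≤ 1) (x : ℝ) :
    trainWeight α B β v t x ≤ √(localWeight α B β v t₀ x) :=
  Real.le_sqrt_of_sq_le ((pow_le_of_le_one (h.trainWeight_nonneg t x) (h.trainWeight_le_one t x)
    two_ne_zero).trans (h.trainWeight_le_localWeight ht x))

theorem memLp_sqrt_localWeight (h : TrainSeq α lam B β v) (t : ℝ) :
    MemLp (fun x => √(localWeight α B β v t x)) 2 volume := by
  rw [memLp_two_iff_integrable_sq]
  · refine (h.integrable_localWeight t).congr (Eventually.of_forall fun x => ?_)
    exact (Real.sq_sqrt (h.localWeight_nonneg t x)).symm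
  · exact (Real.continuous_sqrt.comp
      (h.continuous_localWeight.comp (Continuous.prodMk_right t))).aestronglyMeasurable

theorem min_envelope_le (h : TrainSeq α lam B β v) {j n : ℕ} (hjn : j < n) {t : ℝ} (ht : 0 ≤ t)
    (x : ℝ) : min (envelope B β v j t x) (envelope B β v n t x) ≤
      (1 / 2 : ℝ) ^ (j + 1) * ((1 / 2 : ℝ) ^ (n + 1) * Real.exp (-lam * t)) := by
  have hj := h.envelope_nonneg j t x
  have hn := h.envelope_nonneg n t x
  have exp_mul_exp_le : Real.exp (-(β j * |x - v j * t|)) * Real.exp (-(β n * |x - v n * t|)) ≤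
      Real.exp (-lam * t) ^ 2 := by
    rw [← Real.exp_add, ← Real.exp_nat_mul]
    refine Real.exp_le_exp.2 ?_
    push_cast
    linarith [h.separated j n hjn t ht x]
  have quarter_pow : ∀ k : ℕ, (1 / 4 : ℝ) ^ k = (1 / 2 : ℝ) ^ k * (1 / 2 : ℝ) ^ k := fun k => by
    rw [← mul_pow]
    norm_num
  refine (pow_le_pow_iff_left₀ (le_min hj hn) (by positivity) two_ne_zero).1 ?_
  calc min (envelope B β v j t x) (envelope B β v n t x) ^ 2
      ≤ envelope B β v j t x * envelope B β v n t x := by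
        rw [sq]
        exact mul_le_mul (min_le_left _ _) (min_le_right _ _) (le_min hj hn) hj
    _ = B j * B n * (Real.exp (-(β j * |x - v j * t|)) * Real.exp (-(β n * |x - v n * t|))) := by
        simp only [envelope]
        ring
    _ ≤ ((1 / 4 : ℝ) ^ (j + 1) * (1 / 4 : ℝ) ^ (n + 1)) * Real.exp (-lam * t) ^ 2 := by
        gcongr
        · exact h.B_nonneg n
        · exact h.B_le j
        · exact h.B_le n
    _ = _ := by
        rw [quarter_pow, quarter_pow (n + 1)]
        ring

end TrainSeq

/-- Waves `R j` dominated by the envelopes of a soliton train. -/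
structure Train (α lam : ℝ) (B β v : ℕ → ℝ) (R : ℕ → ℝ → ℝ → ℂ) : Prop extends
    TrainSeq α lam B β v where
  continuous : ∀ j, Continuous fun p : ℝ × ℝ => R j p.1 p.2
  norm_le : ∀ j t x, ‖R j t x‖ ≤ envelope B β v j t x

/-- The interaction term of a train: the amount by which the nonlinearity `F` fails to be additive
on the waves `R j`. -/
noncomputable def interaction (F : ℂ → ℂ) (R : ℕ → ℝ → ℝ → ℂ) (t x : ℝ) : ℂ :=
  F (∑' j, R j t x) - ∑' j, F (R j t x)

namespace PowerLipschitz

variable {F : ℂ → ℂ} {L α : ℝ}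

theorem norm_sub_le_of_max_le (hF : PowerLipschitz F L α) {z w : ℂ} {s : ℝ}
    (hs : max (min ‖z‖ 2) (min ‖w‖ 2) ≤ s) : ‖F z - F w‖ ≤ L * s ^ α * ‖z - w‖ := by
  have nonneg_L := hF.nonneg
  have nonneg_α : 0 ≤ α := zero_le_one.trans hF.one_le
  have : 0 ≤ max (min ‖z‖ 2) (min ‖w‖ 2) := le_max_of_le_left (by positivity)
  refine (hF.bound z w).trans ?_
  gcongr

theorem norm_sub_le_of_norm_le (hF : PowerLipschitz F L α) {z w : ℂ} {s : ℝ} (hz : ‖z‖ ≤ s)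
    (hw : ‖w‖ ≤ s) : ‖F z - F w‖ ≤ L * s ^ α * ‖z - w‖ :=
  hF.norm_sub_le_of_max_le (max_le (min_le_of_left_le hz) (min_le_of_left_le hw))

theorem norm_sub_le (hF : PowerLipschitz F L α) (z w : ℂ) :
    ‖F z - F w‖ ≤ L * 2 ^ α * ‖z - w‖ :=
  hF.norm_sub_le_of_max_le (max_le (min_le_right _ _) (min_le_right _ _))

theorem continuous (hF : PowerLipschitz F L α) : Continuous F := by
  refine (LipschitzWith.of_dist_le' (K := L * 2 ^ α) fun z w => ?_).continuous
  simpa only [dist_eq_norm] using hF.norm_sub_le z w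

theorem norm_le (hF : PowerLipschitz F L α) {z : ℂ} {s : ℝ} (hz : ‖z‖ ≤ s) :
    ‖F z‖ ≤ L * s ^ α * ‖z‖ := by
  simpa [hF.map_zero] using
    hF.norm_sub_le_of_norm_le hz (w := 0) (norm_zero.trans_le ((norm_nonneg z).trans hz))

theorem norm_add_sub_le (hF : PowerLipschitz F L α) {z w : ℂ} {s : ℝ} (hz : ‖z‖ ≤ s) :
    ‖F (z + w) - F z‖ ≤ L * 2 ^ α * (s ^ α + ‖w‖) * ‖w‖ := by
  have nonneg_L := hF.nonneg
  have nonneg_s : 0 ≤ s := (norm_nonneg z).trans hz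
  set r := max s (min ‖w‖ 1)
  have nonneg_r : 0 ≤ r := le_max_of_le_left nonneg_s
  have max_norm_le : max (min ‖z + w‖ 2) (min ‖z‖ 2) ≤ 2 * r := by
    have := norm_add_le z w
    grind
  have rpow_r_le : r ^ α ≤ s ^ α + ‖w‖ := by
    rcases max_choice s (min ‖w‖ 1) with r_eq | r_eq <;> simp only [r, r_eq]
    · exact le_add_of_nonneg_right (norm_nonneg w)
    · exact (Real.rpow_le_self_of_le_one (by positivity) (min_le_right _ _) hF.one_le).trans
        ((min_le_left _ _).trans (le_add_of_nonneg_left (by positivity)))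
  calc ‖F (z + w) - F z‖ ≤ L * (2 * r) ^ α * ‖w‖ := by
        simpa only [add_sub_cancel_left] using hF.norm_sub_le_of_max_le max_norm_le
    _ = L * 2 ^ α * r ^ α * ‖w‖ := by
        rw [Real.mul_rpow zero_le_two nonneg_r, mul_assoc L (2 ^ α)]
    _ ≤ _ := by gcongr

theorem norm_map_add_sub_sub_le (hF : PowerLipschitz F L α) {z w : ℂ} {s : ℝ} (hz : ‖z‖ ≤ s)
    (hw : ‖w‖ ≤ s) (hzw : ‖z + w‖ ≤ s) :
    ‖F (z + w) - F z - F w‖ ≤ 2 * L * s ^ α * ‖w‖ := by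
  have increment_le : ‖F (z + w) - F z‖ ≤ L * s ^ α * ‖w‖ := by
    simpa only [add_sub_cancel_left] using hF.norm_sub_le_of_norm_le hzw hz
  linarith [_root_.norm_sub_le (F (z + w) - F z) (F w), hF.norm_le hw]

theorem norm_map_add_sub_sub_le_min (hF : PowerLipschitz F L α) {z w : ℂ} {s : ℝ}
    (hz : ‖z‖ ≤ s) (hw : ‖w‖ ≤ s) (hzw : ‖z + w‖ ≤ s) :
    ‖F (z + w) - F z - F w‖ ≤ 2 * L * s ^ α * min ‖z‖ ‖w‖ := by
  rcases min_choice ‖z‖ ‖w‖ with min_eq | min_eq <;> rw [min_eq]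
  · rw [sub_right_comm, add_comm]
    exact hF.norm_map_add_sub_sub_le hw hz (by rwa [add_comm])
  · exact hF.norm_map_add_sub_sub_le hz hw hzw

end PowerLipschitz

namespace Train

variable {α lam : ℝ} {B β v : ℕ → ℝ} {R : ℕ → ℝ → ℝ → ℂ} {F : ℂ → ℂ} {L : ℝ}

theorem summable_norm (h : Train α lam B β v R) (t x : ℝ) : Summable fun j => ‖R j t x‖ :=
  Summable.of_nonneg_of_le (fun _ => norm_nonneg _) (fun j => h.norm_le j t x)
    (h.summable_envelope t x)

theorem norm_le_B (h : Train α lam B β v R) (j : ℕ) (t x : ℝ) : ‖R j t x‖ ≤ B j :=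
  (h.norm_le j t x).trans (h.envelope_le j t x)

theorem norm_le_tsum (h : Train α lam B β v R) (j : ℕ) (t x : ℝ) :
    ‖R j t x‖ ≤ ∑' j, envelope B β v j t x :=
  (h.norm_le j t x).trans ((h.summable_envelope t x).le_tsum j fun i _ => h.envelope_nonneg i t x)

theorem norm_tsum_le (h : Train α lam B β v R) (t x : ℝ) :
    ‖∑' j, R j t x‖ ≤ ∑' j, envelope B β v j t x :=
  tsum_of_norm_bounded (h.summable_envelope t x).hasSum fun j => h.norm_le j t x

theorem norm_tsum_le_one (h : Train α lam B β v R) (t x : ℝ) : ‖∑' j, R j t x‖ ≤ 1 :=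
  (h.norm_tsum_le t x).trans (h.tsum_envelope_le_one t x)

theorem continuous_tsum (h : Train α lam B β v R) :
    Continuous fun p : ℝ × ℝ => ∑' j, R j p.1 p.2 :=
  _root_.continuous_tsum h.continuous h.summable_B fun j p => h.norm_le_B j p.1 p.2

theorem norm_comp_le (h : Train α lam B β v R) (hF : PowerLipschitz F L α) (j : ℕ) (t x : ℝ) :
    ‖F (R j t x)‖ ≤ L * B j := by
  have norm_le_one : ‖R j t x‖ ≤ 1 := (h.norm_le_tsum j t x).trans (h.tsum_envelope_le_one t x)
  calc ‖F (R j t x)‖ ≤ L * 1 ^ α * ‖R j t x‖ := hF.norm_le norm_le_one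
    _ = L * ‖R j t x‖ := by rw [Real.one_rpow, mul_one]
    _ ≤ L * B j := mul_le_mul_of_nonneg_left (h.norm_le_B j t x) hF.nonneg

theorem summable_comp (h : Train α lam B β v R) (hF : PowerLipschitz F L α) (t x : ℝ) :
    Summable fun j => F (R j t x) :=
  Summable.of_norm_bounded (h.summable_B.mul_left L) fun j => h.norm_comp_le hF j t x

theorem continuous_tsum_comp (h : Train α lam B β v R) (hF : PowerLipschitz F L α) :
    Continuous fun p : ℝ × ℝ => ∑' j, F (R j p.1 p.2) :=
  _root_.continuous_tsum (fun j => hF.continuous.comp (h.continuous j)) (h.summable_B.mul_left L)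
    fun j p => h.norm_comp_le hF j p.1 p.2

theorem continuous_interaction (h : Train α lam B β v R) (hF : PowerLipschitz F L α) :
    Continuous fun p : ℝ × ℝ => interaction F R p.1 p.2 :=
  (hF.continuous.comp h.continuous_tsum).sub (h.continuous_tsum_comp hF)

theorem norm_sum_range_le (h : Train α lam B β v R) (N : ℕ) (t x : ℝ) :
    ‖∑ j ∈ Finset.range N, R j t x‖ ≤ ∑ j ∈ Finset.range N, envelope B β v j t x :=
  norm_sum_le_of_le _ fun j _ => h.norm_le j t x

theorem norm_sum_range_le_tsum (h : Train α lam B β v R) (N : ℕ) (t x : ℝ) :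
    ‖∑ j ∈ Finset.range N, R j t x‖ ≤ ∑' j, envelope B β v j t x :=
  (h.norm_sum_range_le N t x).trans
    ((h.summable_envelope t x).sum_le_tsum _ fun j _ => h.envelope_nonneg j t x)

theorem min_norm_sum_range_le (h : Train α lam B β v R) {t : ℝ} (ht : 0 ≤ t) (N : ℕ) (x : ℝ) :
    min ‖∑ j ∈ Finset.range N, R j t x‖ ‖R N t x‖ ≤
      (1 / 2 : ℝ) ^ (N + 1) * Real.exp (-lam * t) :=
  calc min ‖∑ j ∈ Finset.range N, R j t x‖ ‖R N t x‖
      ≤ min (∑ j ∈ Finset.range N, envelope B β v j t x) (envelope B β v N t x) :=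
        min_le_min (h.norm_sum_range_le N t x) (h.norm_le N t x)
    _ ≤ ∑ j ∈ Finset.range N, min (envelope B β v j t x) (envelope B β v N t x) :=
        min_sum_le _ (fun j => h.envelope_nonneg j t x) (h.envelope_nonneg N t x)
    _ ≤ ∑ j ∈ Finset.range N,
        (1 / 2 : ℝ) ^ (j + 1) * ((1 / 2 : ℝ) ^ (N + 1) * Real.exp (-lam * t)) :=
        Finset.sum_le_sum fun j hj => h.min_envelope_le (Finset.mem_range.1 hj) ht x
    _ = (∑ j ∈ Finset.range N, (1 / 2 : ℝ) ^ (j + 1)) *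
        ((1 / 2 : ℝ) ^ (N + 1) * Real.exp (-lam * t)) := by rw [Finset.sum_mul]
    _ ≤ _ := mul_le_of_le_one_left (by positivity) (sum_half_pow_succ_le N)

theorem norm_map_sum_succ_sub_sub_le (h : Train α lam B β v R) (hF : PowerLipschitz F L α) {t : ℝ}
    (ht : 0 ≤ t) (N : ℕ) (x : ℝ) :
    ‖F (∑ j ∈ Finset.range (N + 1), R j t x) - F (∑ j ∈ Finset.range N, R j t x) - F (R N t x)‖ ≤
      2 * L * trainWeight α B β v t x * ((1 / 2 : ℝ) ^ (N + 1) * Real.exp (-lam * t)) := by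
  have nonneg_L := hF.nonneg
  have nonneg_weight := h.trainWeight_nonneg t x
  have norm_succ_le := h.norm_sum_range_le_tsum (N + 1) t x
  rw [Finset.sum_range_succ] at norm_succ_le ⊢
  refine (hF.norm_map_add_sub_sub_le_min (h.norm_sum_range_le_tsum N t x) (h.norm_le_tsum N t x)
    norm_succ_le).trans ?_
  gcongr
  · exact h.rpow_tsum_envelope_le t x
  · exact h.min_norm_sum_range_le ht N x

theorem norm_map_sum_sub_sum_le (h : Train α lam B β v R) (hF : PowerLipschitz F L α) {t : ℝ}
    (ht : 0 ≤ t) (N : ℕ) (x : ℝ) :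
    ‖F (∑ j ∈ Finset.range N, R j t x) - ∑ j ∈ Finset.range N, F (R j t x)‖ ≤
      2 * L * trainWeight α B β v t x *
        ((∑ j ∈ Finset.range N, (1 / 2 : ℝ) ^ (j + 1)) * Real.exp (-lam * t)) := by
  induction N with
  | zero => simp [hF.map_zero]
  | succ N ih =>
    have telescope : F (∑ j ∈ Finset.range (N + 1), R j t x) -
        ∑ j ∈ Finset.range (N + 1), F (R j t x) =
        (F (∑ j ∈ Finset.range N, R j t x) - ∑ j ∈ Finset.range N, F (R j t x)) +
        (F (∑ j ∈ Finset.range (N + 1), R j t x) - F (∑ j ∈ Finset.range N, R j t x) -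
          F (R N t x)) := by
      rw [Finset.sum_range_succ (fun j => F (R j t x))]
      ring
    rw [telescope, Finset.sum_range_succ (fun j => (1 / 2 : ℝ) ^ (j + 1)), add_mul, mul_add]
    exact norm_add_le_of_le ih (h.norm_map_sum_succ_sub_sub_le hF ht N x)

theorem norm_interaction_le (h : Train α lam B β v R) (hF : PowerLipschitz F L α) {t : ℝ}
    (ht : 0 ≤ t) (x : ℝ) :
    ‖interaction F R t x‖ ≤ 2 * L * trainWeight α B β v t x * Real.exp (-lam * t) := by
  have nonneg_L := hF.nonneg
  have nonneg_weight := h.trainWeight_nonneg t x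
  have tendsto_partial : Tendsto (fun N => F (∑ j ∈ Finset.range N, R j t x) -
      ∑ j ∈ Finset.range N, F (R j t x)) atTop (𝓝 (interaction F R t x)) :=
    ((hF.continuous.tendsto _).comp (h.summable_norm t x).of_norm.hasSum.tendsto_sum_nat).sub
      (h.summable_comp hF t x).hasSum.tendsto_sum_nat
  refine le_of_tendsto tendsto_partial.norm (Eventually.of_forall fun N =>
    (h.norm_map_sum_sub_sum_le hF ht N x).trans ?_)
  gcongr
  exact mul_le_of_le_one_left (Real.exp_pos _).le (sum_half_pow_succ_le N)

theorem norm_add_sub_le (h : Train α lam B β v R) (hF : PowerLipschitz F L α) (t x : ℝ) (w : ℂ) :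
    ‖F (∑' j, R j t x + w) - F (∑' j, R j t x)‖ ≤
      L * 2 ^ α * (trainWeight α B β v t x + ‖w‖) * ‖w‖ := by
  have nonneg_L := hF.nonneg
  refine (hF.norm_add_sub_le (h.norm_tsum_le t x)).trans ?_
  gcongr
  exact h.rpow_tsum_envelope_le t x

end Train

namespace PowerLipschitz

variable {F : ℂ → ℂ} {L α : ℝ} {T : ℝ → ℝ → ℂ}

theorem memLp_comp_add_sub (hF : PowerLipschitz F L α) {T : ℝ → ℂ} (hT : Continuous T)
    (w : L2Line) : MemLp (fun x => F (T x + w x) - F (T x)) 2 volume := by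
  refine MemLp.of_le_mul (c := L * 2 ^ α) (Lp.memLp w) ?_ (Eventually.of_forall fun x => ?_)
  · exact (hF.continuous.comp_aestronglyMeasurable (hT.aestronglyMeasurable.add
      (Lp.aestronglyMeasurable w))).sub (hF.continuous.comp hT).aestronglyMeasurable
  · simpa only [add_sub_cancel_left] using hF.norm_sub_le (T x + w x) (T x)

/-- The superposition operator `w ↦ F (T t + w) - F (T t)` on `L²`. -/
noncomputable def superposition (hF : PowerLipschitz F L α)
    (hT : Continuous fun p : ℝ × ℝ => T p.1 p.2) (t : ℝ) (w : L2Line) : L2Line :=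
  (hF.memLp_comp_add_sub (hT.comp (Continuous.prodMk_right t)) w).toLp _

theorem coeFn_superposition (hF : PowerLipschitz F L α)
    (hT : Continuous fun p : ℝ × ℝ => T p.1 p.2) (t : ℝ) (w : L2Line) :
    hF.superposition hT t w =ᵐ[volume] fun x => F (T t x + w x) - F (T t x) :=
  MemLp.coeFn_toLp _

theorem norm_superposition_sub_le (hF : PowerLipschitz F L α)
    (hT : Continuous fun p : ℝ × ℝ => T p.1 p.2) (t : ℝ) (v w : L2Line) :
    ‖hF.superposition hT t v - hF.superposition hT t w‖ ≤ L * 2 ^ α * ‖v - w‖ := by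
  refine Lp.norm_le_mul_norm_of_ae_le_mul ?_
  filter_upwards [hF.coeFn_superposition hT t v, hF.coeFn_superposition hT t w,
    Lp.coeFn_sub v w, Lp.coeFn_sub (hF.superposition hT t v) (hF.superposition hT t w)]
    with x hv hw hvw hsub
  rw [hvw, hsub, Pi.sub_apply, Pi.sub_apply, hv, hw, sub_sub_sub_cancel_right]
  simpa only [add_sub_add_left_eq_sub] using hF.norm_sub_le (T t x + v x) (T t x + w x)

theorem superposition_zero (hF : PowerLipschitz F L α)
    (hT : Continuous fun p : ℝ × ℝ => T p.1 p.2) (t : ℝ) : hF.superposition hT t 0 = 0 := by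
  refine Lp.ext ?_
  filter_upwards [hF.coeFn_superposition hT t 0, Lp.coeFn_zero ℂ 2 (volume : Measure ℝ)]
    with x hx hzero
  simp only [hx, hzero, Pi.zero_apply, add_zero, sub_self]

theorem continuous_superposition_left (hF : PowerLipschitz F L α)
    (hT : Continuous fun p : ℝ × ℝ => T p.1 p.2) (w : L2Line) :
    Continuous fun t => hF.superposition hT t w := by
  refine continuous_toLp_of_dominated (by norm_num)
    (fun t => hF.memLp_comp_add_sub (hT.comp (Continuous.prodMk_right t)) w)
    (fun t₀ => ⟨fun x => L * 2 ^ α * ‖w x‖, (Lp.memLp w).norm.const_mul _,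
      Eventually.of_forall fun t => Eventually.of_forall fun x => ?_⟩)
    fun t₀ => Eventually.of_forall fun x => Continuous.continuousAt ?_
  · simpa using hF.norm_sub_le (T t x + w x) (T t x)
  · have continuous_T : Continuous fun t => T t x := hT.comp (Continuous.prodMk_left x)
    exact (hF.continuous.comp (continuous_T.add continuous_const)).sub
      (hF.continuous.comp continuous_T)

theorem continuous_superposition (hF : PowerLipschitz F L α)
    (hT : Continuous fun p : ℝ × ℝ => T p.1 p.2) :
    Continuous fun p : ℝ × L2Line => hF.superposition hT p.1 p.2 := by
  refine continuous_prod_of_continuous_lipschitzWith' _ (L * 2 ^ α).toNNReal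
    (fun t => LipschitzWith.of_dist_le' fun v w => ?_) (hF.continuous_superposition_left hT)
  simpa only [dist_eq_norm] using hF.norm_superposition_sub_le hT t v w

end PowerLipschitz

theorem L2Line.integrable_norm_sq (w : L2Line) : Integrable fun x => ‖w x‖ ^ 2 :=
  (memLp_two_iff_integrable_sq_norm (Lp.aestronglyMeasurable w)).1 (Lp.memLp w)

theorem L2Line.integral_norm_sq (w : L2Line) : ∫ x, ‖w x‖ ^ 2 = ‖w‖ ^ 2 := by
  have inner_self_eq : (∫ x, inner ℂ (w x) (w x)) = ((‖w‖ : ℂ)) ^ 2 := by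
    rw [← L2.inner_def, inner_self_eq_norm_sq_to_K]
    rfl
  simp only [inner_self_eq_norm_sq_to_K, Complex.coe_algebraMap] at inner_self_eq
  exact_mod_cast inner_self_eq

namespace TrainSeq

variable {α lam : ℝ} {B β v : ℕ → ℝ}

theorem trainWeight_sq_le (h : TrainSeq α lam B β v) (t x : ℝ) :
    trainWeight α B β v t x ^ 2 ≤ trainWeight α B β v t x :=
  pow_le_of_le_one (h.trainWeight_nonneg t x) (h.trainWeight_le_one t x) two_ne_zero

theorem integrable_trainWeight_sq (h : TrainSeq α lam B β v) (t : ℝ) :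
    Integrable fun x => trainWeight α B β v t x ^ 2 := by
  refine (h.integrable_trainWeight t).mono'
    ((h.continuous_trainWeight.comp (Continuous.prodMk_right t)).pow 2).aestronglyMeasurable
    (Eventually.of_forall fun x => ?_)
  rw [Real.norm_of_nonneg (sq_nonneg _)]
  exact h.trainWeight_sq_le t x

theorem memLp_trainWeight (h : TrainSeq α lam B β v) (t : ℝ) :
    MemLp (trainWeight α B β v t) 2 volume :=
  (memLp_two_iff_integrable_sq (h.integrable_trainWeight t).1).2 (h.integrable_trainWeight_sq t)

theorem integral_trainWeight_sq_le (h : TrainSeq α lam B β v) (t : ℝ) :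
    ∫ x, trainWeight α B β v t x ^ 2 ≤ 1 :=
  (integral_mono (h.integrable_trainWeight_sq t) (h.integrable_trainWeight t)
    (h.trainWeight_sq_le t)).trans (h.integral_trainWeight_le t)

theorem integrable_weight_mul (h : TrainSeq α lam B β v) (t : ℝ) (w : L2Line) :
    Integrable fun x => trainWeight α B β v t x * ‖w x‖ :=
  (h.memLp_trainWeight t).integrable_mul (Lp.memLp w).norm

theorem integral_weight_mul_le (h : TrainSeq α lam B β v) (t : ℝ) (w : L2Line) :
    ∫ x, trainWeight α B β v t x * ‖w x‖ ≤ ‖w‖ := by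
  have cauchy_schwarz := integral_mul_le_Lp_mul_Lq_of_nonneg (μ := volume) (p := 2) (q := 2)
    Real.HolderConjugate.two_two (Eventually.of_forall (h.trainWeight_nonneg t))
    (Eventually.of_forall fun x => norm_nonneg (w x))
    (by simpa using h.memLp_trainWeight t) (by simpa using (Lp.memLp w).norm)
  simp only [Real.rpow_ofNat, ← Real.sqrt_eq_rpow, w.integral_norm_sq,
    Real.sqrt_sq (norm_nonneg w)] at cauchy_schwarz
  exact cauchy_schwarz.trans (mul_le_of_le_one_left (norm_nonneg w)
    (Real.sqrt_le_one.2 (h.integral_trainWeight_sq_le t)))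

end TrainSeq

theorem TrainSeq.exp_neg_lam_mul_le_one {α lam : ℝ} {B β v : ℕ → ℝ} (h : TrainSeq α lam B β v)
    {t : ℝ} (ht : 0 ≤ t) : Real.exp (-lam * t) ≤ 1 :=
  Real.exp_le_one_iff.2 (mul_nonpos_of_nonpos_of_nonneg (neg_nonpos.2 h.lam_pos.le) ht)

namespace Train

variable {α lam : ℝ} {B β v : ℕ → ℝ} {R : ℕ → ℝ → ℝ → ℂ} {F : ℂ → ℂ} {L : ℝ}

theorem norm_interaction_le_weight (h : Train α lam B β v R) (hF : PowerLipschitz F L α) {t : ℝ}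
    (ht : 0 ≤ t) (x : ℝ) : ‖interaction F R t x‖ ≤ 2 * L * trainWeight α B β v t x :=
  (h.norm_interaction_le hF ht x).trans (mul_le_of_le_one_right
    (mul_nonneg (mul_nonneg zero_le_two hF.nonneg) (h.trainWeight_nonneg t x))
    (h.exp_neg_lam_mul_le_one ht))

theorem memLp_interaction (h : Train α lam B β v R) (hF : PowerLipschitz F L α) (t : ℝ) :
    MemLp (interaction F R (max t 0)) 2 volume := by
  refine MemLp.of_le_mul (c := 2 * L) (h.memLp_trainWeight (max t 0))
    ((h.continuous_interaction hF).comp (Continuous.prodMk_right _)).aestronglyMeasurable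
    (Eventually.of_forall fun x => ?_)
  rw [Real.norm_of_nonneg (h.trainWeight_nonneg _ x)]
  exact h.norm_interaction_le_weight hF (le_max_right t 0) x

/-- The interaction term as a curve in `L²`, frozen at its initial value for negative times. -/
noncomputable def interactionLp (h : Train α lam B β v R) (hF : PowerLipschitz F L α) (t : ℝ) :
    L2Line :=
  (h.memLp_interaction hF t).toLp _

theorem coeFn_interactionLp (h : Train α lam B β v R) (hF : PowerLipschitz F L α) {t : ℝ}
    (ht : 0 ≤ t) : h.interactionLp hF t =ᵐ[volume] interaction F R t := by
  simpa only [interactionLp, max_eq_left ht] using (h.memLp_interaction hF t).coeFn_toLp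

theorem continuous_interactionLp (h : Train α lam B β v R) (hF : PowerLipschitz F L α) :
    Continuous (h.interactionLp hF) := by
  have nonneg_L := hF.nonneg
  refine continuous_toLp_of_dominated (by norm_num) (h.memLp_interaction hF)
    (fun t₀ => ⟨fun x => 2 * L * √(localWeight α B β v (max t₀ 0) x),
      (h.memLp_sqrt_localWeight _).const_mul _, ?_⟩)
    fun t₀ => Eventually.of_forall fun x => ((h.continuous_interaction hF).comp
      (f := fun t : ℝ => ((max t 0, x) : ℝ × ℝ)) (by fun_prop)).continuousAt
  have continuousAt_dist : ContinuousAt (fun t : ℝ => 2 * lam * |max t 0 - max t₀ 0|) t₀ := by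
    fun_prop
  have dist_lt_one : 2 * lam * |max t₀ 0 - max t₀ 0| < 1 := by simp
  filter_upwards [continuousAt_dist.eventually_lt_const dist_lt_one] with t ht
  refine Eventually.of_forall fun x =>
    (h.norm_interaction_le_weight hF (le_max_right t 0) x).trans ?_
  gcongr
  exact h.trainWeight_le_sqrt ht.le x

theorem norm_interactionLp_le (h : Train α lam B β v R) (hF : PowerLipschitz F L α) {t : ℝ}
    (ht : 0 ≤ t) : ‖h.interactionLp hF t‖ ≤ 2 * L * Real.exp (-lam * t) := by
  have nonneg_L := hF.nonneg
  have sq_le : ∀ᵐ x, ‖h.interactionLp hF t x‖ ^ 2 ≤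
      (2 * L * Real.exp (-lam * t)) ^ 2 * trainWeight α B β v t x ^ 2 := by
    filter_upwards [h.coeFn_interactionLp hF ht] with x hx
    rw [hx, ← mul_pow, mul_right_comm]
    exact pow_le_pow_left₀ (norm_nonneg _) (h.norm_interaction_le hF ht x) 2
  refine (pow_le_pow_iff_left₀ (norm_nonneg _) (by positivity) two_ne_zero).1 ?_
  calc ‖h.interactionLp hF t‖ ^ 2 = ∫ x, ‖h.interactionLp hF t x‖ ^ 2 :=
        (L2Line.integral_norm_sq _).symm
    _ ≤ ∫ x, (2 * L * Real.exp (-lam * t)) ^ 2 * trainWeight α B β v t x ^ 2 :=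
        integral_mono_ae (L2Line.integrable_norm_sq _)
          ((h.integrable_trainWeight_sq t).const_mul _) sq_le
    _ ≤ (2 * L * Real.exp (-lam * t)) ^ 2 := by
        rw [integral_const_mul]
        exact mul_le_of_le_one_right (sq_nonneg _) (h.integral_trainWeight_sq_le t)

/-- The nonlinear term `F (∑ R + w) - ∑ F (R)` in the equation for the remainder `w`. -/
noncomputable def forcing (h : Train α lam B β v R) (hF : PowerLipschitz F L α) (t : ℝ)
    (w : L2Line) : L2Line :=
  hF.superposition (T := fun t x => ∑' j, R j t x) h.continuous_tsum t w + h.interactionLp hF t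

theorem coeFn_forcing_eq_add (h : Train α lam B β v R) (hF : PowerLipschitz F L α) {t : ℝ}
    (ht : 0 ≤ t) (w : L2Line) : h.forcing hF t w =ᵐ[volume] fun x =>
      F (∑' j, R j t x + w x) - F (∑' j, R j t x) + interaction F R t x :=
  (Lp.coeFn_add _ _).trans
    ((hF.coeFn_superposition (T := fun t x => ∑' j, R j t x) h.continuous_tsum t w).add
      (h.coeFn_interactionLp hF ht))

theorem coeFn_forcing (h : Train α lam B β v R) (hF : PowerLipschitz F L α) {t : ℝ} (ht : 0 ≤ t)
    (w : L2Line) : h.forcing hF t w =ᵐ[volume]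
      fun x => F (∑' j, R j t x + w x) - ∑' j, F (R j t x) := by
  simpa only [interaction, sub_add_sub_cancel] using h.coeFn_forcing_eq_add hF ht w

theorem norm_forcing_apply_le (h : Train α lam B β v R) (hF : PowerLipschitz F L α) {t : ℝ}
    (ht : 0 ≤ t) (w : L2Line) : ∀ᵐ x, ‖h.forcing hF t w x‖ ≤
      L * 2 ^ α * (trainWeight α B β v t x * ‖w x‖ + ‖w x‖ ^ 2) +
        2 * L * Real.exp (-lam * t) * trainWeight α B β v t x := by
  filter_upwards [h.coeFn_forcing_eq_add hF ht w] with x hx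
  rw [hx]
  refine (norm_add_le _ _).trans ?_
  linarith [h.norm_add_sub_le hF t x (w x), h.norm_interaction_le hF ht x]

theorem integrable_weight_mul_add_sq (h : Train α lam B β v R) (t : ℝ) (w : L2Line) :
    Integrable fun x => trainWeight α B β v t x * ‖w x‖ + ‖w x‖ ^ 2 :=
  (h.integrable_weight_mul t w).add w.integrable_norm_sq

theorem integrable_forcing_bound (h : Train α lam B β v R) (t c c' : ℝ) (w : L2Line) :
    Integrable fun x => c * (trainWeight α B β v t x * ‖w x‖ + ‖w x‖ ^ 2) +
      c' * trainWeight α B β v t x :=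
  ((h.integrable_weight_mul_add_sq t w).const_mul c).add ((h.integrable_trainWeight t).const_mul c')

theorem integrable_forcing (h : Train α lam B β v R) (hF : PowerLipschitz F L α) {t : ℝ}
    (ht : 0 ≤ t) (w : L2Line) : Integrable (h.forcing hF t w) :=
  (h.integrable_forcing_bound t _ _ w).mono' (Lp.aestronglyMeasurable _)
    (h.norm_forcing_apply_le hF ht w)

theorem integral_norm_forcing_le (h : Train α lam B β v R) (hF : PowerLipschitz F L α) {t : ℝ}
    (ht : 0 ≤ t) {w : L2Line} (hw : ‖w‖ ≤ Real.exp (-lam * t)) :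
    ∫ x, ‖h.forcing hF t w x‖ ≤ (2 * L * 2 ^ α + 2 * L) * Real.exp (-lam * t) := by
  have nonneg_L := hF.nonneg
  set e := Real.exp (-lam * t)
  have norm_sq_le : ‖w‖ ^ 2 ≤ e :=
    (pow_le_of_le_one (norm_nonneg w) (hw.trans (h.exp_neg_lam_mul_le_one ht)) two_ne_zero).trans hw
  calc ∫ x, ‖h.forcing hF t w x‖
      ≤ ∫ x, (L * 2 ^ α * (trainWeight α B β v t x * ‖w x‖ + ‖w x‖ ^ 2) +
          2 * L * e * trainWeight α B β v t x) :=
        integral_mono_ae (h.integrable_forcing hF ht w).norm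
          (h.integrable_forcing_bound t _ _ w) (h.norm_forcing_apply_le hF ht w)
    _ = L * 2 ^ α * ((∫ x, trainWeight α B β v t x * ‖w x‖) + ‖w‖ ^ 2) +
          2 * L * e * ∫ x, trainWeight α B β v t x := by
        rw [integral_add ((h.integrable_weight_mul_add_sq t w).const_mul _)
          ((h.integrable_trainWeight t).const_mul _), integral_const_mul, integral_const_mul,
          integral_add (h.integrable_weight_mul t w) w.integrable_norm_sq, w.integral_norm_sq]
    _ ≤ L * 2 ^ α * (e + e) + 2 * L * e * 1 := by
        gcongr
        · exact (h.integral_weight_mul_le t w).trans hw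
        · exact h.integral_trainWeight_le t
    _ = _ := by ring

theorem isDecayingForcing_forcing (h : Train α lam B β v R) (hF : PowerLipschitz F L α) :
    IsDecayingForcing (h.forcing hF) (L * 2 ^ α) (2 * L) lam where
  continuous := (hF.continuous_superposition (T := fun t x => ∑' j, R j t x)
    h.continuous_tsum).add ((h.continuous_interactionLp hF).comp continuous_fst)
  lip_nonneg := mul_nonneg hF.nonneg (by positivity)
  norm_sub_le t w w' := by
    rw [forcing, forcing, add_sub_add_right_eq_sub]
    exact hF.norm_superposition_sub_le _ t w w'
  norm_zero_le t ht := by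
    rw [forcing, hF.superposition_zero, zero_add]
    exact h.norm_interactionLp_le hF ht

end Train

/-! ### The solution around a train -/

/-- The decay rates for which the remainder of size `ε` is constructed. -/
structure AdmissibleRate (L α ε lam : ℝ) : Prop where
  lipschitz_le : 2 * (L * 2 ^ α) ≤ lam
  norm_le : 2 * (2 * L) / lam ≤ ε
  sup_le : (2 * L * 2 ^ α + 2 * L) * √(Real.pi / lam) ≤ ε

theorem eventually_admissibleRate (L α : ℝ) {ε : ℝ} (hε : 0 < ε) :
    ∀ᶠ lam in atTop, AdmissibleRate L α ε lam := by
  have norm_tendsto : Tendsto (fun lam : ℝ => 2 * (2 * L) / lam) atTop (𝓝 0) :=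
    tendsto_const_nhds.div_atTop tendsto_id
  have sup_tendsto : Tendsto (fun lam : ℝ => (2 * L * 2 ^ α + 2 * L) * √(Real.pi / lam))
      atTop (𝓝 0) := by
    have sqrt_tendsto : Tendsto (fun lam : ℝ => √(Real.pi / lam)) atTop (𝓝 0) := by
      simpa using (tendsto_const_nhds (x := Real.pi)).div_atTop tendsto_id |>.sqrt
    simpa using sqrt_tendsto.const_mul (2 * L * 2 ^ α + 2 * L)
  filter_upwards [eventually_ge_atTop (2 * (L * 2 ^ α)), norm_tendsto.eventually_le_const hε,
    sup_tendsto.eventually_le_const hε] with lam lipschitz_le norm_le sup_le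
  exact ⟨lipschitz_le, norm_le, sup_le⟩

/-- `η` is a remainder for the train `∑ R`: it decays like `ε e^{-lam t}` in `L² ∩ L^∞`, and it is
generated from `t = ∞` by Duhamel's formula with the forcing `G = F (∑ R + η) - ∑ F (R)`. -/
structure IsRemainder (F : ℂ → ℂ) (R : ℕ → ℝ → ℝ → ℂ) (lam ε K : ℝ) (η G : ℝ → L2Line) :
    Prop where
  continuous : Continuous η
  continuous_forcing : Continuous G
  norm_forcing_le : ∀ t, 0 ≤ t → ‖G t‖ ≤ K * Real.exp (-lam * t)
  coeFn_forcing : ∀ t, 0 ≤ t → G t =ᵐ[volume]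
    fun x => F (∑' j, R j t x + η t x) - ∑' j, F (R j t x)
  duhamel : ∀ t, 0 ≤ t → η t = (-Complex.I) • ∫ r in Ioi (0 : ℝ), schrodinger r (G (t + r))
  norm_le : ∀ t, 0 ≤ t → ‖η t‖ ≤ ε * Real.exp (-lam * t)
  ae_norm_le : ∀ t, 0 ≤ t → ∀ᵐ x, ‖η t x‖ ≤ ε * Real.exp (-lam * t)

/-- `W` represents the curve `ζ` of `L²` functions at nonnegative times by a jointly measurable
function with values in the unit disc. -/
structure IsBoundedRepresentative (W : ℝ → ℝ → ℂ) (ζ : ℝ → L2Line) : Prop where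
  stronglyMeasurable : StronglyMeasurable fun p : ℝ × ℝ => W p.1 p.2
  norm_le_one : ∀ t x, ‖W t x‖ ≤ 1
  ae_eq : ∀ t, 0 ≤ t → W t =ᵐ[volume] ζ t

theorem exists_isBoundedRepresentative {ζ : ℝ → L2Line} (hζ : Continuous ζ)
    (hbound : ∀ t, 0 ≤ t → ∀ᵐ x, ‖ζ t x‖ ≤ 1) : ∃ W, IsBoundedRepresentative W ζ := by
  obtain ⟨W, measurable_W, ae_eq⟩ := exists_measurable_representative hζ
  refine ⟨fun t x => if ‖W t x‖ ≤ 1 then W t x else 0,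
    StronglyMeasurable.ite (measurableSet_le measurable_W.norm.measurable measurable_const)
      measurable_W stronglyMeasurable_const, fun t x => ?_, fun t ht => ?_⟩
  · split_ifs with norm_le
    · exact norm_le
    · exact norm_zero.trans_le zero_le_one
  · filter_upwards [ae_eq t, hbound t ht] with x eq norm_le
    rw [if_pos (eq ▸ norm_le), eq]

namespace IsBoundedRepresentative

variable {W : ℝ → ℝ → ℂ} {ζ : ℝ → L2Line}

theorem stronglyMeasurable_slice (hW : IsBoundedRepresentative W ζ) (t : ℝ) :
    StronglyMeasurable (W t) :=
  hW.stronglyMeasurable.comp_measurable measurable_prodMk_left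

theorem tendsto_eLpNorm_sub (hW : IsBoundedRepresentative W ζ) (hζ : Continuous ζ) {t₀ : ℝ}
    (ht₀ : 0 ≤ t₀) (s : Set ℝ) :
    Tendsto (fun t => eLpNorm (W t - W t₀) 2 (volume.restrict s)) (𝓝[Ici 0] t₀) (𝓝 0) := by
  have enorm_tendsto : Tendsto (fun t => ‖ζ t - ζ t₀‖ₑ) (𝓝[Ici 0] t₀) (𝓝 0) := by
    have continuous_enorm : Continuous fun t => ‖ζ t - ζ t₀‖ₑ := (hζ.sub continuous_const).enorm
    simpa using (continuous_enorm.tendsto t₀).mono_left nhdsWithin_le_nhds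
  refine tendsto_of_tendsto_of_tendsto_of_le_of_le' tendsto_const_nhds enorm_tendsto
    (Eventually.of_forall fun _ => zero_le) ?_
  filter_upwards [self_mem_nhdsWithin] with t ht
  rw [Lp.enorm_def, ← eLpNorm_congr_ae
    (((hW.ae_eq t ht).sub (hW.ae_eq t₀ ht₀)).trans (Lp.coeFn_sub _ _).symm)]
  exact eLpNorm_mono_measure _ Measure.restrict_le_self

end IsBoundedRepresentative

theorem locallyIntegrable_of_norm_le {X : Type*} [TopologicalSpace X] [MeasurableSpace X]
    {μ : Measure X} [IsLocallyFiniteMeasure μ] {u : X → ℂ}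
    (hu : AEStronglyMeasurable u μ) {C : ℝ} (hC : ∀ p, ‖u p‖ ≤ C) : LocallyIntegrable u μ :=
  (locallyIntegrable_const C).mono hu
    (Eventually.of_forall fun p => (hC p).trans (le_abs_self C))

namespace IsTest

variable {χ : ℝ × ℝ → ℂ}

theorem integrable_mul_of_norm_le {u : ℝ × ℝ → ℂ} (h : IsTest χ)
    (hu : AEStronglyMeasurable u volume) {C : ℝ} (hC : ∀ p, ‖u p‖ ≤ C) :
    Integrable (fun p => u p * χ p) volume :=
  h.integrable.bdd_mul hu (Eventually.of_forall hC)

theorem integrable_slice_mul (h : IsTest χ) (t : ℝ) (w : L2Line) :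
    Integrable fun x => χ (t, x) * w x :=
  MemLp.integrable_mul (p := 2) (q := 2) ((h.contDiff_slice t).continuous.memLp_of_hasCompactSupport
    (h.hasCompactSupport_slice t)) (Lp.memLp w)

theorem integrable_inner_slice (h : IsTest χ) {ζ : ℝ → L2Line} (hζ : Continuous ζ) :
    Integrable fun t => inner ℂ (h.slice t) (ζ t) :=
  (h.continuous_slice.inner hζ).integrable_of_hasCompactSupport
    (h.hasCompactSupport_slice_toLp.mono' (subset_closure.trans' fun t ht => by
      contrapose! ht
      simp [Function.notMem_support.1 ht]))

end IsTest

namespace IsRemainder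

variable {lam : ℝ} {R : ℕ → ℝ → ℝ → ℂ} {F : ℂ → ℂ} {ε K : ℝ} {η G : ℝ → L2Line} {W : ℝ → ℝ → ℂ}

theorem integral_slice_pairing (hη : IsRemainder F R lam ε K η G)
    (hW : IsBoundedRepresentative W η) {χ : ℝ × ℝ → ℂ} (hχ : IsTest χ)
    (hpos : ∀ t ≤ 0, ∀ x, χ (t, x) = 0) (t : ℝ) :
    ∫ x, (W t x * adjointSchrodinger χ (t, x) +
      (F (∑' j, R j t x + W t x) - ∑' j, F (R j t x)) * χ (t, x)) =
      inner ℂ (hχ.adjointSchrodinger.slice t) (η t) + inner ℂ (hχ.slice t) (G t) := by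
  rcases le_or_gt t 0 with ht | ht
  · have adjoint_eq_zero := hχ.adjointSchrodinger_eq_zero hpos ht
    simp only [hpos t ht, adjoint_eq_zero, mul_zero, add_zero, integral_zero,
      hχ.slice_eq_zero (hpos t ht), hχ.adjointSchrodinger.slice_eq_zero adjoint_eq_zero,
      inner_zero_left]
  · rw [IsTest.inner_slice, IsTest.inner_slice,
      ← integral_add (hχ.adjointSchrodinger.integrable_slice_mul t _) (hχ.integrable_slice_mul t _)]
    refine integral_congr_ae ?_
    filter_upwards [hW.ae_eq t ht.le, hη.coeFn_forcing t ht.le] with x W_eq G_eq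
    rw [G_eq, W_eq]
    ring

end IsRemainder

namespace Train

variable {α lam : ℝ} {B β v : ℕ → ℝ} {R : ℕ → ℝ → ℝ → ℂ} {L : ℝ} {F : ℂ → ℂ}

theorem exists_isRemainder {ε : ℝ} (h : Train α lam B β v R) (hF : PowerLipschitz F L α)
    (hε : ε ≤ 1) (hlam : AdmissibleRate L α ε lam) :
    ∃ (K : ℝ) (η G : ℝ → L2Line), IsRemainder F R lam ε K η G := by
  have decaying := h.isDecayingForcing_forcing hF
  obtain ⟨η, continuous_η, duhamel, norm_le_quot⟩ := decaying.exists_decaying_duhamel_solution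
    h.lam_pos hlam.lipschitz_le continuous_schrodinger
  have norm_le : ∀ t, 0 ≤ t → ‖η t‖ ≤ ε * Real.exp (-lam * t) := fun t ht =>
    (norm_le_quot t ht).trans (mul_le_mul_of_nonneg_right hlam.norm_le (Real.exp_pos _).le)
  have norm_le_exp : ∀ t, 0 ≤ t → ‖η t‖ ≤ Real.exp (-lam * t) := fun t ht =>
    (norm_le t ht).trans (mul_le_of_le_one_left (Real.exp_pos _).le hε)
  have continuous_G : Continuous fun t => h.forcing hF t (η t) :=
    decaying.continuous.comp (continuous_id.prodMk continuous_η)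
  have norm_forcing_le : ∀ t, 0 ≤ t → ‖h.forcing hF t (η t)‖ ≤
      (2 * L + L * 2 ^ α * 1) * Real.exp (-lam * t) := fun t ht =>
    decaying.norm_le ht ((norm_le_exp t ht).trans_eq (one_mul _).symm)
  refine ⟨_, η, fun t => h.forcing hF t (η t), continuous_η, continuous_G, norm_forcing_le,
    fun t ht => h.coeFn_forcing hF ht (η t), duhamel, norm_le, fun t ht => ?_⟩
  filter_upwards [ae_norm_le_of_duhamel continuous_G h.lam_pos norm_forcing_le
    (fun s hs => h.integrable_forcing hF hs (η s))
    (fun s hs => h.integral_norm_forcing_le hF hs (norm_le_exp s hs)) ht (duhamel t ht)] with x hx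
  exact hx.trans (mul_le_mul_of_nonneg_right hlam.sup_le (Real.exp_pos _).le)

theorem norm_tsum_comp_le (h : Train α lam B β v R) (hF : PowerLipschitz F L α) (t x : ℝ) :
    ‖∑' j, F (R j t x)‖ ≤ ∑' j, L * B j :=
  tsum_of_norm_bounded (h.summable_B.mul_left L).hasSum fun j => h.norm_comp_le hF j t x

theorem norm_tsum_add_le_two (h : Train α lam B β v R) (t x : ℝ) {w : ℂ} (hw : ‖w‖ ≤ 1) :
    ‖∑' j, R j t x + w‖ ≤ 2 :=
  (norm_add_le_of_le (h.norm_tsum_le_one t x) hw).trans_eq one_add_one_eq_two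

theorem norm_comp_tsum_add_le (h : Train α lam B β v R) (hF : PowerLipschitz F L α) (t x : ℝ)
    {w : ℂ} (hw : ‖w‖ ≤ 1) : ‖F (∑' j, R j t x + w)‖ ≤ L * 2 ^ α * 2 :=
  (hF.norm_le (h.norm_tsum_add_le_two t x hw)).trans (mul_le_mul_of_nonneg_left
    (h.norm_tsum_add_le_two t x hw) (mul_nonneg hF.nonneg (Real.rpow_nonneg zero_le_two α)))

theorem integrable_train_pairing (h : Train α lam B β v R) (hF : PowerLipschitz F L α)
    {χ : ℝ × ℝ → ℂ} (hχ : IsTest χ) :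
    Integrable (fun p : ℝ × ℝ => (∑' j, R j p.1 p.2) * adjointSchrodinger χ p +
      (∑' j, F (R j p.1 p.2)) * χ p) volume :=
  (hχ.adjointSchrodinger.integrable_mul_of_norm_le h.continuous_tsum.aestronglyMeasurable
    fun p => h.norm_tsum_le_one p.1 p.2).add
  (hχ.integrable_mul_of_norm_le (h.continuous_tsum_comp hF).aestronglyMeasurable
    fun p => h.norm_tsum_comp_le hF p.1 p.2)

theorem integral_train_eq_zero (h : Train α lam B β v R) (hF : PowerLipschitz F L α)
    {χ : ℝ × ℝ → ℂ} (hχ : IsTest χ)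
    (hR : ∀ j, ∫ p : ℝ × ℝ, (R j p.1 p.2 * adjointSchrodinger χ p + F (R j p.1 p.2) * χ p) = 0) :
    ∫ p : ℝ × ℝ, ((∑' j, R j p.1 p.2) * adjointSchrodinger χ p +
      (∑' j, F (R j p.1 p.2)) * χ p) = 0 := by
  set f : ℕ → ℝ × ℝ → ℂ := fun j p =>
    R j p.1 p.2 * adjointSchrodinger χ p + F (R j p.1 p.2) * χ p
  have integrable_f : ∀ j, Integrable (f j) volume := fun j =>
    (hχ.adjointSchrodinger.integrable_mul_of_norm_le (h.continuous j).aestronglyMeasurable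
      fun p => h.norm_le_B j p.1 p.2).add
    (hχ.integrable_mul_of_norm_le (hF.continuous.comp (h.continuous j)).aestronglyMeasurable
      fun p => h.norm_comp_le hF j p.1 p.2)
  have norm_f_le : ∀ j p, ‖f j p‖ ≤ B j * (‖adjointSchrodinger χ p‖ + L * ‖χ p‖) := fun j p =>
    calc ‖f j p‖ ≤ ‖R j p.1 p.2‖ * ‖adjointSchrodinger χ p‖ + ‖F (R j p.1 p.2)‖ * ‖χ p‖ := by
          simpa only [f, norm_mul] using
            norm_add_le (R j p.1 p.2 * adjointSchrodinger χ p) (F (R j p.1 p.2) * χ p)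
      _ ≤ B j * ‖adjointSchrodinger χ p‖ + L * B j * ‖χ p‖ := by
          gcongr
          · exact h.norm_le_B j p.1 p.2
          · exact h.norm_comp_le hF j p.1 p.2
      _ = B j * (‖adjointSchrodinger χ p‖ + L * ‖χ p‖) := by ring
  have integrable_bound : Integrable (fun p => ‖adjointSchrodinger χ p‖ + L * ‖χ p‖) volume :=
    hχ.adjointSchrodinger.integrable.norm.add (hχ.integrable.norm.const_mul L)
  have summable_integral : Summable fun j => ∫ p, ‖f j p‖ := by
    refine Summable.of_nonneg_of_le (fun j => integral_nonneg fun p => norm_nonneg _) (fun j => ?_)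
      (h.summable_B.mul_right (∫ p, (‖adjointSchrodinger χ p‖ + L * ‖χ p‖)))
    rw [← integral_const_mul]
    exact integral_mono (integrable_f j).norm (integrable_bound.const_mul _) (norm_f_le j)
  calc ∫ p : ℝ × ℝ, ((∑' j, R j p.1 p.2) * adjointSchrodinger χ p + (∑' j, F (R j p.1 p.2)) * χ p)
      = ∫ p, ∑' j, f j p := by
        congr 1 with p
        rw [((h.summable_norm p.1 p.2).of_norm.mul_right _).tsum_add
          ((h.summable_comp hF p.1 p.2).mul_right _), tsum_mul_right, tsum_mul_right]
    _ = ∑' j, ∫ p, f j p := (integral_tsum_of_summable_integral_norm integrable_f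
        summable_integral).symm
    _ = 0 := by simp only [f, hR, tsum_zero]

variable {ε K : ℝ} {η G : ℝ → L2Line} {W : ℝ → ℝ → ℂ}

theorem stronglyMeasurable_tsum_add (h : Train α lam B β v R) (hW : IsBoundedRepresentative W η) :
    StronglyMeasurable fun p : ℝ × ℝ => ∑' j, R j p.1 p.2 + W p.1 p.2 :=
  h.continuous_tsum.stronglyMeasurable.add hW.stronglyMeasurable

theorem integrable_remainder_pairing (h : Train α lam B β v R) (hF : PowerLipschitz F L α)
    (hW : IsBoundedRepresentative W η) {χ : ℝ × ℝ → ℂ} (hχ : IsTest χ) :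
    Integrable (fun p : ℝ × ℝ => W p.1 p.2 * adjointSchrodinger χ p +
      (F (∑' j, R j p.1 p.2 + W p.1 p.2) - ∑' j, F (R j p.1 p.2)) * χ p) volume :=
  (hχ.adjointSchrodinger.integrable_mul_of_norm_le hW.stronglyMeasurable.aestronglyMeasurable
    fun p => hW.norm_le_one p.1 p.2).add
  (hχ.integrable_mul_of_norm_le
    ((hF.continuous.comp_stronglyMeasurable (h.stronglyMeasurable_tsum_add hW)).sub
      (h.continuous_tsum_comp hF).stronglyMeasurable).aestronglyMeasurable
    fun p => norm_sub_le_of_le (h.norm_comp_tsum_add_le hF p.1 p.2 (hW.norm_le_one p.1 p.2))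
      (h.norm_tsum_comp_le hF p.1 p.2))

theorem integral_remainder_eq_zero (h : Train α lam B β v R) (hF : PowerLipschitz F L α)
    (hη : IsRemainder F R lam ε K η G) (hW : IsBoundedRepresentative W η)
    {χ : ℝ × ℝ → ℂ} (hχ : IsTest χ) (hpos : ∀ t ≤ 0, ∀ x, χ (t, x) = 0) :
    ∫ p : ℝ × ℝ, (W p.1 p.2 * adjointSchrodinger χ p +
      (F (∑' j, R j p.1 p.2 + W p.1 p.2) - ∑' j, F (R j p.1 p.2)) * χ p) = 0 := by
  have integrable_pairing := h.integrable_remainder_pairing hF hW hχ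
  rw [Measure.volume_eq_prod] at integrable_pairing ⊢
  rw [integral_prod _ integrable_pairing]
  simp only [hη.integral_slice_pairing hW hχ hpos]
  rw [integral_add (hχ.adjointSchrodinger.integrable_inner_slice hη.continuous)
      (hχ.integrable_inner_slice hη.continuous_forcing),
    hχ.integral_inner_slice_duhamel hpos hη.continuous_forcing h.lam_pos hη.norm_forcing_le
      hη.duhamel, neg_add_cancel]

theorem integral_solution_eq_zero (h : Train α lam B β v R) (hF : PowerLipschitz F L α)
    (hη : IsRemainder F R lam ε K η G) (hW : IsBoundedRepresentative W η)
    {χ : ℝ × ℝ → ℂ} (hχ : IsTest χ) (hpos : ∀ t ≤ 0, ∀ x, χ (t, x) = 0)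
    (hR : ∀ j, ∫ p : ℝ × ℝ, (R j p.1 p.2 * adjointSchrodinger χ p + F (R j p.1 p.2) * χ p) = 0) :
    ∫ p : ℝ × ℝ, ((∑' j, R j p.1 p.2 + W p.1 p.2) * adjointSchrodinger χ p +
      F (∑' j, R j p.1 p.2 + W p.1 p.2) * χ p) = 0 := by
  have integral_sum := integral_add (h.integrable_train_pairing hF hχ)
    (h.integrable_remainder_pairing hF hW hχ)
  rw [h.integral_train_eq_zero hF hχ hR, h.integral_remainder_eq_zero hF hη hW hχ hpos,
    add_zero] at integral_sum
  rw [← integral_sum]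
  congr 1 with p
  ring

theorem tendsto_eLpNorm_tsum_sub (h : Train α lam B β v R) (t₀ r : ℝ) :
    Tendsto (fun t => eLpNorm ((fun x => ∑' j, R j t x) - fun x => ∑' j, R j t₀ x) 2
      (volume.restrict (Icc (-r) r))) (𝓝 t₀) (𝓝 0) := by
  have aestronglyMeasurable_tsum (t : ℝ) := (h.continuous_tsum.comp
    (Continuous.prodMk_right t)).aestronglyMeasurable (μ := volume.restrict (Icc (-r) r))
  refine tendsto_eLpNorm_sub_of_dominated (b := fun _ => 1 + 1) two_ne_zero (by norm_num)
    aestronglyMeasurable_tsum (aestronglyMeasurable_tsum t₀) (memLp_const _)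
    (Eventually.of_forall fun t => Eventually.of_forall fun x =>
      norm_sub_le_of_le (h.norm_tsum_le_one t x) (h.norm_tsum_le_one t₀ x))
    (Eventually.of_forall fun x =>
      (h.continuous_tsum.comp (Continuous.prodMk_left x)).tendsto t₀)

theorem tendsto_eLpNorm_tsum_add_sub (h : Train α lam B β v R) (hη : Continuous η)
    (hW : IsBoundedRepresentative W η) {t₀ : ℝ} (ht₀ : 0 ≤ t₀) (r : ℝ) :
    Tendsto (fun t => eLpNorm (fun x => (∑' j, R j t x + W t x) - (∑' j, R j t₀ x + W t₀ x)) 2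
      (volume.restrict (Icc (-r) r))) (𝓝[Ici 0] t₀) (𝓝 0) := by
  have aestronglyMeasurable_tsum (t : ℝ) := (h.continuous_tsum.comp
    (Continuous.prodMk_right t)).aestronglyMeasurable (μ := volume.restrict (Icc (-r) r))
  have aestronglyMeasurable_W (t : ℝ) := (hW.stronglyMeasurable_slice t).aestronglyMeasurable
    (μ := volume.restrict (Icc (-r) r))
  have sum_tendsto := ((h.tendsto_eLpNorm_tsum_sub t₀ r).mono_left nhdsWithin_le_nhds).add
    (hW.tendsto_eLpNorm_sub hη ht₀ (Icc (-r) r))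
  rw [add_zero] at sum_tendsto
  refine tendsto_of_tendsto_of_tendsto_of_le_of_le tendsto_const_nhds sum_tendsto
    (fun _ => zero_le) fun t => ?_
  simp only [add_sub_add_comm]
  exact eLpNorm_add_le ((aestronglyMeasurable_tsum t).sub (aestronglyMeasurable_tsum t₀))
    ((aestronglyMeasurable_W t).sub (aestronglyMeasurable_W t₀)) one_le_two

variable {g : ℝ → ℝ}

theorem truncF_eq_nlsF (h : Train α lam B β v R) (j : ℕ) (t x : ℝ) :
    truncF g (R j t x) = nlsF g (R j t x) :=
  _root_.truncF_eq_nlsF (((h.norm_le_tsum j t x).trans (h.tsum_envelope_le_one t x)).trans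
    one_le_two)

theorem isNLSSolution (h : Train α lam B β v R) (hF : PowerLipschitz (truncF g) L α)
    (hR : ∀ j χ, IsTest χ → ∫ p : ℝ × ℝ,
      (R j p.1 p.2 * adjointSchrodinger χ p + nlsF g (R j p.1 p.2) * χ p) = 0)
    (hη : IsRemainder (truncF g) R lam ε K η G) (hW : IsBoundedRepresentative W η) :
    IsNLSSolution g fun t x => ∑' j, R j t x + W t x := by
  have stronglyMeasurable_u := h.stronglyMeasurable_tsum_add hW
  have norm_u_le (t x : ℝ) := h.norm_tsum_add_le_two t x (hW.norm_le_one t x)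
  have nlsF_u (t x : ℝ) : nlsF g (∑' j, R j t x + W t x) = truncF g (∑' j, R j t x + W t x) :=
    (_root_.truncF_eq_nlsF (norm_u_le t x)).symm
  refine ⟨fun t _ r => ?_, fun t₀ ht₀ r => h.tendsto_eLpNorm_tsum_add_sub hη.continuous hW ht₀ r,
    ?_, ?_, fun χ smooth compact tsupport_subset => ?_⟩
  · exact MemLp.of_bound (stronglyMeasurable_u.comp_measurable
      measurable_prodMk_left).aestronglyMeasurable 2 (Eventually.of_forall (norm_u_le t))
  · exact (locallyIntegrable_of_norm_le stronglyMeasurable_u.aestronglyMeasurable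
      fun p => norm_u_le p.1 p.2).locallyIntegrableOn _
  · simp only [nlsF_u]
    exact (locallyIntegrable_of_norm_le
      (hF.continuous.comp_stronglyMeasurable stronglyMeasurable_u).aestronglyMeasurable
      fun p => h.norm_comp_tsum_add_le hF p.1 p.2 (hW.norm_le_one p.1 p.2)).locallyIntegrableOn _
  · have hχ : IsTest χ := ⟨smooth, compact⟩
    simp only [hχ.deriv_add_iteratedDeriv_eq, nlsF_u]
    refine h.integral_solution_eq_zero hF hη hW hχ (fun t ht x => ?_) fun j => ?_
    · exact image_eq_zero_of_notMem_tsupport fun hmem =>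
        (tsupport_subset hmem).1.not_ge ht
    · simpa only [h.truncF_eq_nlsF] using hR j χ hχ

end Train

/-! ### Frequencies and velocities -/

/-- The velocities of a soliton train with decay rates `β`, for which consecutive waves separate at
rate `lam`. -/
noncomputable def trainVelocity (lam : ℝ) (β : ℕ → ℝ) (j : ℕ) : ℝ := 2 * lam * j / β j

section TrainVelocity

variable {lam : ℝ} {β : ℕ → ℝ}

theorem mul_trainVelocity {j : ℕ} (hβ : 0 < β j) (lam : ℝ) :
    β j * trainVelocity lam β j = 2 * lam * j :=
  mul_div_cancel₀ _ hβ.ne'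

theorem trainVelocity_nonneg (hlam : 0 ≤ lam) {j : ℕ} (hβ : 0 < β j) :
    0 ≤ trainVelocity lam β j := by
  rw [trainVelocity]
  positivity

theorem strictMono_trainVelocity (hlam : 0 < lam) (hβ0 : ∀ j, 0 < β j) (hβ : Antitone β) :
    StrictMono (trainVelocity lam β) := strictMono_nat_of_lt_succ fun j =>
  calc 2 * lam * (j : ℝ) / β j ≤ 2 * lam * j / β (j + 1) :=
        div_le_div_of_nonneg_left (by positivity) (hβ0 _) (hβ j.le_succ)
    _ < 2 * lam * ((j + 1 : ℕ) : ℝ) / β (j + 1) := by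
        have := hβ0 (j + 1)
        gcongr
        exact j.lt_succ_self

theorem two_mul_le_mul_abs_sub_trainVelocity_add (hlam : 0 ≤ lam) (hβ0 : ∀ j, 0 < β j)
    (hβ : Antitone β) {j n : ℕ} (hjn : j < n) {t : ℝ} (ht : 0 ≤ t) (x : ℝ) :
    2 * lam * t ≤
      β j * |x - trainVelocity lam β j * t| + β n * |x - trainVelocity lam β n * t| := by
  set vj := trainVelocity lam β j with vj_def
  set vn := trainVelocity lam β n with vn_def
  have succ_le : (j : ℝ) + 1 ≤ n := by exact_mod_cast hjn
  have relative_speed : 2 * lam ≤ β n * (vn - vj) := by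
    calc 2 * lam = 2 * lam * (j + 1) - 2 * lam * j := by ring
      _ ≤ 2 * lam * n - β j * vj := by
          rw [vj_def, mul_trainVelocity (hβ0 j)]
          gcongr
      _ ≤ β n * vn - β n * vj := by
          rw [vn_def, mul_trainVelocity (hβ0 n)]
          gcongr
          · exact trainVelocity_nonneg hlam (hβ0 j)
          · exact hβ hjn.le
      _ = β n * (vn - vj) := (mul_sub ..).symm
  have distance_le : (vn - vj) * t ≤ |x - vj * t| + |x - vn * t| := by
    linarith [le_abs_self (x - vj * t), neg_le_abs (x - vn * t)]
  calc 2 * lam * t ≤ β n * (vn - vj) * t := by gcongr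
    _ = β n * ((vn - vj) * t) := mul_assoc ..
    _ ≤ β n * (|x - vj * t| + |x - vn * t|) := mul_le_mul_of_nonneg_left distance_le (hβ0 n).le
    _ = β n * |x - vj * t| + β n * |x - vn * t| := mul_add ..
    _ ≤ β j * |x - vj * t| + β n * |x - vn * t| := by
        gcongr
        exact hβ hjn.le

end TrainVelocity

theorem trainSeq_trainVelocity {α lam : ℝ} {B β : ℕ → ℝ} (hα : 1 ≤ α) (hlam : 0 < lam)
    (hB0 : ∀ j, 0 ≤ B j) (hB : ∀ j, B j ≤ (1 / 4 : ℝ) ^ (j + 1)) (hβ0 : ∀ j, 0 < β j)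
    (hβ2 : ∀ j, β j ≤ 2) (hβ : Antitone β)
    (hw : ∀ j : ℕ, (2 ^ (j + 1) * B j) ^ α * Real.exp j * (2 / β j) ≤ (1 / 2 : ℝ) ^ (j + 1)) :
    TrainSeq α lam B β (trainVelocity lam β) where
  one_le := hα
  lam_pos := hlam
  B_nonneg := hB0
  B_le := hB
  β_pos := hβ0
  β_le := hβ2
  weight_le := hw
  separated j n hjn t ht x :=
    two_mul_le_mul_abs_sub_trainVelocity_add hlam.le hβ0 hβ hjn ht x
  speed_le j := by
    rw [abs_of_nonneg (trainVelocity_nonneg hlam.le (hβ0 j)), mul_trainVelocity (hβ0 j)]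

/-- The scale of the `j`-th wave of a train.  A frequency `(geometricScale k j) ^ (2 * α)` makes its
amplitude and decay rate proportional to the powers `2` and `α` of the scale. -/
noncomputable def geometricScale (k : ℝ) (j : ℕ) : ℝ := k * (1 / 16) ^ (j + 1)

section GeometricScale

variable {k : ℝ}

theorem geometricScale_pos (hk : 0 < k) (j : ℕ) : 0 < geometricScale k j := by
  rw [geometricScale]
  positivity

theorem geometricScale_lt (hk : 0 < k) (j : ℕ) : geometricScale k j < k :=
  mul_lt_of_lt_one_right hk (pow_lt_one₀ (by norm_num) (by norm_num) j.succ_ne_zero)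

theorem antitone_geometricScale (hk : 0 ≤ k) : Antitone (geometricScale k) := fun i j hij =>
  mul_le_mul_of_nonneg_left
    (pow_le_pow_of_le_one (by norm_num) (by norm_num) (Nat.succ_le_succ hij)) hk

theorem mul_geometricScale_sq_le {D : ℝ} (hk : 0 < k) (hk1 : k ≤ 1) (hkD : D * k ≤ 1) (j : ℕ) :
    D * geometricScale k j ^ 2 ≤ (1 / 4 : ℝ) ^ (j + 1) :=
  calc D * geometricScale k j ^ 2 = D * k * geometricScale k j * (1 / 16 : ℝ) ^ (j + 1) := by
        rw [geometricScale]
        ring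
    _ ≤ 1 * 1 * (1 / 4 : ℝ) ^ (j + 1) := by
        have := geometricScale_pos hk j
        gcongr
        · exact (geometricScale_lt hk j).le.trans hk1
        · norm_num
    _ = (1 / 4 : ℝ) ^ (j + 1) := by ring

theorem rpow_two_pow_mul_geometricScale_sq_le {D α : ℝ} (hα : 1 ≤ α) (hk : 0 < k) (hD : 0 ≤ D)
    (hkD : D * k ≤ 1) (j : ℕ) :
    (2 ^ (j + 1) * (D * geometricScale k j ^ 2)) ^ α ≤
      D * k * (1 / 8) ^ (j + 1) * geometricScale k j ^ α := by
  have base_eq : 2 ^ (j + 1) * (D * geometricScale k j ^ 2) =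
      D * k * (1 / 8) ^ (j + 1) * geometricScale k j := by
    rw [show (1 / 8 : ℝ) = 2 * (1 / 16) by norm_num, mul_pow, geometricScale]
    ring
  have scale_pos := geometricScale_pos hk j
  rw [base_eq, Real.mul_rpow (by positivity) scale_pos.le]
  gcongr
  exact Real.rpow_le_self_of_le_one (by positivity)
    (mul_le_one₀ hkD (by positivity) (pow_le_one₀ (by norm_num) (by norm_num))) hα

theorem exp_natCast_le_four_pow (j : ℕ) : Real.exp j ≤ 4 ^ j := by
  rw [← Real.exp_one_pow]
  exact pow_le_pow_left₀ (Real.exp_pos _).le (by linarith [Real.exp_one_lt_three]) j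

theorem weight_geometricScale_le {D α a : ℝ} (hα : 1 ≤ α) (hk : 0 < k) (hD : 0 ≤ D) (ha : 0 < a)
    (hkD : D * k ≤ 1) (hkDa : 2 * (D * k) ≤ a) (j : ℕ) :
    (2 ^ (j + 1) * (D * geometricScale k j ^ 2)) ^ α * Real.exp j *
      (2 / (a * geometricScale k j ^ α)) ≤ (1 / 2 : ℝ) ^ (j + 1) := by
  have power_pos := Real.rpow_pos_of_pos (geometricScale_pos hk j) α
  calc (2 ^ (j + 1) * (D * geometricScale k j ^ 2)) ^ α * Real.exp j *
        (2 / (a * geometricScale k j ^ α))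
      ≤ D * k * (1 / 8) ^ (j + 1) * geometricScale k j ^ α * 4 ^ (j + 1) *
        (2 / (a * geometricScale k j ^ α)) := by
        gcongr
        · exact rpow_two_pow_mul_geometricScale_sq_le hα hk hD hkD j
        · exact (exp_natCast_le_four_pow j).trans (pow_le_pow_right₀ (by norm_num) j.le_succ)
    _ = 2 * (D * k) / a * ((1 / 8) * 4) ^ (j + 1) := by
        rw [mul_pow]
        field_simp
    _ ≤ 1 * ((1 / 8) * 4) ^ (j + 1) := by
        gcongr
        exact (div_le_one ha).2 hkDa
    _ = (1 / 2 : ℝ) ^ (j + 1) := by norm_num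

end GeometricScale

theorem exists_trainSeq {ωs a D α lam : ℝ} (hωs : 0 < ωs) (ha : 0 < a) (ha1 : a < 1) (hD : 0 < D)
    (hα : 1 ≤ α) (hlam : 0 < lam) :
    ∃ ω v : ℕ → ℝ, (∀ j, 0 < ω j ∧ ω j < ωs) ∧ Function.Injective v ∧
      TrainSeq α lam (fun j => D * ω j ^ (1 / α)) (fun j => a * ω j ^ (1 / 2 : ℝ)) v := by
  obtain ⟨k, k_pos, k_le⟩ : ∃ k, 0 < k ∧ k ≤ min (min 1 ωs) (a / (2 * D)) :=
    ⟨_, lt_min (lt_min one_pos hωs) (by positivity), le_rfl⟩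
  simp only [le_min_iff, le_div_iff₀ (mul_pos two_pos hD)] at k_le
  obtain ⟨⟨k_le_one, k_le_ωs⟩, k_mul_le⟩ := k_le
  have scale_pos := geometricScale_pos k_pos
  have scale_le_one (j : ℕ) := (geometricScale_lt k_pos j).le.trans k_le_one
  have amplitude_eq (j : ℕ) :
      (geometricScale k j ^ (2 * α)) ^ (1 / α) = geometricScale k j ^ 2 := by
    rw [← Real.rpow_mul (scale_pos j).le, mul_one_div, mul_div_cancel_right₀ _ (by linarith),
      Real.rpow_two]
  have rate_eq (j : ℕ) : (geometricScale k j ^ (2 * α)) ^ (1 / 2 : ℝ) = geometricScale k j ^ α := by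
    rw [← Real.rpow_mul (scale_pos j).le, mul_one_div, mul_div_cancel_left₀ _ two_ne_zero]
  set β : ℕ → ℝ := fun j => a * geometricScale k j ^ α
  have β_pos (j : ℕ) : 0 < β j := mul_pos ha (Real.rpow_pos_of_pos (scale_pos j) _)
  have β_le (j : ℕ) : β j ≤ 2 :=
    (mul_le_of_le_one_right ha.le (Real.rpow_le_one (scale_pos j).le (scale_le_one j)
      (by linarith))).trans (by linarith)
  have antitone_β : Antitone β := fun i j hij => mul_le_mul_of_nonneg_left
    (Real.rpow_le_rpow (scale_pos j).le (antitone_geometricScale k_pos.le hij) (by linarith)) ha.le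
  refine ⟨fun j => geometricScale k j ^ (2 * α), trainVelocity lam β,
    fun j => ⟨Real.rpow_pos_of_pos (scale_pos j) _, ?_⟩,
    (strictMono_trainVelocity hlam β_pos antitone_β).injective, ?_⟩
  · calc geometricScale k j ^ (2 * α) ≤ geometricScale k j :=
          Real.rpow_le_self_of_le_one (scale_pos j).le (scale_le_one j) (by linarith)
      _ < ωs := (geometricScale_lt k_pos j).trans_le k_le_ωs
  · simp only [amplitude_eq, rate_eq]
    exact trainSeq_trainVelocity hα hlam (fun j => by positivity)
      (mul_geometricScale_sq_le k_pos k_le_one (by linarith)) β_pos β_le antitone_β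
      (weight_geometricScale_le hα k_pos hD.le ha (by linarith) (by linarith))

theorem soliton_ae_eq {φ ψ : ℝ → ℝ} (h : φ =ᵐ[volume] ψ) (ω v x₀ γ t : ℝ) :
    soliton φ ω v x₀ γ t =ᵐ[volume] soliton ψ ω v x₀ γ t := by
  have measurePreserving_shift : MeasurePreserving (fun x : ℝ => x - x₀ - v * t) volume volume :=
    (measurePreserving_sub_right volume (v * t)).comp (measurePreserving_sub_right volume x₀)
  filter_upwards [measurePreserving_shift.quasiMeasurePreserving.ae h] with x profile_eq
  rw [soliton, soliton, profile_eq]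

theorem soliton_ae_eq_prod {φ ψ : ℝ → ℝ} (h : φ =ᵐ[volume] ψ) (ω v x₀ γ : ℝ) :
    ∀ᵐ p : ℝ × ℝ, soliton φ ω v x₀ γ p.1 p.2 = soliton ψ ω v x₀ γ p.1 p.2 := by
  have quasiMeasurePreserving_shift : Measure.QuasiMeasurePreserving
      (fun p : ℝ × ℝ => p.2 - x₀ - v * p.1) (volume.prod volume) volume :=
    QuasiMeasurePreserving.prod_of_right (by fun_prop) (Eventually.of_forall fun t =>
      ((measurePreserving_sub_right volume (v * t)).comp
        (measurePreserving_sub_right volume x₀)).quasiMeasurePreserving)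
  rw [Measure.volume_eq_prod]
  filter_upwards [quasiMeasurePreserving_shift.ae h] with p profile_eq
  rw [soliton, soliton, profile_eq]

theorem IsNLSSolution.congr {g : ℝ → ℝ} {u u' : ℝ → ℝ → ℂ} (hu : IsNLSSolution g u)
    (hslice : ∀ t, u t =ᵐ[volume] u' t) (hprod : ∀ᵐ p : ℝ × ℝ, u p.1 p.2 = u' p.1 p.2) :
    IsNLSSolution g u' where
  memLp_loc t ht r := (memLp_congr_ae (ae_restrict_of_ae (hslice t))).1 (hu.memLp_loc t ht r)
  continuous_loc t₀ ht₀ r := (hu.continuous_loc t₀ ht₀ r).congr fun t =>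
    eLpNorm_congr_ae (ae_restrict_of_ae ((hslice t).sub (hslice t₀)))
  locallyIntegrable := hu.locallyIntegrable.congr (ae_restrict_of_ae hprod)
  locallyIntegrable_nonlinearity := hu.locallyIntegrable_nonlinearity.congr
    (ae_restrict_of_ae (hprod.mono fun _ => congrArg (nlsF g)))
  equation χ smooth compact tsupport_subset := by
    rw [← hu.equation χ smooth compact tsupport_subset]
    refine integral_congr_ae ?_
    filter_upwards [hprod] with p u_eq
    rw [u_eq]

theorem normL2Linfty_le {w : ℝ → ℂ} {f : L2Line} (hw : w =ᵐ[volume] f) {C : ℝ} (h2 : ‖f‖ ≤ C)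
    (hsup : ∀ᵐ x, ‖f x‖ ≤ C) : normL2Linfty w ≤ ENNReal.ofReal (2 * C) := by
  have C_nonneg : 0 ≤ C := (norm_nonneg _).trans h2
  rw [normL2Linfty, two_mul, ENNReal.ofReal_add C_nonneg C_nonneg, eLpNorm_congr_ae hw,
    eLpNorm_congr_ae hw, ← Lp.enorm_def, ← ofReal_norm, eLpNorm_exponent_top]
  exact add_le_add (ENNReal.ofReal_le_ofReal h2) (eLpNormEssSup_le_of_ae_bound hsup)

theorem iSup_ofReal_exp_mul_le {lam C : ℝ} {N : ℝ → ENNReal}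
    (hN : ∀ t, 0 ≤ t → N t ≤ ENNReal.ofReal (C * Real.exp (-lam * t))) :
    ⨆ (t : ℝ) (_ : 0 ≤ t), ENNReal.ofReal (Real.exp (lam * t)) * N t ≤ ENNReal.ofReal C := by
  refine iSup₂_le fun t ht => ?_
  calc ENNReal.ofReal (Real.exp (lam * t)) * N t
      ≤ ENNReal.ofReal (Real.exp (lam * t)) * ENNReal.ofReal (C * Real.exp (-lam * t)) := by
        gcongr
        exact hN t ht
    _ = ENNReal.ofReal C := by
        rw [← ENNReal.ofReal_mul (Real.exp_pos _).le, mul_left_comm, ← Real.exp_add, neg_mul,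
          add_neg_cancel, Real.exp_zero, mul_one]

theorem Train.exists_solution {α lam L ε : ℝ} {B β v : ℕ → ℝ} {R : ℕ → ℝ → ℝ → ℂ} {g : ℝ → ℝ}
    (h : Train α lam B β v R) (hF : PowerLipschitz (truncF g) L α)
    (hR : ∀ j χ, IsTest χ → ∫ p : ℝ × ℝ,
      (R j p.1 p.2 * adjointSchrodinger χ p + nlsF g (R j p.1 p.2) * χ p) = 0)
    (hε : ε ≤ 1) (hlam : AdmissibleRate L α ε lam) :
    ∃ W : ℝ → ℝ → ℂ, (∀ t, AEStronglyMeasurable (W t) volume) ∧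
      IsNLSSolution g (fun t x => ∑' j, R j t x + W t x) ∧
      ∀ t, 0 ≤ t → normL2Linfty (W t) ≤ ENNReal.ofReal (2 * ε * Real.exp (-lam * t)) := by
  obtain ⟨K, η, G, hη⟩ := h.exists_isRemainder hF hε hlam
  obtain ⟨W, hW⟩ := exists_isBoundedRepresentative hη.continuous fun t ht =>
    (hη.ae_norm_le t ht).mono fun x norm_le =>
      norm_le.trans (mul_le_one₀ hε (Real.exp_pos _).le (h.exp_neg_lam_mul_le_one ht))
  refine ⟨W, fun t => (hW.stronglyMeasurable_slice t).aestronglyMeasurable,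
    h.isNLSSolution hF hR hη hW, fun t ht => ?_⟩
  rw [mul_assoc]
  exact normL2Linfty_le (hW.ae_eq t ht) (hη.norm_le t ht) (hη.ae_norm_le t ht)

theorem AssumptionT.exists_train {g : ℝ → ℝ} {α ωs a D lam : ℝ} {φ : ℝ → ℝ → ℝ} {ω v : ℕ → ℝ}
    (hT : AssumptionT g α ωs a D φ) (hω : ∀ j, 0 < ω j ∧ ω j < ωs)
    (hseq : TrainSeq α lam (fun j => D * ω j ^ (1 / α)) (fun j => a * ω j ^ (1 / 2 : ℝ)) v) :
    ∃ ψ : ℕ → ℝ → ℝ, (∀ j, IsProfile g (ω j) (ψ j)) ∧ (∀ j, ψ j =ᵐ[volume] φ (ω j)) ∧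
      Train α lam (fun j => D * ω j ^ (1 / α)) (fun j => a * ω j ^ (1 / 2 : ℝ)) v
        (fun j => soliton (ψ j) (ω j) (v j) 0 0) := by
  choose ψ isProfile ae_eq abs_le using fun j => hT.exists_profile (hω j).1 (hω j).2
  refine ⟨ψ, isProfile, fun j => (ae_eq j).symm, hseq,
    fun j => continuous_soliton (isProfile j).continuous (ω j) (v j) 0 0, fun j t x => ?_⟩
  rw [norm_soliton, sub_zero, envelope, ← neg_mul, ← neg_mul]
  exact abs_le j (x - v j * t)

theorem theorem3p2_general (g : ℝ → ℝ) (C α ωs a D : ℝ) (hg : PowerDerivBound g C α)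
    (hα : 1 ≤ α) (ρ : ℝ) (hρ : 0 < ρ) :
    ∃ lam₀ : ℝ, 0 < lam₀ ∧
      ∀ φ : ℝ → ℝ → ℝ, AssumptionT g α ωs a D φ →
      ∀ lam : ℝ, lam₀ ≤ lam →
      ∃ (ω v γ : ℕ → ℝ) (η : ℝ → ℝ → ℂ),
        (∀ j, 0 < ω j ∧ ω j < ωs) ∧
        Function.Injective v ∧
        (∀ t : ℝ, 0 ≤ t → ∀ᵐ x : ℝ,
          Summable (fun j => ‖soliton (φ (ω j)) (ω j) (v j) 0 (γ j) t x‖)) ∧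
        (∀ t : ℝ, 0 ≤ t → AEStronglyMeasurable (η t) volume) ∧
        IsNLSSolution g
          (fun t x => (∑' j, soliton (φ (ω j)) (ω j) (v j) 0 (γ j) t x) + η t x) ∧
        (⨆ (t : ℝ) (_ : 0 ≤ t), ENNReal.ofReal (Real.exp (lam * t)) * normL2Linfty (η t)) ≤
          ENNReal.ofReal ρ := by
  obtain ⟨lam₁, admissible⟩ := eventually_atTop.1 (eventually_admissibleRate (C / (α / 2) + 2 * C) α
    (show 0 < min 1 (ρ / 2) by positivity))
  refine ⟨max lam₁ 1, by positivity, fun φ hT lam hlam => ?_⟩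
  obtain ⟨lam₁_le, one_le⟩ := max_le_iff.1 hlam
  obtain ⟨ω, v, hω, hv, hseq⟩ := exists_trainSeq hT.ωs_pos hT.a_pos hT.a_lt_one hT.D_pos hα
    (one_pos.trans_le one_le)
  obtain ⟨ψ, isProfile, ψ_ae_eq, train⟩ := hT.exists_train hω hseq
  obtain ⟨W, measurable_W, solution, norm_W_le⟩ := train.exists_solution
    (hg.powerLipschitz_truncF hα)
    (fun j _ hχ => (isProfile j).soliton_equation hg.continuousOn (v j) 0 0 hχ) (min_le_left _ _)
    (admissible lam lam₁_le)
  have ae_eq (t : ℝ) := ae_all_iff.2 fun j => soliton_ae_eq (ψ_ae_eq j) (ω j) (v j) 0 0 t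
  have ae_eq_prod := ae_all_iff.2 fun j => soliton_ae_eq_prod (ψ_ae_eq j) (ω j) (v j) 0 0
  refine ⟨ω, v, fun _ => 0, W, hω, hv, fun t _ => ?_, fun t _ => measurable_W t,
    solution.congr (fun t => ?_) ?_, (iSup_ofReal_exp_mul_le norm_W_le).trans ?_⟩
  · exact (ae_eq t).mono fun x eq => by simpa only [eq] using train.summable_norm t x
  · exact (ae_eq t).mono fun x eq => by simp only [eq]
  · exact ae_eq_prod.mono fun p eq => by simp only [eq]
  · exact ENNReal.ofReal_le_ofReal (by linarith [min_le_right 1 (ρ / 2)])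

theorem theorem3p2 (g : ℝ → ℝ) (C₀ α₁ α₂ ωs a D : ℝ)
    (hF : AssumptionF g C₀ α₁ α₂) (hα₁ : 1 ≤ α₁) (ρ : ℝ) (hρ : 0 < ρ) :
    ∃ lam₀ : ℝ, 0 < lam₀ ∧
      ∀ φ : ℝ → ℝ → ℝ, AssumptionT g α₁ ωs a D φ →
      ∀ lam : ℝ, lam₀ ≤ lam →
      ∃ (ω v γ : ℕ → ℝ) (η : ℝ → ℝ → ℂ),
        (∀ j, 0 < ω j ∧ ω j < ωs) ∧
        Function.Injective v ∧
        (∀ t : ℝ, 0 ≤ t → ∀ᵐ x : ℝ,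
          Summable (fun j => ‖soliton (φ (ω j)) (ω j) (v j) 0 (γ j) t x‖)) ∧
        (∀ t : ℝ, 0 ≤ t → AEStronglyMeasurable (η t) volume) ∧
        IsNLSSolution g
          (fun t x => (∑' j, soliton (φ (ω j)) (ω j) (v j) 0 (γ j) t x) + η t x) ∧
        (⨆ (t : ℝ) (_ : 0 ≤ t), ENNReal.ofReal (Real.exp (lam * t)) * normL2Linfty (η t)) ≤
          ENNReal.ofReal ρ := by
  obtain ⟨C, hg⟩ := hF.exists_powerDerivBound
  exact theorem3p2_general g C α₁ ωs a D hg hα₁ ρ hρ
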